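/- (Nonnegativity of concentrations.) Let $A\subset\mathbb{R}^2$ be a bounded simply connected $C^2$-domain whose boundary is a closed regular $C^2$-curve, let $h>0$, and put $\Omega=A\times(-h,h)$, $\Sigma=\partial A\times(-h,h)$, $\Gamma_{\rm in}=A\times\{-h\}$, $\Gamma_{\rm out}=A\times\{h\}$, with $\nu$ the outer unit normal of $\Omega$ and $\nu_\Sigma$ the outer unit conormal of $\Sigma$ on $\partial\Sigma$. Let $1<p<\infty$, $T>0$, $N\in\mathbb{N}$, and let $d_i,d_i^\Sigma>0$ $(i=1,\dots,N)$ be constants. Assume: * (velocity) $u\in W^{1,p}((0,T),L^p(\Omega,\mathbb{R}^3))\cap L^p((0,T),W^{2,p}(\Omega,\mathbb{R}^3))$, $\operatorname{div}u=0$ in the distributional sense, and $u\cdot\nu\le 0$ on $\Gamma_{\rm in}$, $u\cdot\nu=0$ on $\Sigma$, $u\cdot\nu\ge 0$ on $\Gamma_{\rm out}$; * (sorption) for each $i$, $r_i^{\rm sorp}\in C^2(\mathbb{R}^2)$ with $\nabla r_i^{\rm sorp}\in BC^1(\mathbb{R}^2,\mathbb{R}^2)$; $r_i^{\rm sorp}(a,b)$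 is nondecreasing in $a$ and nonincreasing in $b$; and there are $k_i^{\rm ad},k_i^{\rm de}>0$ with $-k_i^{\rm de}b\le r_i^{\rm sorp}(a,b)\le k_i^{\rm ad}a$ for all $a,b\ge 0$; * (reaction) $r^{\rm ch}\in C^1([0,\infty)^N,\mathbb{R}^N)$; $r_i^{\rm ch}(y)\ge 0$ whenever $y\in[0,\infty)^N$ and $y_i=0$; and there are $M>0$ and $\kappa\ge 1$, where $\kappa=\frac{1}{1-p/2}$ if $5/3<p<2$, with $|r^{\rm ch}(y)|\le M(1+|y|^\kappa)$ and $|(r^{\rm ch})'(y)|\le M(1+|y|^{\kappa-1})$ for all $y\in[0,\infty)^N$. Let $f_i\in L^p((0,T)\times\Omega)$ with $f_i\ge 0$ a.e., and let data $g_i^{\rm in}\le 0$ a.e. on $(0,T)\times\Gamma_{\rm in}$, $c_{0,i}\ge 0$ a.e. in $\Omega$ and $c_{0,i}^\Sigma\ge 0$ a.e. on $\Sigma$ be given (no regularity is assumed beyond what follows from their being attained by the solution below). Suppose that $$c_i\in W^{1,p}((0,T),L^p(\Omega))\cap L^p((0,T),W^{2,p}(\Omega)),\qquad c_i^\Sigma\in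 W^{1,p}((0,T),L^p(\Sigma))\cap L^p((0,T),W^{2,p}(\Sigma))$$ form a strong $L^p$-solution, that is, for $i=1,\dots,N$, almost everywhere and in the sense of traces, $$\begin{aligned} \partial_t c_i+(u\cdot\nabla)c_i-d_i\Delta c_i&=f_i&&\text{in }(0,T)\times\Omega,\\ \partial_t c_i^\Sigma-d_i^\Sigma\Delta_\Sigma c_i^\Sigma&=r_i^{\rm sorp}(c_i,c_i^\Sigma)+r_i^{\rm ch}((c^\Sigma)^+)&&\text{on }(0,T)\times\Sigma,\\ (u\cdot\nu)c_i-d_i\partial_\nu c_i&=g_i^{\rm in}&&\text{on }(0,T)\times\Gamma_{\rm in},\\ -d_i\partial_\nu c_i&=r_i^{\rm sorp}(c_i,c_i^\Sigma)&&\text{on }(0,T)\times\Sigma,\\ -d_i\partial_\nu c_i&=0&&\text{on }(0,T)\times\Gamma_{\rm out},\\ -d_i^\Sigma\partial_{\nu_\Sigma}c_i^\Sigma&=0&&\text{on }(0,T)\times\partial\Sigma,\\ c_i|_{t=0}=c_{0,i}\ \text{ in }\Omega,&\qquad c_i^\Sigma|_{t=0}=c_{0,i}^\Sigma&&\text{on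 }\Sigma, \end{aligned}$$ where $y^+=(\max\{0,y_i\})_i$ and $\Delta_\Sigma$ is the Laplace–Beltrami operator of $\Sigma$. Then, for every $i$, $c_i\ge 0$ a.e. in $(0,T)\times\Omega$ and $c_i^\Sigma\ge 0$ a.e. on $(0,T)\times\Sigma$ with respect to the surface measure. -/

import Mathlib

open MeasureTheory Set Filter Topology

noncomputable section

namespace Catalysis

/-! ### Parabolic Sobolev classes and traces

Functions of time and space are functions on `ℝ × E`. The space
`W^{1,p}((0,T), L^p(G)) ∩ L^p((0,T), W^{2,p}(G))` is described through the distributional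
derivatives `∂_t`, `∂_j`, `∂_k ∂_j` on `(0,T) × G`. -/

section Sobolev

variable {E : Type*} [NormedAddCommGroup E] [NormedSpace ℝ E] [MeasureSpace E]

/-- The space-time set `(0,T) × G`. -/
def timeCyl (T : ℝ) (G : Set E) : Set (ℝ × E) := Ioo 0 T ×ˢ G

/-- Lebesgue measure in time on `(0,T)` times a measure `σ` in space. -/
def timeProd (T : ℝ) (σ : Measure E) : Measure (ℝ × E) := (volume.restrict (Ioo 0 T)).prod σ

/-- `g` is the distributional derivative of `f` on `(0,T) × G` in the space-time direction `v`. -/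
structure HasWeakDeriv (T : ℝ) (G : Set E) (v : ℝ × E) (f g : ℝ × E → ℝ) : Prop where
  locInt : LocallyIntegrableOn f (timeCyl T G)
  locInt_deriv : LocallyIntegrableOn g (timeCyl T G)
  byParts : ∀ φ : ℝ × E → ℝ, ContDiff ℝ (⊤ : ℕ∞) φ → HasCompactSupport φ →
    tsupport φ ⊆ timeCyl T G →
    ∫ q in timeCyl T G, f q * fderiv ℝ φ q v = - ∫ q in timeCyl T G, g q * φ q

/-- `ft`, `Df`, `D2f` are the weak derivatives `∂_t f`, `∂_j f`, `∂_k ∂_j f` on `(0,T) × G`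
(spatial derivatives in the directions `e j`), and `f` and all of them belong to
`L^p((0,T) × K)`. In the bulk `K = G`; for functions that are periodic in one variable, `K` is
one period of `G`. -/
structure HasParabolicJet {n : ℕ} (e : Fin n → E) (T : ℝ) (G K : Set E) (p : ENNReal)
    (f ft : ℝ × E → ℝ) (Df : Fin n → ℝ × E → ℝ) (D2f : Fin n → Fin n → ℝ × E → ℝ) : Prop where
  memLp : MemLp f p (volume.restrict (timeCyl T K))
  memLp_dt : MemLp ft p (volume.restrict (timeCyl T K))
  memLp_grad : ∀ j, MemLp (Df j) p (volume.restrict (timeCyl T K))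
  memLp_hess : ∀ j k, MemLp (D2f j k) p (volume.restrict (timeCyl T K))
  weak_dt : HasWeakDeriv T G (1, 0) f ft
  weak_grad : ∀ j, HasWeakDeriv T G (0, e j) f (Df j)
  weak_hess : ∀ j k, HasWeakDeriv T G (0, e k) (Df j) (D2f j k)

/-- For `f ∈ L^p((0,T), W^{2,p}(G))` with weak derivatives `Df`, `D2f`: the functions `w` and
`Dw j` are the boundary traces of `f` and of `∂_j f` with respect to the measure `σ` carried by
the boundary of `G`. Traces are the continuous extension of the restriction map on smooth
functions: they are the limits in `L^p((0,T) × ∂G)` of the boundary values of smooth functions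
(and of their first derivatives) which converge to `f` in `L^p((0,T), W^{2,p}(G))`. -/
def HasTrace {n : ℕ} (e : Fin n → E) (T : ℝ) (G : Set E) (σ : Measure E) (p : ENNReal)
    (f : ℝ × E → ℝ) (w : ℝ × E → ℝ) (Dw : Fin n → ℝ × E → ℝ) : Prop :=
  MemLp w p (timeProd T σ) ∧ (∀ j, MemLp (Dw j) p (timeProd T σ)) ∧
  ∃ (Df : Fin n → ℝ × E → ℝ) (D2f : Fin n → Fin n → ℝ × E → ℝ),
    (∀ j, HasWeakDeriv T G (0, e j) f (Df j)) ∧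
    (∀ j k, HasWeakDeriv T G (0, e k) (Df j) (D2f j k)) ∧
    ∃ V : ℕ → ℝ × E → ℝ, (∀ m, ContDiff ℝ (⊤ : ℕ∞) (V m)) ∧
      Tendsto (fun m => eLpNorm (fun q => V m q - f q) p (volume.restrict (timeCyl T G)))
        atTop (𝓝 0) ∧
      (∀ j, Tendsto (fun m => eLpNorm (fun q => fderiv ℝ (V m) q (0, e j) - Df j q) p
        (volume.restrict (timeCyl T G))) atTop (𝓝 0)) ∧
      (∀ j k, Tendsto (fun m => eLpNorm (fun q =>
        fderiv ℝ (fun q' => fderiv ℝ (V m) q' (0, e j)) q (0, e k) - D2f j k q) p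
        (volume.restrict (timeCyl T G))) atTop (𝓝 0)) ∧
      Tendsto (fun m => eLpNorm (fun q => V m q - w q) p (timeProd T σ)) atTop (𝓝 0) ∧
      (∀ j, Tendsto (fun m => eLpNorm (fun q => fderiv ℝ (V m) q (0, e j) - Dw j q) p
        (timeProd T σ)) atTop (𝓝 0))

/-- `f|_{t=0} = f₀` for `f ∈ W^{1,p}((0,T), L^p)`: the representative of `f` that is continuous
in time with values in `L^p` has the value `f₀` at time `0`, that is, `f(t) → f₀` in `L^p` as
`t → 0+` outside a null set of times. -/
def HasInitialValue (m : Measure E) (p : ENNReal) (f : ℝ × E → ℝ) (f₀ : E → ℝ) : Prop :=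
  Tendsto (fun t : ℝ => eLpNorm (fun x => f (t, x) - f₀ x) p m)
    (𝓝[>] (0 : ℝ) ⊓ ae (volume : Measure ℝ)) (𝓝 0)

end Sobolev

/-! ### The pore -/

/-- The plane `ℝ²`. -/
abbrev Plane := EuclideanSpace ℝ (Fin 2)

/-- The space `ℝ³ = ℝ² × ℝ`. -/
abbrev Space := Plane × ℝ

/-- The three coordinate directions of `ℝ³`. -/
def axis : Fin 3 → Space :=
  ![(EuclideanSpace.single 0 1, 0), (EuclideanSpace.single 1 1, 0), (0, 1)]

/-- The two coordinate directions of the `(s,z)`-plane. -/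
def surfAxis : Fin 2 → ℝ × ℝ := ![(1, 0), (0, 1)]

/-- The vector `v` turned clockwise by a right angle. -/
def turn (v : Plane) : Plane := !₂[v 1, -v 0]

/-- A pore: a height `h > 0` and a bounded simply connected planar `C²`-domain `A` whose boundary
is a closed regular `C²`-curve `γ`, given by arc length and positively oriented, so that
`(γ₂', -γ₁')` is the outer unit normal of `A`. -/
structure Pore where
  A : Set Plane
  h : ℝ
  /-- the length of `∂A` -/
  len : ℝ
  γ : ℝ → Plane
  h_pos : 0 < h
  len_pos : 0 < len
  isOpen : IsOpen A
  isBounded : Bornology.IsBounded A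
  isConnected : IsConnected A
  simplyConnected : SimplyConnectedSpace A
  contDiff : ContDiff ℝ 2 γ
  periodic : Function.Periodic γ len
  injOn : InjOn γ (Ico 0 len)
  unitSpeed : ∀ s, ‖deriv γ s‖ = 1
  frontier_eq : frontier A = range γ
  inner_side : ∀ s, ∀ᶠ τ in 𝓝[>] (0 : ℝ), γ s - τ • turn (deriv γ s) ∈ A
  outer_side : ∀ s, ∀ᶠ τ in 𝓝[>] (0 : ℝ), γ s + τ • turn (deriv γ s) ∉ A

namespace Pore

variable (P : Pore)

/-- The bulk `Ω = A × (-h, h)`. -/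
def bulk : Set Space := P.A ×ˢ Ioo (-P.h) P.h

/-- Parametrization of the inflow area `A × {-h}`. -/
def inlet (y : Plane) : Space := (y, -P.h)

/-- Parametrization of the outflow area `A × {h}`. -/
def outlet (y : Plane) : Space := (y, P.h)

/-- Parametrization of the active surface `Σ = ∂A × (-h, h)` by `(s, z)`. The metric of `Σ` in
these coordinates is `ds² + dz²`. -/
def lateral (x : ℝ × ℝ) : Space := (P.γ x.1, x.2)

/-- One period of the parameters of `Σ`. -/
def cell : Set (ℝ × ℝ) := Ioo 0 P.len ×ˢ Ioo (-P.h) P.h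

/-- All the parameters of `Σ`. -/
def strip : Set (ℝ × ℝ) := univ ×ˢ Ioo (-P.h) P.h

/-- The surface measure of the active surface `Σ`. -/
def surfaceMeasure : Measure Space := (volume.restrict P.cell).map P.lateral

/-- The surface measure of `∂Ω`. -/
def boundaryMeasure : Measure Space :=
  (volume.restrict P.A).map P.inlet + (volume.restrict P.A).map P.outlet + P.surfaceMeasure

/-- The length measure of `∂Σ = ∂A × {-h, h}` in the coordinates `(s, z)`. -/
def rimMeasure : Measure (ℝ × ℝ) :=
  (volume.restrict (Ioo 0 P.len)).map (fun s => (s, -P.h)) +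
    (volume.restrict (Ioo 0 P.len)).map (fun s => (s, P.h))

/-- The outer normal of `Ω` on the inflow area. -/
def normalIn : Fin 3 → ℝ := ![0, 0, -1]

/-- The outer normal of `Ω` on the outflow area. -/
def normalOut : Fin 3 → ℝ := ![0, 0, 1]

/-- The outer normal of `Ω` at the point `lateral (s, z)` of the active surface. -/
def normalLat (x : ℝ × ℝ) : Fin 3 → ℝ :=
  ![turn (deriv P.γ x.1) 0, turn (deriv P.γ x.1) 1, 0]

/-- A function on `(0,T) × Σ` in the coordinates `(t, s, z)`. -/
def pull (v : ℝ × Space → ℝ) (q : ℝ × (ℝ × ℝ)) : ℝ := v (q.1, P.lateral q.2)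

end Pore

/-! ### Assumptions on the velocity and on the rates -/

/-- `u ∈ W^{1,p}((0,T), L^p(Ω,ℝ³)) ∩ L^p((0,T), W^{2,p}(Ω,ℝ³))`, `u·ν ≤ 0` on the inflow area,
`u·ν = 0` on the active surface, `u·ν ≥ 0` on the outflow area, and `div u = 0` in the
distributional sense. -/
structure VelocityAssumption (P : Pore) (T : ℝ) (p : ENNReal) (u : Fin 3 → ℝ × Space → ℝ) :
    Prop where
  regular : ∀ j, ∃ ut Du D2u, HasParabolicJet axis T P.bulk P.bulk p (u j) ut Du D2u
  boundary : ∃ (w : Fin 3 → ℝ × Space → ℝ) (Dw : Fin 3 → Fin 3 → ℝ × Space → ℝ),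
    (∀ j, HasTrace axis T P.bulk P.boundaryMeasure p (u j) (w j) (Dw j)) ∧
    (∀ᵐ q ∂(volume.restrict (timeCyl T P.A)),
      ∑ j, w j (q.1, P.inlet q.2) * Pore.normalIn j ≤ 0) ∧
    (∀ᵐ q ∂(volume.restrict (timeCyl T P.cell)),
      ∑ j, w j (q.1, P.lateral q.2) * P.normalLat q.2 j = 0) ∧
    (∀ᵐ q ∂(volume.restrict (timeCyl T P.A)),
      0 ≤ ∑ j, w j (q.1, P.outlet q.2) * Pore.normalOut j)
  div_free : ∀ φ : ℝ × Space → ℝ, ContDiff ℝ (⊤ : ℕ∞) φ → HasCompactSupport φ →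
    tsupport φ ⊆ timeCyl T P.bulk →
    ∫ q in timeCyl T P.bulk, ∑ j, u j q * fderiv ℝ φ q (0, axis j) = 0

/-- `r ∈ C²(ℝ²)` with `∇r ∈ BC¹(ℝ², ℝ²)`. -/
def SorptionRegular (r : ℝ → ℝ → ℝ) : Prop :=
  ContDiff ℝ 2 (fun x : ℝ × ℝ => r x.1 x.2) ∧
  (∃ C, ∀ x, ‖fderiv ℝ (fun x : ℝ × ℝ => r x.1 x.2) x‖ ≤ C) ∧
  ∃ C, ∀ x, ‖fderiv ℝ (fderiv ℝ (fun x : ℝ × ℝ => r x.1 x.2)) x‖ ≤ C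

/-- The rate increases in the bulk concentration and decreases in the surface concentration. -/
def SorptionMonotone (r : ℝ → ℝ → ℝ) : Prop :=
  (∀ b, Monotone fun a => r a b) ∧ ∀ a, Antitone fun b => r a b

/-- Linear bounds for nonnegative concentrations. -/
def SorptionBounded (r : ℝ → ℝ → ℝ) : Prop :=
  ∃ kad kde : ℝ, 0 < kad ∧ 0 < kde ∧
    ∀ a b : ℝ, 0 ≤ a → 0 ≤ b → -kde * b ≤ r a b ∧ r a b ≤ kad * a

/-- The closed orthant `[0,∞)^N`. -/
def orthant (N : ℕ) : Set (EuclideanSpace ℝ (Fin N)) := {y | ∀ i, 0 ≤ y i}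

/-- `r i (y) ≥ 0` if `y ∈ [0,∞)^N` and `y i = 0`. -/
def QuasiPositive {N : ℕ} (r : EuclideanSpace ℝ (Fin N) → EuclideanSpace ℝ (Fin N)) : Prop :=
  ∀ i, ∀ y ∈ orthant N, y i = 0 → 0 ≤ r y i

/-- Polynomial growth of the reaction and of its Jacobian on `[0,∞)^N`, with an exponent
`κ ≥ 1` which is `1 / (1 - p/2)` if `5/3 < p < 2`. -/
def PolynomialGrowth {N : ℕ} (p : ℝ)
    (r : EuclideanSpace ℝ (Fin N) → EuclideanSpace ℝ (Fin N)) : Prop :=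
  ∃ M κ : ℝ, 0 < M ∧ 1 ≤ κ ∧ (5 / 3 < p → p < 2 → κ = 1 / (1 - p / 2)) ∧
    (∀ y ∈ orthant N, ‖r y‖ ≤ M * (1 + ‖y‖ ^ κ)) ∧
    ∀ y ∈ orthant N, ‖fderivWithin ℝ r (orthant N) y‖ ≤ M * (1 + ‖y‖ ^ (κ - 1))

/-- The extension `y ↦ r(y⁺)` of the reaction rate from `[0,∞)^N` to `ℝ^N`. -/
def extendPos {N : ℕ} (r : EuclideanSpace ℝ (Fin N) → EuclideanSpace ℝ (Fin N))
    (y : Fin N → ℝ) : EuclideanSpace ℝ (Fin N) :=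
  r (WithLp.toLp 2 fun i => max 0 (y i))

/-! ### Strong solutions -/

/-- `(c, cS)` is a strong `L^p`-solution on `(0,T)` of the system, for every species `i`,

* `∂_t c + u·∇c - d Δc = f` in `Ω`,
* `∂_t cS - dS Δ_Σ cS = rs(c, cS) + rc(cS⁺)` on `Σ`,
* `(u·ν) c - d ∂_ν c = g` on the inflow area,
* `-d ∂_ν c = rs(c, cS)` on `Σ`, `-d ∂_ν c = 0` on the outflow area,
* `-dS ∂_{ν_Σ} cS = 0` on `∂Σ`,
* `c = c₀` in `Ω` and `cS = cS₀` on `Σ` at time `0`.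

Here `cB`, `DcB`, `uB` are the traces of `c i`, `∇(c i)`, `u` on `∂Ω`, and functions on `Σ` are
written in the isometric coordinates `(s, z)`, where `Δ_Σ = ∂_s² + ∂_z²` and
`∂_{ν_Σ} = ±∂_z` at `z = ±h`. -/
def IsStrongSolution (P : Pore) {N : ℕ} (T : ℝ) (p : ENNReal) (d dS : Fin N → ℝ)
    (u : Fin 3 → ℝ × Space → ℝ) (rs : Fin N → ℝ → ℝ → ℝ)
    (rc : EuclideanSpace ℝ (Fin N) → EuclideanSpace ℝ (Fin N))
    (f g : Fin N → ℝ × Space → ℝ) (c₀ cS₀ : Fin N → Space → ℝ)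
    (c cS : Fin N → ℝ × Space → ℝ) : Prop :=
  ∃ (uB : Fin 3 → ℝ × Space → ℝ) (DuB : Fin 3 → Fin 3 → ℝ × Space → ℝ),
  (∀ j, HasTrace axis T P.bulk P.boundaryMeasure p (u j) (uB j) (DuB j)) ∧
  ∀ i : Fin N,
  ∃ (ct : ℝ × Space → ℝ) (Dc : Fin 3 → ℝ × Space → ℝ) (D2c : Fin 3 → Fin 3 → ℝ × Space → ℝ)
    (cB : ℝ × Space → ℝ) (DcB : Fin 3 → ℝ × Space → ℝ)
    (cSt : ℝ × (ℝ × ℝ) → ℝ) (DcS : Fin 2 → ℝ × (ℝ × ℝ) → ℝ)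
    (D2cS : Fin 2 → Fin 2 → ℝ × (ℝ × ℝ) → ℝ)
    (cR : ℝ × (ℝ × ℝ) → ℝ) (DcR : Fin 2 → ℝ × (ℝ × ℝ) → ℝ),
  -- regularity classes and traces
  HasParabolicJet axis T P.bulk P.bulk p (c i) ct Dc D2c ∧
  HasTrace axis T P.bulk P.boundaryMeasure p (c i) cB DcB ∧
  HasParabolicJet surfAxis T P.strip P.cell p (P.pull (cS i)) cSt DcS D2cS ∧
  HasTrace surfAxis T P.cell P.rimMeasure p (P.pull (cS i)) cR DcR ∧
  -- equation in the bulk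
  (∀ᵐ q ∂(volume.restrict (timeCyl T P.bulk)),
    ct q + ∑ j, u j q * Dc j q - d i * ∑ j, D2c j j q = f i q) ∧
  -- equation on the active surface
  (∀ᵐ q ∂(volume.restrict (timeCyl T P.cell)),
    cSt q - dS i * ∑ j, D2cS j j q =
      rs i (P.pull cB q) (P.pull (cS i) q) + extendPos rc (fun k => P.pull (cS k) q) i) ∧
  -- boundary condition on the inflow area
  (∀ᵐ q ∂(volume.restrict (timeCyl T P.A)),
    (∑ j, uB j (q.1, P.inlet q.2) * Pore.normalIn j) * cB (q.1, P.inlet q.2)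
      - d i * ∑ j, Pore.normalIn j * DcB j (q.1, P.inlet q.2) = g i (q.1, P.inlet q.2)) ∧
  -- boundary condition on the active surface
  (∀ᵐ q ∂(volume.restrict (timeCyl T P.cell)),
    -d i * ∑ j, P.normalLat q.2 j * P.pull (DcB j) q =
      rs i (P.pull cB q) (P.pull (cS i) q)) ∧
  -- boundary condition on the outflow area
  (∀ᵐ q ∂(volume.restrict (timeCyl T P.A)),
    -d i * ∑ j, Pore.normalOut j * DcB j (q.1, P.outlet q.2) = 0) ∧
  -- boundary condition on the rim of the active surface
  (∀ᵐ q ∂(timeProd T P.rimMeasure), -dS i * DcR 1 q = 0) ∧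
  -- initial conditions
  HasInitialValue (volume.restrict P.bulk) p (c i) (c₀ i) ∧
  HasInitialValue (volume.restrict P.cell) p (P.pull (cS i)) (fun x => cS₀ i (P.lateral x))

end Catalysis

end

open MeasureTheory Set Filter Topology

noncomputable section

/-! Fix one species. The total mass of the negative parts, the integral of `max 0 (-c)` over Ω plus
the integral of `max 0 (-cS)` over Σ, does not increase in time. It vanishes at time zero, hence
always. Other species enter only through the reaction rate, and there only its sign matters.

Formally, multiply both equations by the derivative of the negative part, b(s) = -1 for s < 0 and
b(s) = 0 otherwise, and integrate. Since b is nondecreasing, ∫ b(c) Δc is at most its boundary term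
(Kato's inequality). Since div u = 0, convection becomes a flux of the negative part through ∂Ω: it
is zero on Σ, has a good sign on the outflow area, and on the inflow area it combines with the
diffusive flux through g ≤ 0. The source satisfies f ≥ 0, and where cS is negative the reaction is
nonnegative, because the corresponding entry of its argument is cut off to 0. The sorption rate
enters the two balances with opposite signs and leaves (b(cS) - b(c)) rs(c, cS) on Σ. This is zero
if both concentrations are negative or both are nonnegative, and nonpositive otherwise by the sign
of rs. Testing for mass rather than energy makes this cancellation exact, so no Gronwall argument is
needed, and it keeps the test functions bounded, as p > 1 may be close to 1.

To make this rigorous, b is replaced by smooth increasing functions. Integrations by parts are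
carried out for smooth approximations (mollifications in the interior, the approximating sequences
of the trace definition at the boundary), and the nonnegative terms b'(c)|∇c|² are discarded before
the limit. Integrability of u·∇c is read off from the equation.

The main steps are the plane Green formula `UnitSpeedLoop.Bounds.green` and the divergence theorem
`Pore.integral_divergence`; the diffusion estimates `BulkApprox.kato`, `kato_along`, `kato_axial`;
the convection identity `BulkApprox.convection`; the balance `integral_negPart_mul_deriv_nonneg`;
and the conclusion `ae_eq_zero_of_mass_nonincreasing`. -/

namespace Catalysis

open scoped ContDiff Convolution Manifold

set_option linter.unusedSectionVars false

/-! ### Cutoff functions and integrals of derivatives -/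

section Calculus

variable {X : Type*} [NormedAddCommGroup X] [NormedSpace ℝ X] [FiniteDimensional ℝ X]

/-- Smooth cutoff functions: equal to `1` near a compact set `K`, supported in an open set `O`. -/
theorem exists_cutoff {K O : Set X} (hK : IsCompact K) (hO : IsOpen O) (hKO : K ⊆ O) :
    ∃ χ : X → ℝ, ContDiff ℝ ∞ χ ∧ HasCompactSupport χ ∧ tsupport χ ⊆ O ∧
      (∀ x, 0 ≤ χ x) ∧ (∀ x, χ x ≤ 1) ∧ ∃ W, IsOpen W ∧ K ⊆ W ∧ ∀ x ∈ W, χ x = 1 := by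
  have : ProperSpace X := FiniteDimensional.proper ℝ X
  -- Two intermediate compact sets are needed: χ is 1 on K₂, whose interior serves as W, and χ is
  -- supported in the interior of K₁, so that its closed support stays in K₁ and hence in O.
  obtain ⟨K₁, hK₁, hKK₁, hK₁O⟩ := exists_compact_between hK hO hKO
  obtain ⟨K₂, hK₂, hKK₂, hK₂K₁⟩ := exists_compact_between hK isOpen_interior hKK₁
  obtain ⟨χ, hχ, hr, hs, h1⟩ := exists_contMDiff_support_eq_eq_one_iff (n := ⊤) 𝓘(ℝ, X)
    (isOpen_interior (s := K₁)) hK₂.isClosed hK₂K₁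
  have hts : tsupport χ ⊆ K₁ := by
    rw [tsupport, hs]
    exact closure_minimal interior_subset hK₁.isClosed
  refine ⟨χ, hχ.contDiff, HasCompactSupport.of_support_subset_isCompact hK₁ ?_,
    hts.trans hK₁O, fun x => (hr ⟨x, rfl⟩).1, fun x => (hr ⟨x, rfl⟩).2,
    interior K₂, isOpen_interior, hKK₂, fun x hx => (h1 x).1 (interior_subset hx)⟩
  rw [hs]; exact interior_subset

/-- An increasing family of cutoff functions exhausting an open set. -/
theorem exists_cutoff_seq {O : Set X} (hO : IsOpen O) :
    ∃ χ : ℕ → X → ℝ, (∀ m, ContDiff ℝ ∞ (χ m)) ∧ (∀ m, HasCompactSupport (χ m)) ∧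
      (∀ m, tsupport (χ m) ⊆ O) ∧ (∀ m x, 0 ≤ χ m x) ∧ (∀ m x, χ m x ≤ 1) ∧
      ∀ x ∈ O, ∀ᶠ m in atTop, χ m x = 1 := by
  have : ProperSpace X := FiniteDimensional.proper ℝ X
  have : LocallyCompactSpace O := hO.locallyCompactSpace
  let e : CompactExhaustion O := default
  have hK : ∀ m, IsCompact ((↑) '' (e m) : Set X) := fun m =>
    (e.isCompact m).image continuous_subtype_val
  have hsub : ∀ m, ((↑) '' (e m) : Set X) ⊆ O := by
    rintro m _ ⟨x, -, rfl⟩; exact x.2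
  choose χ h1 h2 h3 h4 h5 W hW hKW hone using fun m => exists_cutoff (hK m) hO (hsub m)
  refine ⟨χ, h1, h2, h3, h4, h5, fun x hx => ?_⟩
  obtain ⟨m, hm⟩ := e.exists_mem ⟨x, hx⟩
  filter_upwards [eventually_ge_atTop m] with k hk
  exact hone k x (hKW k ⟨⟨x, hx⟩, e.subset hk hm, rfl⟩)

variable [MeasurableSpace X] [BorelSpace X] (μ : Measure X) [μ.IsAddHaarMeasure]

/-- The integral of a derivative of a compactly supported function vanishes. -/
theorem integral_fderiv_eq_zero {φ : X → ℝ} (hφ : ContDiff ℝ 1 φ) (hc : HasCompactSupport φ)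
    (v : X) : ∫ x, fderiv ℝ φ x v ∂μ = 0 := by
  have hd : Continuous fun x => fderiv ℝ φ x v :=
    (hφ.continuous_fderiv one_ne_zero).clm_apply continuous_const
  have hdc : HasCompactSupport fun x => fderiv ℝ φ x v :=
    (hc.fderiv ℝ).comp_left (g := fun A : X →L[ℝ] ℝ => A v) (by simp)
  -- Integration by parts needs a second factor. With χ = 1 near the support of φ, the product χ ∂φ
  -- is ∂φ and the product ∂χ φ vanishes.
  obtain ⟨χ, hχ, hχc, -, -, -, W, hW, hKW, hone⟩ :=
    exists_cutoff (K := tsupport φ) hc isOpen_univ (subset_univ _)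
  have hχ' : ∀ x ∈ tsupport φ, fderiv ℝ χ x = 0 := fun x hx => by
    have : χ =ᶠ[𝓝 x] fun _ => 1 := by
      filter_upwards [hW.mem_nhds (hKW hx)] with y hy using hone y hy
    rw [this.fderiv_eq]; simp
  have h0 : ∀ x, fderiv ℝ χ x v * φ x = 0 := fun x => by
    by_cases hx : x ∈ tsupport φ
    · simp [hχ' x hx]
    · simp [image_eq_zero_of_notMem_tsupport hx]
  have h1 : ∀ x, χ x * fderiv ℝ φ x v = fderiv ℝ φ x v := fun x => by
    by_cases hx : x ∈ tsupport φ
    · simp [hone x (hKW hx)]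
    · have : fderiv ℝ φ x = 0 := by
        by_contra h
        exact hx (support_fderiv_subset ℝ (f := φ) h)
      simp [this]
  have h2 : ∀ x, χ x * φ x = φ x := fun x => by
    by_cases hx : x ∈ tsupport φ
    · simp [hone x (hKW hx)]
    · simp [image_eq_zero_of_notMem_tsupport hx]
  have := integral_mul_fderiv_eq_neg_fderiv_mul_of_integrable (μ := μ) (f := χ) (g := φ) (v := v)
    (by simp only [h0]; exact integrable_zero _ _ _)
    (by simp only [h1]; exact hd.integrable_of_hasCompactSupport hdc)
    (by simp only [h2]; exact hφ.continuous.integrable_of_hasCompactSupport hc)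
    (fun x _ => (hχ.differentiable (by simp)) x)
    (fun x _ => (hφ.differentiable (by simp)) x)
  simpa [h0, h1] using this

end Calculus

/-! ### Limits of integrals of nonlinear compositions -/

section Limits

variable {Y : Type*} [MeasurableSpace Y] {μ : Measure Y}

/-- Passage to the limit in integrals of a bounded continuous function of strongly convergent
functions times an `L¹`-convergent function. -/
theorem tendsto_integral_comp_mul {ι : Type*} [Fintype ι] {F : ℕ → ι → Y → ℝ} {F' : ι → Y → ℝ}
    {G : ℕ → Y → ℝ} {G' : Y → ℝ} {B : (ι → ℝ) → ℝ} {k : Y → ℝ} {C D : ℝ}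
    (hB : Continuous B) (hBC : ∀ z, |B z| ≤ C) (hk : AEStronglyMeasurable k μ)
    (hkD : ∀ y, |k y| ≤ D)
    (hF : ∀ m i, AEStronglyMeasurable (F m i) μ) (hF' : ∀ i, AEStronglyMeasurable (F' i) μ)
    (hFF : ∀ i, Tendsto (fun m => eLpNorm (fun y => F m i y - F' i y) 1 μ) atTop (𝓝 0))
    (hG : ∀ m, AEStronglyMeasurable (G m) μ) (hG' : Integrable G' μ)
    (hGG : Tendsto (fun m => eLpNorm (fun y => G m y - G' y) 1 μ) atTop (𝓝 0)) :
    Tendsto (fun m => ∫ y, k y * (B (fun i => F m i y) * G m y) ∂μ) atTop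
      (𝓝 (∫ y, k y * (B (fun i => F' i y) * G' y) ∂μ)) := by
  have hBm : ∀ {H : ι → Y → ℝ}, (∀ i, AEStronglyMeasurable (H i) μ) →
      AEStronglyMeasurable (fun y => B fun i => H i y) μ := fun {H} hH =>
    hB.comp_aestronglyMeasurable
      (aemeasurable_pi_lambda _ fun i => (hH i).aemeasurable).aestronglyMeasurable
  -- Every subsequence has a further one along which F converges almost everywhere, and that is
  -- enough. Summing |F - F'| over the finite index set lets one extraction serve all components at
  -- once.
  refine tendsto_of_subseq_tendsto fun ns hns => ?_
  -- a subsequence along which `F` converges almost everywhere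
  have hsum : Tendsto (fun m => eLpNorm (fun y => (∑ i, |F (ns m) i y - F' i y|) - 0) 1 μ) atTop
      (𝓝 0) := by
    have h1 : Tendsto (fun m => ∑ i, eLpNorm (fun y => F (ns m) i y - F' i y) 1 μ) atTop
        (𝓝 (∑ _i : ι, 0)) := tendsto_finsetSum _ fun i _ => (hFF i).comp hns
    rw [Finset.sum_const_zero] at h1
    refine tendsto_of_tendsto_of_tendsto_of_le_of_le tendsto_const_nhds h1 (fun _ => zero_le)
      fun m => ?_
    have : (fun y => (∑ i, |F (ns m) i y - F' i y|) - 0) =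
        ∑ i, fun y => |F (ns m) i y - F' i y| := by
      ext y; simp
    simp only [this]
    refine (eLpNorm_sum_le (fun i _ => ?_) le_rfl).trans (Finset.sum_le_sum fun i _ => ?_)
    · exact ((hF _ i).sub (hF' i)).norm
    · exact (eLpNorm_norm (fun y => F (ns m) i y - F' i y)).le
  have hmeas : ∀ m, AEStronglyMeasurable (fun y => ∑ i, |F (ns m) i y - F' i y|) μ := fun m =>
    Finset.aestronglyMeasurable_fun_sum _ fun i _ => ((hF _ i).sub (hF' i)).norm
  obtain ⟨ms, hms, hae⟩ := (tendstoInMeasure_of_tendsto_eLpNorm one_ne_zero hmeas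
    aestronglyMeasurable_const hsum).exists_seq_tendsto_ae
  refine ⟨ms, ?_⟩
  have hnm : Tendsto (fun m => ns (ms m)) atTop atTop := hns.comp hms.tendsto_atTop
  have hFae : ∀ᵐ y ∂μ, Tendsto (fun m => fun i => F (ns (ms m)) i y) atTop
      (𝓝 fun i => F' i y) := by
    filter_upwards [hae] with y hy
    refine tendsto_pi_nhds.2 fun i => ?_
    refine tendsto_iff_norm_sub_tendsto_zero.2 ?_
    refine tendsto_of_tendsto_of_tendsto_of_le_of_le tendsto_const_nhds hy
      (fun _ => norm_nonneg _) fun m => ?_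
    exact Finset.single_le_sum (f := fun i => |F (ns (ms m)) i y - F' i y|)
      (fun i _ => abs_nonneg _) (Finset.mem_univ i)
  -- the part with the limit of `G`
  have hdom : Tendsto (fun m => ∫ y, k y * (B (fun i => F (ns (ms m)) i y) * G' y) ∂μ) atTop
      (𝓝 (∫ y, k y * (B (fun i => F' i y) * G' y) ∂μ)) := by
    refine tendsto_integral_of_dominated_convergence (fun y => D * (C * |G' y|))
      (fun m => hk.mul ((hBm (hF _)).mul hG'.1)) ((hG'.abs.const_mul C).const_mul D)
      (fun m => ae_of_all _ fun y => ?_) ?_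
    · rw [Real.norm_eq_abs, abs_mul, abs_mul]
      have := (abs_nonneg _).trans (hkD y)
      have := (abs_nonneg _).trans (hBC 0)
      exact mul_le_mul (hkD y) (mul_le_mul_of_nonneg_right (hBC _) (abs_nonneg _))
        (by positivity) (by positivity)
    · filter_upwards [hFae] with y hy
      exact (((hB.tendsto _).comp hy).mul_const _).const_mul _
  -- the remainder
  have hintg : ∀ {H : ι → Y → ℝ} {g : Y → ℝ}, (∀ i, AEStronglyMeasurable (H i) μ) →
      Integrable g μ → Integrable (fun y => k y * (B (fun i => H i y) * g y)) μ := fun hH hg =>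
    (hg.bdd_mul (c := C) (hBm hH) (ae_of_all _ fun y => hBC _)).bdd_mul (c := D) hk
      (ae_of_all _ fun y => hkD y)
  have hGae : ∀ᶠ m in atTop, Integrable (fun y => G (ns (ms m)) y - G' y) μ := by
    have := (hGG.comp hnm).eventually (gt_mem_nhds ENNReal.zero_lt_top)
    filter_upwards [this] with m hm
    exact memLp_one_iff_integrable.1 ⟨(hG _).sub hG'.1, hm⟩
  have hrem : Tendsto (fun m => ∫ y, k y * (B (fun i => F (ns (ms m)) i y) *
      (G (ns (ms m)) y - G' y)) ∂μ) atTop (𝓝 0) := by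
    have h0 : Tendsto (fun m => D * (C * (eLpNorm (fun y => G (ns (ms m)) y - G' y) 1 μ).toReal))
        atTop (𝓝 0) := by
      have := (ENNReal.tendsto_toReal ENNReal.zero_ne_top).comp (hGG.comp hnm)
      simpa using (this.const_mul C).const_mul D
    refine squeeze_zero_norm' ?_ h0
    filter_upwards [hGae] with m hm
    have h2 : (eLpNorm (fun y => G (ns (ms m)) y - G' y) 1 μ).toReal =
        ∫ y, |G (ns (ms m)) y - G' y| ∂μ := by
      rw [eLpNorm_one_eq_lintegral_enorm, ← integral_norm_eq_lintegral_enorm hm.1]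
      rfl
    rw [h2, ← integral_const_mul, ← integral_const_mul]
    refine norm_integral_le_of_norm_le ((hm.abs.const_mul C).const_mul D)
      (ae_of_all _ fun y => ?_)
    rw [Real.norm_eq_abs, abs_mul, abs_mul]
    have := (abs_nonneg _).trans (hkD y)
    have := (abs_nonneg _).trans (hBC 0)
    exact mul_le_mul (hkD y) (mul_le_mul_of_nonneg_right (hBC _) (abs_nonneg _))
      (by positivity) (by positivity)
  have := hrem.add hdom
  rw [zero_add] at this
  refine this.congr' ?_
  filter_upwards [hGae] with m hm
  rw [← integral_add (hintg (hF _) hm) (hintg (hF _) hG')]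
  congr 1; ext y; ring

end Limits

/-! ### Mollification and its compatibility with weak derivatives -/

section Mollification

variable {X : Type*} [NormedAddCommGroup X] [NormedSpace ℝ X] [FiniteDimensional ℝ X]

/-- Bump functions shrinking to the origin. -/
def shrinkingBump (X : Type*) [NormedAddCommGroup X] [NormedSpace ℝ X] (m : ℕ) :
    ContDiffBump (0 : X) where
  rIn := 1 / (2 * ((m : ℝ) + 1))
  rOut := 1 / ((m : ℝ) + 1)
  rIn_pos := by positivity
  rIn_lt_rOut := by
    apply one_div_lt_one_div_of_lt <;> nlinarith [(Nat.cast_nonneg m : (0 : ℝ) ≤ m)]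

theorem shrinkingBump_rOut (m : ℕ) : (shrinkingBump X m).rOut = 1 / ((m : ℝ) + 1) := rfl

variable [MeasurableSpace X] [BorelSpace X] (μ : Measure X) [μ.IsAddHaarMeasure]

/-- Convolution with the normalized bump functions. -/
def mollify (m : ℕ) (f : X → ℝ) : X → ℝ :=
  (shrinkingBump X m).normed μ ⋆[ContinuousLinearMap.lsmul ℝ ℝ, μ] f

theorem mollify_contDiff (m : ℕ) {f : X → ℝ} (hf : Integrable f μ) :
    ContDiff ℝ ∞ (mollify μ m f) :=
  (shrinkingBump X m).hasCompactSupport_normed.contDiff_convolution_left (n := ⊤) _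
    (shrinkingBump X m).contDiff_normed hf.locallyIntegrable

theorem mollify_integrable (m : ℕ) {f : X → ℝ} (hf : Integrable f μ) :
    Integrable (mollify μ m f) μ :=
  ((shrinkingBump X m).integrable_normed).integrable_convolution _ hf

theorem integral_abs_mollify_le (m : ℕ) {f : X → ℝ} (hf : Integrable f μ) :
    ∫ x, |mollify μ m f x| ∂μ ≤ ∫ x, |f x| ∂μ := by
  have h1 : ∫ x, mollify μ m (fun x => |f x|) x ∂μ = ∫ x, |f x| ∂μ := by
    rw [mollify, integral_convolution _ (shrinkingBump X m).integrable_normed hf.abs,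
      (shrinkingBump X m).integral_normed]
    simp
  rw [← h1]
  refine integral_mono (mollify_integrable μ m hf).abs (mollify_integrable μ m hf.abs) fun x => ?_
  simp only [mollify, convolution_def, ContinuousLinearMap.lsmul_apply, smul_eq_mul]
  refine (abs_integral_le_integral_abs).trans_eq ?_
  congr 1; ext t
  rw [abs_mul, abs_of_nonneg ((shrinkingBump X m).nonneg_normed _)]

theorem mollify_sub (m : ℕ) {f g : X → ℝ} (hf : Integrable f μ) (hg : Integrable g μ) (x : X) :
    mollify μ m (fun x => f x - g x) x = mollify μ m f x - mollify μ m g x := by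
  have h := fun {f : X → ℝ} (hf : Integrable f μ) =>
    ((shrinkingBump X m).hasCompactSupport_normed (μ := μ)).convolutionExists_left
      (ContinuousLinearMap.lsmul ℝ ℝ) (shrinkingBump X m).continuous_normed
      hf.locallyIntegrable x
  have h1 := (h hf).integrable
  have h2 := (h hg).integrable
  simp only [mollify, convolution_def]
  rw [← integral_sub h1 h2]
  congr 1; ext t; simp [mul_sub]

/-- Mollifications converge in `L¹`. -/
theorem tendsto_integral_abs_mollify_sub {f : X → ℝ} (hf : Integrable f μ) :
    Tendsto (fun m => ∫ x, |mollify μ m f x - f x| ∂μ) atTop (𝓝 0) := by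
  have : ProperSpace X := FiniteDimensional.proper ℝ X
  refine Metric.tendsto_atTop.2 fun ε hε => ?_
  obtain ⟨g, hgc, hfg, hg, hgi⟩ :=
    hf.exists_hasCompactSupport_integral_sub_le (ε := ε / 4) (by positivity)
  -- All bump radii are at most 1, so this compact set carries g and all its mollifications. Uniform
  -- continuity of g then bounds the error by ε / (4 (V + 1)) on K; the summand 1 guards against V =
  -- 0.
  set K := Metric.cthickening 1 (tsupport g) with hKdef
  have hK : IsCompact K := hgc.isCompact.cthickening
  set V := μ.real K
  have hV : 0 ≤ V := measureReal_nonneg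
  obtain ⟨δ, hδ, hgδ⟩ := Metric.uniformContinuous_iff.1
    (hgc.uniformContinuous_of_continuous hg) (ε / (4 * (V + 1))) (by positivity)
  obtain ⟨M, hM⟩ := exists_nat_gt (1 / δ)
  refine ⟨M, fun m hm => ?_⟩
  have hrout : (shrinkingBump X m).rOut < δ := by
    rw [shrinkingBump_rOut, div_lt_comm₀ (by positivity) hδ]
    have : (M : ℝ) ≤ m := by exact_mod_cast hm
    linarith
  have hpt : ∀ x, |mollify μ m g x - g x| ≤ K.indicator (fun _ => ε / (4 * (V + 1))) x := by
    intro x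
    by_cases hx : x ∈ K
    · rw [indicator_of_mem hx]
      refine (shrinkingBump X m).dist_normed_convolution_le (g := g) hg.aestronglyMeasurable
        fun y hy => (hgδ ?_).le
      exact (Metric.mem_ball.1 hy).trans hrout
    · rw [indicator_of_notMem hx]
      have hz : ∀ y, dist y x ≤ 1 → g y = 0 := fun y hy => by
        refine image_eq_zero_of_notMem_tsupport fun hy' => hx ?_
        exact Metric.mem_cthickening_of_dist_le x y 1 _ hy' (by rwa [dist_comm])
      have h0 : mollify μ m g x = g x := by
        refine (shrinkingBump X m).normed_convolution_eq_right fun y hy => ?_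
        have : dist y x ≤ 1 := by
          refine (Metric.mem_ball.1 hy).le.trans ?_
          rw [shrinkingBump_rOut]
          exact div_le_one_of_le₀ (by linarith [(Nat.cast_nonneg m : (0 : ℝ) ≤ m)])
            (by positivity)
        rw [hz y this, hz x (by simp)]
      simp [h0]
  have h1 : ∫ x, |mollify μ m g x - g x| ∂μ ≤ ε / 4 := by
    have hi : Integrable (K.indicator fun _ => ε / (4 * (V + 1))) μ :=
      (integrable_indicator_iff hK.measurableSet).2 (integrableOn_const hK.measure_lt_top.ne)
    refine (integral_mono ((mollify_integrable μ m hgi).sub hgi).abs hi hpt).trans ?_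
    rw [integral_indicator hK.measurableSet, setIntegral_const, smul_eq_mul]
    change V * _ ≤ _
    rw [← mul_div_assoc, div_le_div_iff₀ (by positivity) (by positivity)]
    nlinarith
  have h2 : ∫ x, |mollify μ m f x - mollify μ m g x| ∂μ ≤ ε / 4 := by
    have := integral_abs_mollify_le μ m (hf.sub hgi)
    refine le_trans (le_of_eq ?_) (this.trans hfg)
    congr 1; ext x
    rw [← mollify_sub μ m hf hgi]
    rfl
  have hfg' : ∫ x, |g x - f x| ∂μ ≤ ε / 4 := by
    refine le_trans (le_of_eq ?_) hfg
    congr 1; ext x; rw [abs_sub_comm]; rfl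
  have mf := mollify_integrable μ m hf
  have mg := mollify_integrable μ m hgi
  have h3 : ∫ x, |mollify μ m f x - f x| ∂μ ≤ ∫ x, (|mollify μ m f x - mollify μ m g x| +
      |mollify μ m g x - g x| + |g x - f x|) ∂μ := by
    refine integral_mono (mf.sub hf).abs
      (((mf.sub mg).abs.add (mg.sub hgi).abs).add (hgi.sub hf).abs) fun x => ?_
    have := abs_add_le (mollify μ m f x - mollify μ m g x + (mollify μ m g x - g x)) (g x - f x)
    have h' := abs_add_le (mollify μ m f x - mollify μ m g x) (mollify μ m g x - g x)
    calc |mollify μ m f x - f x| = _ := by congr 1; ring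
      _ ≤ _ := this.trans (by gcongr)
  have i1 : Integrable (fun x => |mollify μ m f x - mollify μ m g x|) μ := (mf.sub mg).abs
  have i2 : Integrable (fun x => |mollify μ m g x - g x|) μ := (mg.sub hgi).abs
  have i3 : Integrable (fun x => |g x - f x|) μ := (hgi.sub hf).abs
  rw [integral_add (i1.fun_add i2) i3, integral_add i1 i2] at h3
  rw [Real.dist_eq, sub_zero, abs_of_nonneg (integral_nonneg fun _ => abs_nonneg _)]
  linarith

/-- `g` is the distributional derivative of `f` in the direction `v` on the open set `O`. -/
structure WeakDerivOn (O : Set X) (v : X) (f g : X → ℝ) : Prop where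
  locInt : LocallyIntegrableOn f O μ
  locInt_deriv : LocallyIntegrableOn g O μ
  byParts : ∀ φ : X → ℝ, ContDiff ℝ ∞ φ → HasCompactSupport φ → tsupport φ ⊆ O →
    ∫ x in O, f x * fderiv ℝ φ x v ∂μ = - ∫ x in O, g x * φ x ∂μ

variable {μ}

theorem integrable_indicator_of_compact {O K : Set X} {f : X → ℝ}
    (hf : LocallyIntegrableOn f O μ) (hK : IsCompact K) (hKO : K ⊆ O) :
    Integrable (K.indicator f) μ :=
  (integrable_indicator_iff hK.measurableSet).2 (hf.integrableOn_compact_subset hKO hK)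

/-- Weak derivatives commute with mollification. -/
theorem WeakDerivOn.fderiv_mollify {O K : Set X} {v : X} {f g : X → ℝ}
    (h : WeakDerivOn μ O v f g) (hK : IsCompact K) (hKO : K ⊆ O) (m : ℕ) {x : X}
    (hx : Metric.closedBall x (shrinkingBump X m).rOut ⊆ K) :
    fderiv ℝ (mollify μ m (K.indicator f)) x v = mollify μ m (K.indicator g) x := by
  have : ProperSpace X := FiniteDimensional.proper ℝ X
  have hf := integrable_indicator_of_compact h.locInt hK hKO
  set b := shrinkingBump X m
  set φ := b.normed μ with hφ
  have hφc : ContDiff ℝ ∞ φ := b.contDiff_normed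
  have hφs : HasCompactSupport φ := b.hasCompactSupport_normed
  have hd := hφs.hasFDerivAt_convolution_left (ContinuousLinearMap.lsmul ℝ ℝ)
    (hφc.of_le (by simp)) hf.locallyIntegrable x
  have hex := ((hφs.fderiv ℝ).convolutionExists_left
      ((ContinuousLinearMap.lsmul ℝ ℝ : ℝ →L[ℝ] ℝ →L[ℝ] ℝ).precompL X)
      (hφc.continuous_fderiv (by simp)) hf.locallyIntegrable x).integrable
  change HasFDerivAt (mollify μ m (K.indicator f)) _ x at hd
  rw [hd.fderiv, convolution_def, ContinuousLinearMap.integral_apply hex]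
  have e1 : ∀ t, (((ContinuousLinearMap.lsmul ℝ ℝ : ℝ →L[ℝ] ℝ →L[ℝ] ℝ).precompL X)
      (fderiv ℝ φ t) (K.indicator f (x - t))) v = fderiv ℝ φ t v * K.indicator f (x - t) := by
    intro t; simp [ContinuousLinearMap.precompL_apply]
  simp only [e1]
  have e2 : ∫ t, fderiv ℝ φ t v * K.indicator f (x - t) ∂μ =
      ∫ t, fderiv ℝ φ (x - t) v * K.indicator f t ∂μ := by
    rw [← integral_sub_left_eq_self _ μ x]
    simp
  rw [e2, mollify, convolution_lsmul_swap]
  -- the reflected and translated bump function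
  set ψ : X → ℝ := fun y => φ (x - y) with hψ
  have hψc : ContDiff ℝ ∞ ψ := hφc.comp (contDiff_const.sub contDiff_id)
  have hψd : ∀ y, fderiv ℝ ψ y v = - fderiv ℝ φ (x - y) v := by
    intro y
    have h1 : HasFDerivAt (fun y : X => x - y) (-(ContinuousLinearMap.id ℝ X)) y := by
      simpa using (hasFDerivAt_id y).const_sub x
    have h2 := ((hφc.differentiable (by simp)) (x - y)).hasFDerivAt.comp y h1
    have h3 : fderiv ℝ ψ y = _ := h2.fderiv
    rw [h3]; simp
  have hψs : tsupport ψ ⊆ Metric.closedBall x b.rOut := by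
    refine closure_minimal (fun y hy => ?_) Metric.isClosed_closedBall
    have : x - y ∈ Function.support φ := hy
    rw [hφ, b.support_normed_eq, Metric.mem_ball, dist_zero_right] at this
    rw [Metric.mem_closedBall, dist_comm, dist_eq_norm]
    exact this.le
  have hψcs : HasCompactSupport ψ :=
    HasCompactSupport.of_support_subset_isCompact (isCompact_closedBall x b.rOut)
      (subset_closure.trans hψs)
  have hz : ∀ y ∉ K, ψ y = 0 := fun y hy =>
    image_eq_zero_of_notMem_tsupport fun h' => hy (hx (hψs h'))
  have hz' : ∀ y ∉ K, fderiv ℝ ψ y = 0 := fun y hy => by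
    by_contra h'
    exact hy (hx (hψs (support_fderiv_subset ℝ (f := ψ) h')))
  -- The minus sign from reflecting the bump cancels the one from integration by parts. As ψ lives
  -- in a ball contained in K, restricting f and g to K is invisible to it.
  have hby := h.byParts ψ hψc hψcs (hψs.trans (hx.trans hKO))
  have t1 : ∫ y in O, f y * fderiv ℝ ψ y v ∂μ = ∫ y, f y * fderiv ℝ ψ y v ∂μ :=
    setIntegral_eq_integral_of_forall_compl_eq_zero fun y hy => by
      rw [hz' y fun h' => hy (hKO h')]; simp
  have t2 : ∫ y in O, g y * ψ y ∂μ = ∫ y, g y * ψ y ∂μ :=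
    setIntegral_eq_integral_of_forall_compl_eq_zero fun y hy => by
      rw [hz y fun h' => hy (hKO h')]; simp
  rw [t1, t2] at hby
  have t3 : ∫ t, fderiv ℝ φ (x - t) v * K.indicator f t ∂μ =
      - ∫ y, f y * fderiv ℝ ψ y v ∂μ := by
    rw [← integral_neg]
    congr 1; ext y
    by_cases hy : y ∈ K
    · rw [indicator_of_mem hy, hψd]; ring
    · rw [indicator_of_notMem hy, hz' y hy]; simp
  rw [t3, hby, neg_neg]
  congr 1; ext y
  by_cases hy : y ∈ K
  · rw [indicator_of_mem hy, smul_eq_mul]; change _ = ψ y * _; ring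
  · rw [indicator_of_notMem hy, hz y hy]; simp

/-- Smooth approximation near a compact set `K`, compatible with weak derivatives. -/
theorem exists_smoothing {O K : Set X} (hO : IsOpen O) (hK : IsCompact K) (hKO : K ⊆ O) :
    ∃ (R : ℕ → (X → ℝ) → X → ℝ) (U : Set X), IsOpen U ∧ K ⊆ U ∧
      (∀ f, LocallyIntegrableOn f O μ → ∀ m, ContDiff ℝ ∞ (R m f)) ∧
      (∀ f, LocallyIntegrableOn f O μ →
        Tendsto (fun m => eLpNorm (fun x => R m f x - f x) 1 (μ.restrict K)) atTop (𝓝 0)) ∧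
      (∀ v f g, WeakDerivOn μ O v f g → ∀ᶠ m in atTop, ∀ x ∈ U,
        fderiv ℝ (R m f) x v = R m g x) := by
  have : ProperSpace X := FiniteDimensional.proper ℝ X
  -- Functions are cut off to K' before mollification. Once the radius is below δ, the balls around
  -- points of K₂ stay inside K', which makes mollification commute with weak derivatives there. The
  -- operators `R m` do not depend on the function, so they can be applied to f and its derivatives
  -- simultaneously.
  obtain ⟨K', hK', hKK', hK'O⟩ := exists_compact_between hK hO hKO
  obtain ⟨K₂, hK₂, hKK₂, hK₂K'⟩ := exists_compact_between hK isOpen_interior hKK'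
  obtain ⟨δ, hδ, hth⟩ := hK₂.exists_cthickening_subset_open isOpen_interior hK₂K'
  refine ⟨fun m f => mollify μ m (K'.indicator f), interior K₂, isOpen_interior, hKK₂,
    fun f hf m => mollify_contDiff μ m (integrable_indicator_of_compact hf hK' hK'O),
    fun f hf => ?_, fun v f g h => ?_⟩
  · have hi := integrable_indicator_of_compact hf hK' hK'O
    have h1 := tendsto_integral_abs_mollify_sub μ hi
    have h2 := (ENNReal.tendsto_ofReal h1)
    rw [ENNReal.ofReal_zero] at h2
    refine tendsto_of_tendsto_of_tendsto_of_le_of_le tendsto_const_nhds h2 (fun _ => zero_le)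
      fun m => ?_
    have hle : eLpNorm (fun x => mollify μ m (K'.indicator f) x - f x) 1 (μ.restrict K) =
        eLpNorm (fun x => mollify μ m (K'.indicator f) x - K'.indicator f x) 1
          (μ.restrict K) := by
      refine eLpNorm_congr_ae ?_
      filter_upwards [ae_restrict_mem hK.measurableSet] with x hx
      rw [indicator_of_mem (interior_subset (hKK' hx))]
    change eLpNorm (fun x => mollify μ m (K'.indicator f) x - f x) 1 (μ.restrict K) ≤ _
    rw [hle]
    refine (eLpNorm_mono_measure _ Measure.restrict_le_self).trans (le_of_eq ?_)
    have hintg := ((mollify_integrable μ m hi).sub hi)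
    rw [eLpNorm_one_eq_lintegral_enorm]
    exact (ofReal_integral_norm_eq_lintegral_enorm hintg).symm
  · obtain ⟨M, hM⟩ := exists_nat_gt (1 / δ)
    filter_upwards [eventually_ge_atTop M] with m hm x hx
    refine h.fderiv_mollify hK' hK'O m fun y hy => interior_subset (hth ?_)
    refine Metric.mem_cthickening_of_dist_le y x δ _ (interior_subset hx)
      ((Metric.mem_closedBall.1 hy).trans ?_)
    rw [shrinkingBump_rOut, div_le_comm₀ (by positivity) hδ]
    have : (M : ℝ) ≤ m := by exact_mod_cast hm
    linarith

end Mollification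

/-! ### Chain rule, Kato's inequality and uniqueness for weak derivatives -/

section WeakDerivatives

variable {X : Type*} [NormedAddCommGroup X] [NormedSpace ℝ X] [FiniteDimensional ℝ X]
  [MeasurableSpace X] [BorelSpace X] {μ : Measure X} [μ.IsAddHaarMeasure]

theorem setIntegral_eq_of_support_subset {K O : Set X} {F : X → ℝ} (hKO : K ⊆ O)
    (hF : ∀ x ∉ K, F x = 0) : ∫ x in O, F x ∂μ = ∫ x in K, F x ∂μ := by
  rw [setIntegral_eq_integral_of_forall_compl_eq_zero fun x hx => hF x fun h => hx (hKO h),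
    setIntegral_eq_integral_of_forall_compl_eq_zero hF]

theorem fderiv_eq_zero_of_notMem_tsupport {φ : X → ℝ} {x : X} (hx : x ∉ tsupport φ) :
    fderiv ℝ φ x = 0 := by
  by_contra h
  exact hx (support_fderiv_subset ℝ (f := φ) h)

/-- The chain rule for weak derivatives. -/
theorem WeakDerivOn.chain_rule {O : Set X} {v : X} {f g : X → ℝ} (h : WeakDerivOn μ O v f g)
    (hO : IsOpen O) {β b : ℝ → ℝ} {C : ℝ} (hβ : ∀ s, HasDerivAt β (b s) s) (hb : Continuous b)
    (hbC : ∀ s, |b s| ≤ C) {φ : X → ℝ} (hφ : ContDiff ℝ ∞ φ) (hφc : HasCompactSupport φ)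
    (hφO : tsupport φ ⊆ O) :
    ∫ x in O, β (f x) * fderiv ℝ φ x v ∂μ = - ∫ x in O, b (f x) * g x * φ x ∂μ := by
  set K := tsupport φ with hKdef
  have hK : IsCompact K := hφc
  obtain ⟨R, U, hU, hKU, hRs, hRt, hRd⟩ := exists_smoothing (μ := μ) hO hK hφO
  have hφz : ∀ x ∉ K, φ x = 0 := fun x hx => image_eq_zero_of_notMem_tsupport hx
  have hφz' : ∀ x ∉ K, fderiv ℝ φ x = 0 := fun x hx => fderiv_eq_zero_of_notMem_tsupport hx
  rw [setIntegral_eq_of_support_subset hφO fun x hx => by simp [hφz' x hx],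
    setIntegral_eq_of_support_subset hφO fun x hx => by simp [hφz x hx]]
  have hβc : ContDiff ℝ 1 β := contDiff_one_iff_deriv.2
    ⟨fun s => (hβ s).differentiableAt, by rwa [funext fun s => (hβ s).deriv]⟩
  have hfK := h.locInt.integrableOn_compact_subset hφO hK
  have hgK := h.locInt_deriv.integrableOn_compact_subset hφO hK
  obtain ⟨D, hD⟩ := hφ.continuous.bounded_above_of_compact_support hφc
  have hdφ : Continuous fun x => fderiv ℝ φ x v :=
    (hφ.continuous_fderiv (by simp)).clm_apply continuous_const
  obtain ⟨D', hD'⟩ := hdφ.bounded_above_of_compact_support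
    ((hφc.fderiv ℝ).comp_left (g := fun A : X →L[ℝ] ℝ => A v) (by simp))
  have hlip : ∀ s t, |β s - β t| ≤ C * |s - t| := fun s t => by
    have := Convex.norm_image_sub_le_of_norm_hasDerivWithin_le (f := β) (f' := b) (C := C)
      (s := univ) (x := t) (y := s) (fun x _ => (hβ x).hasDerivWithinAt) (fun x _ => hbC x)
      convex_univ (mem_univ _) (mem_univ _)
    simpa using this
  have hβf : Integrable (fun x => β (f x)) (μ.restrict K) := by
    have hc : Integrable (fun _ : X => |β 0|) (μ.restrict K) :=
      integrableOn_const hK.measure_lt_top.ne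
    refine ((hfK.abs.const_mul C).add hc).mono'
      (hβc.continuous.comp_aestronglyMeasurable hfK.1) (ae_of_all _ fun x => ?_)
    have h1 := hlip (f x) 0
    have h2 := abs_sub_abs_le_abs_sub (β (f x)) (β 0)
    simp only [sub_zero] at h1
    change |β (f x)| ≤ C * |f x| + |β 0|
    linarith
  -- The empty index type and `B = 1` remove the nonlinear factor: here β of the approximations
  -- converges in L¹ itself, because β is Lipschitz with constant C.
  have L1 := tendsto_integral_comp_mul (μ := μ.restrict K) (ι := Fin 0) (F := fun _ _ _ => 0)
    (F' := fun _ _ => 0) (G := fun m x => β (R m f x)) (G' := fun x => β (f x)) (B := fun _ => 1)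
    (k := fun x => fderiv ℝ φ x v) (C := 1) (D := D') continuous_const (by simp)
    hdφ.aestronglyMeasurable hD' (fun _ i => i.elim0) (fun i => i.elim0) (fun i => i.elim0)
    (fun m => (hβc.continuous.comp (hRs f h.locInt m).continuous).aestronglyMeasurable) hβf (by
      have h0 : Tendsto (fun m => ENNReal.ofReal C *
          eLpNorm (fun x => R m f x - f x) 1 (μ.restrict K)) atTop (𝓝 0) := by
        simpa using ENNReal.Tendsto.const_mul (hRt f h.locInt) (Or.inr ENNReal.ofReal_ne_top)
      refine tendsto_of_tendsto_of_tendsto_of_le_of_le tendsto_const_nhds h0 (fun _ => zero_le)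
        fun m => ?_
      exact eLpNorm_le_mul_eLpNorm_of_ae_le_mul (ae_of_all _ fun x => hlip _ _) 1)
  have L2 := tendsto_integral_comp_mul (μ := μ.restrict K) (ι := Fin 1)
    (F := fun m _ x => R m f x) (F' := fun _ x => f x) (G := fun m x => R m g x) (G' := g)
    (B := fun z => b (z 0)) (k := φ) (C := C) (D := D) (hb.comp (continuous_apply 0))
    (fun z => hbC _) hφ.continuous.aestronglyMeasurable hD
    (fun m _ => (hRs f h.locInt m).continuous.aestronglyMeasurable) (fun _ => hfK.1)
    (fun _ => hRt f h.locInt)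
    (fun m => (hRs g h.locInt_deriv m).continuous.aestronglyMeasurable) hgK
    (hRt g h.locInt_deriv)
  have key := L1.add L2
  -- For the smooth approximations the identity says that the integral of ∂_v(β(f) φ) vanishes.
  have hzero : ∀ᶠ m in atTop, (∫ x in K, fderiv ℝ φ x v * (1 * β (R m f x)) ∂μ) +
      ∫ x in K, φ x * (b (R m f x) * R m g x) ∂μ = 0 := by
    filter_upwards [hRd v f g h] with m hm
    have hfm := hRs f h.locInt m
    have hgm := hRs g h.locInt_deriv m
    have hd : ∀ x, fderiv ℝ (fun x => β (R m f x) * φ x) x v =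
        fderiv ℝ φ x v * (1 * β (R m f x)) + φ x * (b (R m f x) * fderiv ℝ (R m f) x v) := by
      intro x
      have h1 := (hβ (R m f x)).comp_hasFDerivAt x
        ((hfm.differentiable (by simp)) x).hasFDerivAt
      have h2 := h1.mul ((hφ.differentiable (by simp)) x).hasFDerivAt
      have h3 : fderiv ℝ (fun x => β (R m f x) * φ x) x = _ := h2.fderiv
      rw [h3]; simp; ring
    have h0 := integral_fderiv_eq_zero μ (φ := fun x => β (R m f x) * φ x)
      ((hβc.comp (hfm.of_le (by simp))).mul (hφ.of_le (by simp))) (hφc.mul_left) v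
    rw [← integral_add]
    · rw [← setIntegral_eq_integral_of_forall_compl_eq_zero (s := K)
        fun x hx => by rw [hd, hφz x hx, hφz' x hx]; simp] at h0
      rw [← h0]
      refine setIntegral_congr_fun hK.measurableSet fun x hx => ?_
      rw [hd, hm x (hKU hx)]
    · exact (hdφ.mul (continuous_const.mul
        (hβc.continuous.comp hfm.continuous))).continuousOn.integrableOn_compact hK
    · exact (hφ.continuous.mul ((hb.comp hfm.continuous).mul
        hgm.continuous)).continuousOn.integrableOn_compact hK
  have hlim := tendsto_nhds_unique (key.congr' hzero) tendsto_const_nhds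
  have e1 : ∫ x in K, β (f x) * fderiv ℝ φ x v ∂μ =
      ∫ x in K, fderiv ℝ φ x v * (1 * β (f x)) ∂μ := by congr 1; ext x; ring
  have e2 : ∫ x in K, b (f x) * g x * φ x ∂μ = ∫ x in K, φ x * (b (f x) * g x) ∂μ := by
    congr 1; ext x; ring
  rw [e1, e2]
  linarith

/-- Kato's inequality in one direction, tested with a nonnegative function. -/
theorem WeakDerivOn.kato {O : Set X} {v : X} {f g k : X → ℝ} (h : WeakDerivOn μ O v f g)
    (h' : WeakDerivOn μ O v g k) (hO : IsOpen O) {b b' : ℝ → ℝ} {C : ℝ}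
    (hb : ∀ s, HasDerivAt b (b' s) s) (hb'c : Continuous b') (hb' : ∀ s, 0 ≤ b' s)
    (hbC : ∀ s, |b s| ≤ C) {φ : X → ℝ} (hφ : ContDiff ℝ ∞ φ) (hφ0 : ∀ x, 0 ≤ φ x)
    (hφc : HasCompactSupport φ) (hφO : tsupport φ ⊆ O) :
    ∫ x in O, φ x * (b (f x) * k x) ∂μ ≤ - ∫ x in O, fderiv ℝ φ x v * (b (f x) * g x) ∂μ := by
  set K := tsupport φ with hKdef
  have hK : IsCompact K := hφc
  obtain ⟨R, U, hU, hKU, hRs, hRt, hRd⟩ := exists_smoothing (μ := μ) hO hK hφO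
  have hφz : ∀ x ∉ K, φ x = 0 := fun x hx => image_eq_zero_of_notMem_tsupport hx
  have hφz' : ∀ x ∉ K, fderiv ℝ φ x = 0 := fun x hx => fderiv_eq_zero_of_notMem_tsupport hx
  rw [setIntegral_eq_of_support_subset hφO fun x hx => by simp [hφz x hx],
    setIntegral_eq_of_support_subset hφO fun x hx => by simp [hφz' x hx]]
  have hbc : ContDiff ℝ 1 b := contDiff_one_iff_deriv.2
    ⟨fun s => (hb s).differentiableAt, by rwa [funext fun s => (hb s).deriv]⟩
  have hfK := h.locInt.integrableOn_compact_subset hφO hK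
  have hgK := h.locInt_deriv.integrableOn_compact_subset hφO hK
  have hkK := h'.locInt_deriv.integrableOn_compact_subset hφO hK
  obtain ⟨D, hD⟩ := hφ.continuous.bounded_above_of_compact_support hφc
  have hdφ : Continuous fun x => fderiv ℝ φ x v :=
    (hφ.continuous_fderiv (by simp)).clm_apply continuous_const
  obtain ⟨D', hD'⟩ := hdφ.bounded_above_of_compact_support
    ((hφc.fderiv ℝ).comp_left (g := fun A : X →L[ℝ] ℝ => A v) (by simp))
  have L1 := tendsto_integral_comp_mul (μ := μ.restrict K) (ι := Fin 1)
    (F := fun m _ x => R m f x) (F' := fun _ x => f x) (G := fun m x => R m k x) (G' := k)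
    (B := fun z => b (z 0)) (k := φ) (C := C) (D := D)
    (hbc.continuous.comp (continuous_apply 0))
    (fun z => hbC _) hφ.continuous.aestronglyMeasurable hD
    (fun m _ => (hRs f h.locInt m).continuous.aestronglyMeasurable) (fun _ => hfK.1)
    (fun _ => hRt f h.locInt)
    (fun m => (hRs k h'.locInt_deriv m).continuous.aestronglyMeasurable) hkK
    (hRt k h'.locInt_deriv)
  have L2 := tendsto_integral_comp_mul (μ := μ.restrict K) (ι := Fin 1)
    (F := fun m _ x => R m f x) (F' := fun _ x => f x) (G := fun m x => R m g x) (G' := g)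
    (B := fun z => b (z 0)) (k := fun x => fderiv ℝ φ x v) (C := C) (D := D')
    (hbc.continuous.comp (continuous_apply 0))
    (fun z => hbC _) hdφ.aestronglyMeasurable hD'
    (fun m _ => (hRs f h.locInt m).continuous.aestronglyMeasurable) (fun _ => hfK.1)
    (fun _ => hRt f h.locInt)
    (fun m => (hRs g h.locInt_deriv m).continuous.aestronglyMeasurable) hgK
    (hRt g h.locInt_deriv)
  refine le_of_tendsto_of_tendsto L1 L2.neg ?_
  filter_upwards [hRd v f g h, hRd v g k h'] with m hm hm'
  have hfm := hRs f h.locInt m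
  have hgm := hRs g h.locInt_deriv m
  have hkm := hRs k h'.locInt_deriv m
  -- The derivative of b(f) ∂_v f φ contains b'(f) (∂_v f)² φ ≥ 0. This term has no controlled
  -- limit, as ∂_v f is only locally integrable, so it is discarded for each m and only an
  -- inequality passes to the limit.
  have hd : ∀ x, fderiv ℝ (fun x => b (R m f x) * R m g x * φ x) x v =
      b' (R m f x) * fderiv ℝ (R m f) x v * R m g x * φ x +
      (φ x * (b (R m f x) * fderiv ℝ (R m g) x v) +
      fderiv ℝ φ x v * (b (R m f x) * R m g x)) := by
    intro x
    have h1 := (hb (R m f x)).comp_hasFDerivAt x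
      ((hfm.differentiable (by simp)) x).hasFDerivAt
    have h2 := (h1.mul ((hgm.differentiable (by simp)) x).hasFDerivAt).mul
      ((hφ.differentiable (by simp)) x).hasFDerivAt
    have h3 : fderiv ℝ (fun x => b (R m f x) * R m g x * φ x) x = _ := h2.fderiv
    rw [h3]; simp; ring
  have h0 := integral_fderiv_eq_zero μ (φ := fun x => b (R m f x) * R m g x * φ x)
    (((hbc.comp (hfm.of_le (by simp))).mul (hgm.of_le (by simp))).mul (hφ.of_le (by simp)))
    (hφc.mul_left) v
  have i1 : IntegrableOn (fun x => φ x * (b (R m f x) * R m k x)) K μ :=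
    (hφ.continuous.mul ((hbc.continuous.comp hfm.continuous).mul
        hkm.continuous)).continuousOn.integrableOn_compact hK
  have i2 : IntegrableOn (fun x => fderiv ℝ φ x v * (b (R m f x) * R m g x)) K μ :=
    (hdφ.mul ((hbc.continuous.comp hfm.continuous).mul
        hgm.continuous)).continuousOn.integrableOn_compact hK
  have i3 : IntegrableOn (fun x => b' (R m f x) * R m g x * R m g x * φ x) K μ :=
    ((((hb'c.comp hfm.continuous).mul hgm.continuous).mul hgm.continuous).mul
        hφ.continuous).continuousOn.integrableOn_compact hK
  have hsum : (∫ x in K, b' (R m f x) * R m g x * R m g x * φ x ∂μ) +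
      ((∫ x in K, φ x * (b (R m f x) * R m k x) ∂μ) +
      ∫ x in K, fderiv ℝ φ x v * (b (R m f x) * R m g x) ∂μ) = 0 := by
    rw [← setIntegral_eq_integral_of_forall_compl_eq_zero (s := K)
      fun x hx => by rw [hd, hφz x hx, hφz' x hx]; simp] at h0
    rw [← integral_add i1 i2, ← integral_add i3 (i1.fun_add i2), ← h0]
    refine setIntegral_congr_fun hK.measurableSet fun x hx => ?_
    rw [hd, hm x (hKU hx), hm' x (hKU hx)]
  have hpos : 0 ≤ ∫ x in K, b' (R m f x) * R m g x * R m g x * φ x ∂μ :=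
    integral_nonneg fun x => by
      change 0 ≤ b' (R m f x) * R m g x * R m g x * φ x
      rw [mul_assoc (b' _)]
      exact mul_nonneg (mul_nonneg (hb' _) (mul_self_nonneg _)) (hφ0 x)
  linarith

/-- Weak derivatives are unique. -/
theorem WeakDerivOn.ae_unique {O : Set X} {v : X} {f f' g g' : X → ℝ} (hO : IsOpen O)
    (h : WeakDerivOn μ O v f g) (h' : WeakDerivOn μ O v f' g')
    (hff : f =ᵐ[μ.restrict O] f') : g =ᵐ[μ.restrict O] g' := by
  have : ProperSpace X := FiniteDimensional.proper ℝ X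
  have key := hO.ae_eq_zero_of_integral_contDiff_smul_eq_zero (μ := μ) (f := fun x => g x - g' x)
    (h.locInt_deriv.sub h'.locInt_deriv) fun φ hφ hφc hφO => ?_
  · rw [← ae_restrict_iff' hO.measurableSet] at key
    filter_upwards [key] with x hx using sub_eq_zero.1 hx
  · have hz : ∀ x ∉ tsupport φ, φ x = 0 := fun x hx => image_eq_zero_of_notMem_tsupport hx
    rw [← setIntegral_eq_integral_of_forall_compl_eq_zero (s := O)
      fun x hx => by simp [hz x fun hh => hx (hφO hh)]]
    obtain ⟨D, hD⟩ := hφ.continuous.bounded_above_of_compact_support hφc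
    have hintg : ∀ {w : X → ℝ}, LocallyIntegrableOn w O μ →
        Integrable (fun x => w x * φ x) (μ.restrict O) := fun {w} hw => by
      have h1 : IntegrableOn w (tsupport φ) μ := hw.integrableOn_compact_subset hφO hφc
      have h2 : IntegrableOn (fun x => w x * φ x) (tsupport φ) μ :=
        Integrable.mul_bdd (c := D) h1 hφ.continuous.aestronglyMeasurable (ae_of_all _ hD)
      exact ((integrableOn_iff_integrable_of_support_subset fun x hx => by
        by_contra hx'
        exact hx (by simp [hz x hx'])).1 h2).integrableOn
    have e1 := h.byParts φ hφ hφc hφO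
    have e2 := h'.byParts φ hφ hφc hφO
    have e3 : ∫ x in O, f x * fderiv ℝ φ x v ∂μ = ∫ x in O, f' x * fderiv ℝ φ x v ∂μ := by
      refine integral_congr_ae ?_
      filter_upwards [hff] with x hx using by rw [hx]
    have : ∫ x in O, φ x • (g x - g' x) ∂μ =
        (∫ x in O, g x * φ x ∂μ) - ∫ x in O, g' x * φ x ∂μ := by
      rw [← integral_sub (hintg h.locInt_deriv) (hintg h'.locInt_deriv)]
      congr 1; ext x; simp; ring
    rw [this]; linarith

theorem WeakDerivOn.mono {O O' : Set X} {v : X} {f g : X → ℝ} (h : WeakDerivOn μ O v f g)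
    (hO' : O' ⊆ O) : WeakDerivOn μ O' v f g where
  locInt := h.locInt.mono_set hO'
  locInt_deriv := h.locInt_deriv.mono_set hO'
  byParts φ hφ hφc hφO := by
    have := h.byParts φ hφ hφc (hφO.trans hO')
    have hz : ∀ x ∉ tsupport φ, φ x = 0 := fun x hx => image_eq_zero_of_notMem_tsupport hx
    have hz' : ∀ x ∉ tsupport φ, fderiv ℝ φ x = 0 :=
      fun x hx => fderiv_eq_zero_of_notMem_tsupport hx
    rw [setIntegral_eq_of_support_subset (hφO.trans hO') fun x hx => by simp [hz' x hx],
      setIntegral_eq_of_support_subset (hφO.trans hO') fun x hx => by simp [hz x hx]] at this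
    rwa [setIntegral_eq_of_support_subset hφO fun x hx => by simp [hz' x hx],
      setIntegral_eq_of_support_subset hφO fun x hx => by simp [hz x hx]]

end WeakDerivatives

/-! ### Normal coordinates along a closed plane curve -/

section Green

/-- A closed plane curve `(x, y)` of class `C²` with unit speed and period `L`, together with its
first and second derivatives. -/
structure UnitSpeedLoop where
  L : ℝ
  x : ℝ → ℝ
  y : ℝ → ℝ
  x' : ℝ → ℝ
  y' : ℝ → ℝ
  x'' : ℝ → ℝ
  y'' : ℝ → ℝ
  L_pos : 0 < L
  hx : ∀ s, HasDerivAt x (x' s) s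
  hy : ∀ s, HasDerivAt y (y' s) s
  hx' : ∀ s, HasDerivAt x' (x'' s) s
  hy' : ∀ s, HasDerivAt y' (y'' s) s
  hx'' : Continuous x''
  hy'' : Continuous y''
  unit : ∀ s, x' s ^ 2 + y' s ^ 2 = 1
  perx : Function.Periodic x L
  pery : Function.Periodic y L
  inj : ∀ s t, x s = x t → y s = y t → ∃ k : ℤ, t = s + k * L

namespace UnitSpeedLoop

variable (c : UnitSpeedLoop)

theorem periodic_deriv {f f' : ℝ → ℝ} {L : ℝ} (h : ∀ s, HasDerivAt f (f' s) s)
    (hf : Function.Periodic f L) : Function.Periodic f' L := fun s => by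
  have h1 := (h (s + L)).comp_add_const s L
  rw [show (fun s => f (s + L)) = f from funext hf] at h1
  exact h1.unique (h s)

theorem continuous_x : Continuous c.x :=
  continuous_iff_continuousAt.2 fun s => (c.hx s).continuousAt
theorem continuous_y : Continuous c.y :=
  continuous_iff_continuousAt.2 fun s => (c.hy s).continuousAt
theorem continuous_x' : Continuous c.x' :=
  continuous_iff_continuousAt.2 fun s => (c.hx' s).continuousAt
theorem continuous_y' : Continuous c.y' :=
  continuous_iff_continuousAt.2 fun s => (c.hy' s).continuousAt

/-- The signed curvature. -/
def a (s : ℝ) : ℝ := c.x'' s * c.y' s - c.y'' s * c.x' s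

theorem continuous_a : Continuous c.a :=
  (c.hx''.mul c.continuous_y').sub (c.hy''.mul c.continuous_x')

theorem periodic_a : Function.Periodic c.a c.L := fun s => by
  have px := periodic_deriv c.hx c.perx
  have py := periodic_deriv c.hy c.pery
  simp only [a, px s, py s, periodic_deriv c.hx' px s, periodic_deriv c.hy' py s]

/-- Derivative of the identity |(x', y')|² = 1. -/
theorem ortho (s : ℝ) : c.x' s * c.x'' s + c.y' s * c.y'' s = 0 := by
  have h := ((c.hx' s).pow 2).add ((c.hy' s).pow 2)
  have h0 : (c.x' ^ 2 + c.y' ^ 2) = fun _ => (1 : ℝ) := funext fun s => c.unit s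
  rw [h0] at h
  have := h.unique (hasDerivAt_const s (1 : ℝ))
  simp at this
  linarith

/-- Frenet equations: by `ortho` the acceleration is normal to the curve, hence a multiple of the
unit vector (y', -x'). -/
theorem x''_eq (s : ℝ) : c.x'' s = c.a s * c.y' s := by
  have h1 := c.ortho s
  have h2 := c.unit s
  simp only [a]
  linear_combination (-c.x'' s) * h2 + c.x' s * h1

theorem y''_eq (s : ℝ) : c.y'' s = -(c.a s * c.x' s) := by
  have h1 := c.ortho s
  have h2 := c.unit s
  simp only [a]
  linear_combination (-c.y'' s) * h2 + c.y' s * h1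

/-- Normal coordinates `(s, τ)` along the curve. -/
def tube (q : ℝ × ℝ) : ℝ × ℝ := (c.x q.1 - q.2 * c.y' q.1, c.y q.1 + q.2 * c.x' q.1)

/-- The derivative of the normal coordinates. -/
def tubeDeriv (q : ℝ × ℝ) : ℝ × ℝ →L[ℝ] ℝ × ℝ :=
  (((1 + c.a q.1 * q.2) * c.x' q.1) • ContinuousLinearMap.fst ℝ ℝ ℝ +
    (-c.y' q.1) • ContinuousLinearMap.snd ℝ ℝ ℝ).prod
  (((1 + c.a q.1 * q.2) * c.y' q.1) • ContinuousLinearMap.fst ℝ ℝ ℝ +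
    c.x' q.1 • ContinuousLinearMap.snd ℝ ℝ ℝ)

theorem tubeDeriv_apply (q v : ℝ × ℝ) : c.tubeDeriv q v =
    ((1 + c.a q.1 * q.2) * c.x' q.1 * v.1 - c.y' q.1 * v.2,
      (1 + c.a q.1 * q.2) * c.y' q.1 * v.1 + c.x' q.1 * v.2) := by
  simp [tubeDeriv, sub_eq_add_neg]

/-- The Jacobian of the normal coordinates. It is the density in `integral_tube`, and its positivity
near the curve makes the coordinates locally invertible. -/
theorem tubeDeriv_det (q : ℝ × ℝ) : (c.tubeDeriv q).det = 1 + c.a q.1 * q.2 := by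
  have : c.tubeDeriv q = LinearMap.toContinuousLinearMap
      (Matrix.toLin (Module.Basis.finTwoProd ℝ) (Module.Basis.finTwoProd ℝ)
        !![(1 + c.a q.1 * q.2) * c.x' q.1, -c.y' q.1;
          (1 + c.a q.1 * q.2) * c.y' q.1, c.x' q.1]) := by
    rw [Matrix.toLin_finTwoProd_toContinuousLinearMap]; rfl
  rw [this]
  simp only [LinearMap.det_toContinuousLinearMap, LinearMap.det_toLin, Matrix.det_fin_two_of]
  linear_combination (1 + c.a q.1 * q.2) * c.unit q.1

theorem continuous_tube : Continuous c.tube := by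
  have := c.continuous_x; have := c.continuous_y
  have := c.continuous_x'; have := c.continuous_y'
  unfold tube; fun_prop

theorem continuous_tubeDeriv : Continuous c.tubeDeriv := by
  have := c.continuous_a
  have := c.continuous_x'; have := c.continuous_y'
  refine continuous_clm_apply.2 fun v => ?_
  simp only [tubeDeriv_apply]
  fun_prop

theorem hasFDerivAt_tube (q : ℝ × ℝ) : HasFDerivAt c.tube (c.tubeDeriv q) q := by
  have f1 : HasFDerivAt (fun q : ℝ × ℝ => q.1) (ContinuousLinearMap.fst ℝ ℝ ℝ) q := hasFDerivAt_fst
  have f2 : HasFDerivAt (fun q : ℝ × ℝ => q.2) (ContinuousLinearMap.snd ℝ ℝ ℝ) q := hasFDerivAt_snd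
  have hx := (c.hx q.1).comp_hasFDerivAt q f1
  have hy := (c.hy q.1).comp_hasFDerivAt q f1
  have hx' := (c.hx' q.1).comp_hasFDerivAt q f1
  have hy' := (c.hy' q.1).comp_hasFDerivAt q f1
  have h := (hx.sub (f2.mul hy')).prodMk (hy.add (f2.mul hx'))
  refine (h.congr_fderiv ?_ : HasFDerivAt c.tube _ q)
  ext <;> simp [tubeDeriv, c.x''_eq, c.y''_eq] <;> ring

theorem hasStrictFDerivAt_tube (q : ℝ × ℝ) : HasStrictFDerivAt c.tube (c.tubeDeriv q) q :=
  hasStrictFDerivAt_of_hasFDerivAt_of_continuousAt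
    (Eventually.of_forall c.hasFDerivAt_tube) c.continuous_tubeDeriv.continuousAt

/-- The input of the inverse function theorem, which is used both for local injectivity and for
openness of the tube around the curve. -/
theorem hasStrictFDerivAt_tube_equiv {q : ℝ × ℝ} (hq : 1 + c.a q.1 * q.2 ≠ 0) :
    ∃ e : (ℝ × ℝ) ≃L[ℝ] ℝ × ℝ, HasStrictFDerivAt c.tube (e : ℝ × ℝ →L[ℝ] ℝ × ℝ) q := by
  refine ⟨(c.tubeDeriv q).toContinuousLinearEquivOfDetNeZero (by rwa [tubeDeriv_det]), ?_⟩
  exact c.hasStrictFDerivAt_tube q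

theorem tube_periodic (s τ : ℝ) (k : ℤ) : c.tube (s + k * c.L, τ) = c.tube (s, τ) := by
  have px := periodic_deriv c.hx c.perx
  have py := periodic_deriv c.hy c.pery
  simp only [tube]
  rw [c.perx.int_mul k s, c.pery.int_mul k s, px.int_mul k s, py.int_mul k s]

theorem tube_zero (s : ℝ) : c.tube (s, 0) = (c.x s, c.y s) := by simp [tube]

theorem exists_curvature_bound : ∃ M, 0 < M ∧ ∀ s, |c.a s| ≤ M := by
  obtain ⟨M, hM⟩ := isCompact_Icc (a := 0) (b := c.L) |>.exists_bound_of_continuousOn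
    c.continuous_a.continuousOn
  refine ⟨|M| + 1, by positivity, fun s => ?_⟩
  obtain ⟨t, ht, hst⟩ := c.periodic_a.exists_mem_Ico₀ c.L_pos s
  rw [hst]
  exact (hM t ⟨ht.1, ht.2.le⟩).trans ((le_abs_self M).trans (by linarith))

/-- Normal coordinates are injective (up to the period) in a neighbourhood of the curve. -/
theorem exists_tube_radius : ∃ δ : ℝ, 0 < δ ∧
    (∀ s τ, |τ| ≤ δ → 0 < 1 + c.a s * τ) ∧
    ∀ s t τ σ, |τ| ≤ δ → |σ| ≤ δ → c.tube (s, τ) = c.tube (t, σ) →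
      τ = σ ∧ ∃ k : ℤ, t = s + k * c.L := by
  have hL := c.L_pos
  -- Pairs (s, t) with s in one period and |t - s| ≤ L/2. Any pair of parameters is congruent to one
  -- in this compact set, and inside it parameters that agree modulo L are equal.
  set C : Set (ℝ × ℝ) := (fun q : ℝ × ℝ => (q.1, q.1 + q.2)) ''
    (Icc 0 c.L ×ˢ Icc (-(c.L / 2)) (c.L / 2)) with hC
  have hCc : IsCompact C := (isCompact_Icc.prod isCompact_Icc).image (by fun_prop)
  have key : ∀ᶠ w : ℝ × ℝ in 𝓝 (0, 0), ∀ q ∈ C, c.tube (q.1, w.1) = c.tube (q.2, w.2) →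
      w.1 = w.2 ∧ q.1 = q.2 := by
    refine hCc.eventually_forall_of_forall_eventually fun q hq => ?_
    have t1 : Tendsto (fun z : (ℝ × ℝ) × (ℝ × ℝ) => (z.2.1, z.1.1)) (𝓝 ((0, 0), q))
        (𝓝 (q.1, 0)) := Continuous.tendsto' (by fun_prop) _ _ rfl
    have t2 : Tendsto (fun z : (ℝ × ℝ) × (ℝ × ℝ) => (z.2.2, z.1.2)) (𝓝 ((0, 0), q))
        (𝓝 (q.2, 0)) := Continuous.tendsto' (by fun_prop) _ _ rfl
    -- On the diagonal, injectivity near the curve comes from the local inverse. Off the diagonal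
    -- the two points of the curve are distinct and remain so for small displacements. Compactness
    -- of C makes both uniform.
    by_cases hne : c.tube (q.1, 0) = c.tube (q.2, 0)
    · have hst : q.1 = q.2 := by
        rw [tube_zero, tube_zero, Prod.mk.injEq] at hne
        obtain ⟨k, hk⟩ := c.inj _ _ hne.1 hne.2
        obtain ⟨⟨s, r⟩, ⟨-, hr⟩, rfl⟩ := hq
        simp only at hk hr ⊢
        have hr' : r = k * c.L := by linarith
        rw [hr'] at hr
        have h1 : (k : ℝ) < 1 := by
          by_contra! h
          nlinarith [hr.2]
        have h2 : (-1 : ℝ) < k := by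
          by_contra! h
          nlinarith [hr.1]
        have : k = 0 := by
          have h1' : k < 1 := by exact_mod_cast h1
          have h2' : -1 < k := by exact_mod_cast h2
          omega
        rw [hr', this]; simp
      obtain ⟨e, he⟩ := c.hasStrictFDerivAt_tube_equiv (q := (q.1, 0)) (by simp)
      have hinv := he.eventually_left_inverse
      rw [← hst] at t2
      filter_upwards [t1.eventually hinv, t2.eventually hinv] with z h1 h2 h3
      rw [h3, h2, Prod.mk.injEq] at h1
      exact ⟨h1.2.symm, h1.1.symm⟩
    · have h1 := (c.continuous_tube.tendsto _).comp t1
      have h2 := (c.continuous_tube.tendsto _).comp t2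
      have hd := (h1.prodMk_nhds h2).eventually
        (isClosed_diagonal.isOpen_compl.mem_nhds (by simpa using hne))
      filter_upwards [hd] with z hz h
      exact absurd h (by simpa using hz)
  obtain ⟨ε, hε, hball⟩ := Metric.eventually_nhds_iff.1 key
  obtain ⟨M, hM, haM⟩ := c.exists_curvature_bound
  -- The bound 1/(2M) gives |aτ| ≤ 1/2, so the Jacobian is positive. The bound ε/2 puts the pair (τ,
  -- σ) strictly inside the ball of radius ε.
  refine ⟨min (ε / 2) (1 / (2 * M)), by positivity, fun s τ hτ => ?_, fun s t τ σ hτ hσ h => ?_⟩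
  · have h1 : |c.a s * τ| ≤ M * (1 / (2 * M)) := by
      rw [abs_mul]
      exact mul_le_mul (haM s) (hτ.trans (min_le_right _ _)) (abs_nonneg _) hM.le
    have h2 : M * (1 / (2 * M)) = 1 / 2 := by field_simp
    have := neg_abs_le (c.a s * τ)
    linarith
  · have hw : dist ((τ, σ) : ℝ × ℝ) (0, 0) < ε := by
      rw [Prod.dist_eq, Real.dist_eq, Real.dist_eq, sub_zero, sub_zero]
      have := min_le_left (ε / 2) (1 / (2 * M))
      exact max_lt (by linarith) (by linarith)
    set s₀ := toIcoMod hL 0 s with hs₀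
    set t₀ := toIcoMod hL (s₀ - c.L / 2) t with ht₀
    have es : s = s₀ + (toIcoDiv hL 0 s : ℤ) * c.L := by
      rw [hs₀, toIcoMod, zsmul_eq_mul]; ring
    have et : t = t₀ + (toIcoDiv hL (s₀ - c.L / 2) t : ℤ) * c.L := by
      rw [ht₀, toIcoMod, zsmul_eq_mul]; ring
    have ms := toIcoMod_mem_Ico hL 0 s
    have mt := toIcoMod_mem_Ico hL (s₀ - c.L / 2) t
    rw [← hs₀] at ms
    rw [← ht₀] at mt
    have hq : (s₀, t₀) ∈ C := by
      refine ⟨(s₀, t₀ - s₀), ⟨⟨ms.1, by linarith [ms.2]⟩, ?_⟩, by simp⟩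
      exact ⟨by simp only; linarith [mt.1], by simp only; linarith [mt.2]⟩
    rw [es, et, tube_periodic, tube_periodic] at h
    obtain ⟨h1, h2⟩ := hball hw _ hq h
    refine ⟨h1, toIcoDiv hL (s₀ - c.L / 2) t - toIcoDiv hL 0 s, ?_⟩
    simp only at h2
    push_cast
    linarith

end UnitSpeedLoop

end Green

/-! ### Green's formula for plane domains -/

section Green

/-- A set missing the frontier is covered by the disjoint open sets `interior A` and `(closure A)ᶜ`.
This spreads the information on which side of the curve A lies from a single point to a whole half
of the tube. -/
theorem subset_of_isPreconnected_of_disjoint_frontier {Z : Type*} [TopologicalSpace Z]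
    {S A : Set Z} (hS : IsPreconnected S) (hne : (S ∩ A).Nonempty)
    (hd : Disjoint S (frontier A)) : S ⊆ A := by
  have hcov : S ⊆ interior A ∪ (closure A)ᶜ := fun z hz => by
    by_cases h : z ∈ closure A
    · left
      by_contra h'
      exact disjoint_left.1 hd hz ⟨h, h'⟩
    · exact Or.inr h
  refine (hS.subset_left_of_subset_union isOpen_interior isClosed_closure.isOpen_compl ?_ hcov
    ?_).trans interior_subset
  · exact disjoint_left.2 fun z h1 h2 => h2 (subset_closure (interior_subset h1))
  · obtain ⟨z, hz, hzA⟩ := hne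
    refine ⟨z, hz, ?_⟩
    rcases hcov hz with h | h
    · exact h
    · exact absurd (subset_closure hzA) h

namespace UnitSpeedLoop

variable (c : UnitSpeedLoop)

/-- `A` is a bounded open set with boundary `c`, lying to the left of `c`. -/
structure Bounds (A : Set (ℝ × ℝ)) : Prop where
  isOpen : IsOpen A
  isBounded : Bornology.IsBounded A
  frontier_eq : frontier A = range fun s => (c.x s, c.y s)
  inner : ∀ s, ∀ᶠ τ in 𝓝[>] (0 : ℝ), c.tube (s, τ) ∈ A
  outer : ∀ s, ∀ᶠ τ in 𝓝[>] (0 : ℝ), c.tube (s, -τ) ∉ A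

variable {c}

/-- Green's formula for a function supported near the curve, in normal coordinates. -/
theorem integral_tube {δ : ℝ} (hδ : 0 < δ) {φ : ℝ × ℝ → ℝ} (hφ : ContDiff ℝ 1 φ) (e : ℝ × ℝ)
    (hz : ∀ s, φ (c.tube (s, δ)) = 0) :
    ∫ q in Ioc 0 c.L ×ˢ Ioc 0 δ, (1 + c.a q.1 * q.2) * fderiv ℝ φ (c.tube q) e =
      ∫ s in 0..c.L, φ (c.x s, c.y s) * (e.1 * c.y' s - e.2 * c.x' s) := by
  have hL := c.L_pos
  have cx' := c.continuous_x'
  have cy' := c.continuous_y'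
  have ca := c.continuous_a
  have ct := c.continuous_tube
  have px := periodic_deriv c.hx c.perx
  have py := periodic_deriv c.hy c.pery
  have cdφ := hφ.continuous_fderiv one_ne_zero
  have cφ := hφ.continuous
  set ψ : ℝ × ℝ → ℝ := fun q => φ (c.tube q) with hψ
  have cψ : Continuous ψ := cφ.comp ct
  -- P and Q are the components of e along the unit tangent (x', y') and the outer unit normal (y',
  -- -x').
  set P : ℝ → ℝ := fun s => e.1 * c.x' s + e.2 * c.y' s with hP
  set Q : ℝ → ℝ := fun s => e.1 * c.y' s - e.2 * c.x' s with hQ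
  have cP : Continuous P := by fun_prop
  have cQ : Continuous Q := by fun_prop
  set Ds : ℝ × ℝ → ℝ := fun q => fderiv ℝ φ (c.tube q) (c.tubeDeriv q (1, 0)) with hDs
  set Dt : ℝ × ℝ → ℝ := fun q => fderiv ℝ φ (c.tube q) (c.tubeDeriv q (0, 1)) with hDt
  have cDs : Continuous Ds :=
    (cdφ.comp ct).clm_apply (c.continuous_tubeDeriv.clm_apply continuous_const)
  have cDt : Continuous Dt :=
    (cdφ.comp ct).clm_apply (c.continuous_tubeDeriv.clm_apply continuous_const)
  have hψd : ∀ q, HasFDerivAt ψ ((fderiv ℝ φ (c.tube q)).comp (c.tubeDeriv q)) q := fun q =>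
    ((hφ.differentiable one_ne_zero) _).hasFDerivAt.comp q (c.hasFDerivAt_tube q)
  have hds : ∀ s τ, HasDerivAt (fun s => ψ (s, τ)) (Ds (s, τ)) s := fun s τ => by
    have h1 : HasDerivAt (fun s : ℝ => (s, τ)) ((1, 0) : ℝ × ℝ) s :=
      (hasDerivAt_id s).prodMk (hasDerivAt_const s τ)
    have h2 := HasFDerivAt.comp_hasDerivAt (l := ψ) (f := fun s => (s, τ)) s (hψd (s, τ)) h1
    exact h2
  have hdt : ∀ s τ, HasDerivAt (fun τ => ψ (s, τ)) (Dt (s, τ)) τ := fun s τ => by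
    have h1 : HasDerivAt (fun τ : ℝ => (s, τ)) ((0, 1) : ℝ × ℝ) τ :=
      (hasDerivAt_const τ s).prodMk (hasDerivAt_id τ)
    have h2 := HasFDerivAt.comp_hasDerivAt (l := ψ) (f := fun τ => (s, τ)) τ (hψd (s, τ)) h1
    exact h2
  have hPd : ∀ s, HasDerivAt P (c.a s * Q s) s := fun s => by
    refine (((c.hx' s).const_mul e.1).add ((c.hy' s).const_mul e.2)).congr_deriv ?_
    rw [c.x''_eq, c.y''_eq]; simp only [hQ]; ring
  -- the divergence form of the integrand
  set G₁ : ℝ × ℝ → ℝ := fun q => c.a q.1 * Q q.1 * ψ q + P q.1 * Ds q with hG₁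
  set G₂ : ℝ × ℝ → ℝ := fun q => Q q.1 * (c.a q.1 * ψ q + (1 + c.a q.1 * q.2) * Dt q) with hG₂
  have cG₁ : Continuous G₁ := by fun_prop
  have cG₂ : Continuous G₂ := by fun_prop
  -- Since P' = aQ, G₁ is the s-derivative of Pψ, and G₂ is the τ-derivative of Q(1 + aτ)ψ. The
  -- first integrates to zero by periodicity; the second leaves only the value at τ = 0, as φ
  -- vanishes at τ = δ.
  have hsplit : ∀ q, (1 + c.a q.1 * q.2) * fderiv ℝ φ (c.tube q) e = G₁ q - G₂ q := by
    intro q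
    have he : (1 + c.a q.1 * q.2) • e = P q.1 • c.tubeDeriv q (1, 0) -
        (Q q.1 * (1 + c.a q.1 * q.2)) • c.tubeDeriv q (0, 1) := by
      have hu := c.unit q.1
      rw [tubeDeriv_apply, tubeDeriv_apply]
      ext
      · simp only [hP, hQ, Prod.smul_fst, Prod.fst_sub, smul_eq_mul]
        linear_combination (-(1 + c.a q.1 * q.2) * e.1) * hu
      · simp only [hP, hQ, Prod.smul_snd, Prod.snd_sub, smul_eq_mul]
        linear_combination (-(1 + c.a q.1 * q.2) * e.2) * hu
    have := congrArg (fderiv ℝ φ (c.tube q)) he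
    rw [map_smul, map_sub, map_smul, map_smul, smul_eq_mul, smul_eq_mul, smul_eq_mul] at this
    rw [this]
    simp only [hG₁, hG₂, hDs, hDt]; ring
  have hintg : ∀ {G : ℝ × ℝ → ℝ}, Continuous G →
      IntegrableOn G (Ioc 0 c.L ×ˢ Ioc 0 δ) (volume.prod volume) := fun hG =>
    (hG.continuousOn.integrableOn_compact
      ((isCompact_Icc (a := 0) (b := c.L)).prod (isCompact_Icc (a := 0) (b := δ)))).mono_set
      (prod_mono Ioc_subset_Icc_self Ioc_subset_Icc_self)
  have hI₁ : ∫ q in Ioc 0 c.L ×ˢ Ioc 0 δ, G₁ q = 0 := by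
    have h := hintg cG₁
    rw [Measure.volume_eq_prod, setIntegral_prod _ h]
    rw [IntegrableOn, ← Measure.prod_restrict] at h
    rw [integral_integral_swap (f := fun s τ => G₁ (s, τ)) h]
    have h0 : ∀ τ, ∫ s in Ioc 0 c.L, G₁ (s, τ) = 0 := fun τ => by
      rw [← intervalIntegral.integral_of_le hL.le,
        intervalIntegral.integral_eq_sub_of_hasDerivAt (f := fun s => P s * ψ (s, τ))]
      · have h1 : P c.L = P 0 := by
          simp only [hP]; rw [← zero_add c.L, px 0, py 0]
        have h2 : ψ (c.L, τ) = ψ (0, τ) := by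
          have := c.tube_periodic 0 τ 1
          simp only [Int.cast_one, one_mul, zero_add] at this
          simp only [hψ, this]
        rw [h1, h2, sub_self]
      · exact fun s _ => (hPd s).mul (hds s τ)
      · exact (cG₁.comp (by fun_prop : Continuous fun s => (s, τ))).intervalIntegrable _ _
    simp [h0]
  have hI₂ : ∫ q in Ioc 0 c.L ×ˢ Ioc 0 δ, G₂ q = - ∫ s in 0..c.L, φ (c.x s, c.y s) * Q s := by
    rw [Measure.volume_eq_prod, setIntegral_prod _ (hintg cG₂), ← intervalIntegral.integral_neg,
      intervalIntegral.integral_of_le hL.le]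
    congr 1; ext s
    rw [← intervalIntegral.integral_of_le hδ.le,
      intervalIntegral.integral_eq_sub_of_hasDerivAt
        (f := fun τ => Q s * ((1 + c.a s * τ) * ψ (s, τ)))]
    · have h1 : ψ (s, δ) = 0 := hz s
      have h2 : ψ (s, 0) = φ (c.x s, c.y s) := by simp only [hψ, tube_zero]
      rw [h1, h2]; ring
    · intro τ _
      have h1 : HasDerivAt (fun τ => 1 + c.a s * τ) (c.a s) τ := by
        simpa using ((hasDerivAt_id τ).const_mul (c.a s)).const_add 1
      exact (h1.mul (hdt s τ)).const_mul (Q s)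
    · exact (cG₂.comp (by fun_prop : Continuous fun τ => (s, τ))).intervalIntegrable _ _
  simp only [hsplit]
  have := integral_sub (hintg cG₁) (hintg cG₂)
  rw [← Measure.volume_eq_prod, hI₁, hI₂] at this
  rw [this]; simp [hQ]

/-- **Green's formula** for a domain bounded by a regular `C²`-curve. -/
theorem Bounds.green {A : Set (ℝ × ℝ)} (hA : c.Bounds A) {φ : ℝ × ℝ → ℝ}
    (hφ : ContDiff ℝ 1 φ) (e : ℝ × ℝ) :
    ∫ q in A, fderiv ℝ φ q e =
      ∫ s in 0..c.L, φ (c.x s, c.y s) * (e.1 * c.y' s - e.2 * c.x' s) := by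
  have hL := c.L_pos
  obtain ⟨δ, hδ, hdet, hinj⟩ := c.exists_tube_radius
  have hab : ∀ {τ : ℝ}, τ ∈ Ioo (-δ) δ → |τ| ≤ δ := fun h => (abs_lt.2 h).le
  set U : Set (ℝ × ℝ) := c.tube '' (univ ×ˢ Ioo (-δ) δ) with hUdef
  have hU : IsOpen U := by
    rw [isOpen_iff_mem_nhds]
    rintro _ ⟨q, hq, rfl⟩
    obtain ⟨e, he⟩ := c.hasStrictFDerivAt_tube_equiv (q := q) (hdet _ _ (hab hq.2)).ne'
    rw [← he.map_nhds_eq_of_equiv]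
    exact image_mem_map ((isOpen_univ.prod isOpen_Ioo).mem_nhds hq)
  have hbd : ∀ {s τ}, |τ| ≤ δ → c.tube (s, τ) ∈ frontier A → τ = 0 := fun {s τ} hτ h => by
    rw [hA.frontier_eq] at h
    obtain ⟨t, ht⟩ := h
    simp only [← tube_zero] at ht
    exact (hinj t s 0 τ (by simpa using hδ.le) hτ ht).1.symm
  -- The open half tube is connected and, by injectivity of the coordinates, does not meet the
  -- curve, so one point in A suffices.
  have hin : ∀ s, ∀ τ ∈ Ioo 0 δ, c.tube (s, τ) ∈ A := by
    have hsub : c.tube '' (univ ×ˢ Ioo 0 δ) ⊆ A := by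
      refine subset_of_isPreconnected_of_disjoint_frontier
        ((isPreconnected_univ.prod isPreconnected_Ioo).image _ c.continuous_tube.continuousOn)
        ?_ ?_
      · obtain ⟨τ, hτ, hτ'⟩ := ((hA.inner 0).and (Ioo_mem_nhdsGT hδ)).exists
        exact ⟨c.tube (0, τ), ⟨(0, τ), ⟨mem_univ _, hτ'⟩, rfl⟩, hτ⟩
      · rw [disjoint_left]
        rintro _ ⟨⟨s, τ⟩, ⟨-, hτ⟩, rfl⟩ h
        have := hbd (hab ⟨by linarith [hτ.1], hτ.2⟩) h
        exact hτ.1.ne' this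
    exact fun s τ hτ => hsub ⟨_, ⟨mem_univ _, hτ⟩, rfl⟩
  have hout : ∀ s, ∀ τ ∈ Ioo (-δ) 0, c.tube (s, τ) ∉ A := by
    have hsub : c.tube '' (univ ×ˢ Ioo (-δ) 0) ⊆ Aᶜ := by
      refine subset_of_isPreconnected_of_disjoint_frontier
        ((isPreconnected_univ.prod isPreconnected_Ioo).image _ c.continuous_tube.continuousOn)
        ?_ ?_
      · obtain ⟨τ, hτ, hτ'⟩ := ((hA.outer 0).and (Ioo_mem_nhdsGT hδ)).exists
        exact ⟨c.tube (0, -τ), ⟨(0, -τ), ⟨mem_univ _, ⟨neg_lt_neg hτ'.2, neg_lt_zero.2 hτ'.1⟩⟩,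
          rfl⟩, hτ⟩
      · rw [disjoint_left]
        rintro _ ⟨⟨s, τ⟩, ⟨-, hτ⟩, rfl⟩ h
        rw [frontier_compl] at h
        have := hbd (hab ⟨hτ.1, by linarith [hτ.2]⟩) h
        exact hτ.2.ne this
    exact fun s τ hτ => hsub ⟨_, ⟨mem_univ _, hτ⟩, rfl⟩
  -- Inside the tube, A is exactly the side τ > 0, and one period of s covers it once. This prepares
  -- the change of variables.
  have hAU : A ∩ U = c.tube '' (Ioc 0 c.L ×ˢ Ioo 0 δ) := by
    ext z; constructor
    · rintro ⟨hzA, ⟨s, τ⟩, ⟨-, hτ⟩, rfl⟩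
      have hτ0 : 0 < τ := by
        rcases lt_trichotomy τ 0 with h | h | h
        · exact absurd hzA (hout s τ ⟨hτ.1, h⟩)
        · have : c.tube (s, τ) ∈ frontier A := by
            rw [hA.frontier_eq, h, tube_zero]; exact ⟨s, rfl⟩
          rw [hA.isOpen.frontier_eq] at this
          exact absurd hzA this.2
        · exact h
      refine ⟨(toIocMod hL 0 s, τ), ⟨by simpa using toIocMod_mem_Ioc hL 0 s, hτ0, hτ.2⟩, ?_⟩
      have := c.tube_periodic (toIocMod hL 0 s) τ (toIocDiv hL 0 s)
      rw [← this, toIocMod, zsmul_eq_mul]; simp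
    · rintro ⟨⟨s, τ⟩, ⟨-, hτ⟩, rfl⟩
      exact ⟨hin s τ hτ, ⟨_, ⟨mem_univ _, by linarith [hτ.1], hτ.2⟩, rfl⟩⟩
  have hinjOn : InjOn c.tube (Ioc 0 c.L ×ˢ Ioo 0 δ) := by
    rintro ⟨s, τ⟩ ⟨hs, hτ⟩ ⟨t, σ⟩ ⟨ht, hσ⟩ h
    obtain ⟨h1, k, hk⟩ := hinj s t τ σ (hab ⟨by linarith [hτ.1], hτ.2⟩)
      (hab ⟨by linarith [hσ.1], hσ.2⟩) h
    simp only at hs ht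
    have a1 : (k : ℝ) < 1 := by
      by_contra! h
      nlinarith [hs.1, ht.2]
    have a2 : (-1 : ℝ) < k := by
      by_contra! h
      nlinarith [ht.1, hs.2]
    have : k = 0 := by
      have h1' : k < 1 := by exact_mod_cast a1
      have h2' : -1 < k := by exact_mod_cast a2
      omega
    rw [hk, h1, this]; simp
  -- cut off near the curve
  have hΓ : IsCompact (frontier A) :=
    Metric.isCompact_of_isClosed_isBounded isClosed_frontier
      (hA.isBounded.closure.subset frontier_subset_closure)
  have hΓU : frontier A ⊆ U := by
    rw [hA.frontier_eq]
    rintro _ ⟨s, rfl⟩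
    exact ⟨(s, 0), ⟨mem_univ _, by linarith, hδ⟩, c.tube_zero s⟩
  obtain ⟨χ, hχ, hχc, hχU, -, -, W, hW, hΓW, hone⟩ := exists_cutoff hΓ hU hΓU
  have hχ1 : ContDiff ℝ 1 χ := hχ.of_le (by simp)
  set φ₁ : ℝ × ℝ → ℝ := fun q => χ q * φ q with hφ₁
  set φ₀ : ℝ × ℝ → ℝ := fun q => (1 - χ q) * φ q with hφ₀
  have hc₁ : ContDiff ℝ 1 φ₁ := hχ1.mul hφ
  have hc₀ : ContDiff ℝ 1 φ₀ := (contDiff_const.sub hχ1).mul hφ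
  have hcont : ∀ {ψ : ℝ × ℝ → ℝ}, ContDiff ℝ 1 ψ →
      IntegrableOn (fun q => fderiv ℝ ψ q e) A := fun {ψ} hψ =>
    (((hψ.continuous_fderiv one_ne_zero).clm_apply
      continuous_const).continuousOn.integrableOn_compact
      (Metric.isCompact_of_isClosed_isBounded isClosed_closure hA.isBounded.closure)).mono_set
      subset_closure
  have hsum : ∫ q in A, fderiv ℝ φ q e =
      (∫ q in A, fderiv ℝ φ₁ q e) + ∫ q in A, fderiv ℝ φ₀ q e := by
    rw [← integral_add (hcont hc₁) (hcont hc₀)]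
    congr 1; ext q
    have : φ = φ₁ + φ₀ := by ext q; simp only [hφ₁, hφ₀, Pi.add_apply]; ring
    rw [this, fderiv_add ((hc₁.differentiable one_ne_zero) q) ((hc₀.differentiable one_ne_zero) q)]
    rfl
  -- φ₀ vanishes near the boundary of A, so its extension by zero outside A is of class C¹ with
  -- compact support on the whole plane.
  have h₀ : ∫ q in A, fderiv ℝ φ₀ q e = 0 := by
    set ψ := A.indicator φ₀ with hψ
    have hout' : ∀ q ∉ closure A, ψ =ᶠ[𝓝 q] fun _ => 0 := fun q hq => by
      filter_upwards [isClosed_closure.isOpen_compl.mem_nhds hq] with z hz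
      exact indicator_of_notMem (fun h => hz (subset_closure h)) _
    have hbdz : ∀ q ∈ frontier A, ψ =ᶠ[𝓝 q] fun _ => 0 := fun q hq => by
      filter_upwards [hW.mem_nhds (hΓW hq)] with z hz
      by_cases h : z ∈ A
      · simp [hψ, indicator_of_mem h, hφ₀, hone z hz]
      · simp [hψ, indicator_of_notMem h]
    have hins : ∀ q ∈ A, ψ =ᶠ[𝓝 q] φ₀ := fun q hq => by
      filter_upwards [hA.isOpen.mem_nhds hq] with z hz
      exact indicator_of_mem hz _
    have hzero : ∀ q ∉ A, ψ =ᶠ[𝓝 q] fun _ => 0 := fun q hq => by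
      by_cases h : q ∈ closure A
      · exact hbdz q (by rw [hA.isOpen.frontier_eq]; exact ⟨h, hq⟩)
      · exact hout' q h
    have hψc : ContDiff ℝ 1 ψ := contDiff_iff_contDiffAt.2 fun q => by
      by_cases h : q ∈ A
      · exact hc₀.contDiffAt.congr_of_eventuallyEq (hins q h)
      · exact contDiffAt_const.congr_of_eventuallyEq (hzero q h)
    have hψs : HasCompactSupport ψ :=
      HasCompactSupport.of_support_subset_isCompact
        (Metric.isCompact_of_isClosed_isBounded isClosed_closure hA.isBounded.closure)
        (support_indicator_subset.trans subset_closure)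
    have hI := integral_fderiv_eq_zero volume hψc hψs e
    rw [← setIntegral_eq_integral_of_forall_compl_eq_zero (s := A)
      fun q hq => by rw [(hzero q hq).fderiv_eq]; simp] at hI
    rw [← hI]
    exact setIntegral_congr_fun hA.isOpen.measurableSet fun q hq => by
      simp only [(hins q hq).fderiv_eq]
  have hts : tsupport φ₁ ⊆ U := (tsupport_mul_subset_left).trans hχU
  have h₁ : ∫ q in A, fderiv ℝ φ₁ q e =
      ∫ s in 0..c.L, φ₁ (c.x s, c.y s) * (e.1 * c.y' s - e.2 * c.x' s) := by
    rw [← integral_tube hδ hc₁ e]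
    · have e1 : ∫ q in A, fderiv ℝ φ₁ q e = ∫ q in A ∩ U, fderiv ℝ φ₁ q e := by
        refine setIntegral_eq_of_subset_of_forall_sdiff_eq_zero hA.isOpen.measurableSet
          inter_subset_left fun q hq => ?_
        rw [fderiv_eq_zero_of_notMem_tsupport fun h => hq.2 ⟨hq.1, hts h⟩]; simp
      rw [e1, hAU, integral_image_eq_integral_abs_det_fderiv_smul volume
        (measurableSet_Ioc.prod measurableSet_Ioo)
        (fun q _ => (c.hasFDerivAt_tube q).hasFDerivWithinAt) hinjOn]
      have e2 : (Ioc 0 c.L ×ˢ Ioo 0 δ : Set (ℝ × ℝ)) =ᵐ[volume] Ioc 0 c.L ×ˢ Ioc 0 δ := by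
        rw [Measure.volume_eq_prod]
        exact Measure.set_prod_ae_eq (ae_eq_refl _) Ioo_ae_eq_Ioc
      rw [setIntegral_congr_set e2]
      refine setIntegral_congr_fun (measurableSet_Ioc.prod measurableSet_Ioc) fun q hq => ?_
      have := hdet q.1 q.2 (by rw [abs_of_pos hq.2.1]; exact hq.2.2)
      simp only [tubeDeriv_det, abs_of_pos this, smul_eq_mul]
    · intro s
      refine image_eq_zero_of_notMem_tsupport fun h => ?_
      obtain ⟨⟨t, σ⟩, ⟨-, hσ⟩, h'⟩ := hts h
      have := (hinj t s σ δ (hab hσ) (abs_of_pos hδ).le h').1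
      exact hσ.2.ne this
  rw [hsum, h₀, add_zero, h₁]
  congr 1; ext s
  have : (c.x s, c.y s) ∈ frontier A := by rw [hA.frontier_eq]; exact ⟨s, rfl⟩
  simp only [hφ₁, hone _ (hΓW this), one_mul]

end UnitSpeedLoop

end Green

/-! ### Space-time cylinders -/

section Products

/-- Makes the results on weak derivatives, stated for a Haar measure on one space, applicable to the
volume of space-time. -/
instance instIsAddHaarMeasureProdVolume {E F : Type*} [NormedAddCommGroup E] [MeasureSpace E]
    [BorelSpace E] [NormedAddCommGroup F] [MeasureSpace F] [BorelSpace F]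
    [SecondCountableTopology E] [SecondCountableTopology F]
    [(volume : Measure E).IsAddHaarMeasure] [(volume : Measure F).IsAddHaarMeasure]
    [SFinite (volume : Measure E)] [SFinite (volume : Measure F)] :
    (volume : Measure (E × F)).IsAddHaarMeasure :=
  Measure.prod.instIsAddHaarMeasure _ _

theorem _root_.Continuous.integrableOn_of_isBounded {Z : Type*} [MetricSpace Z]
    [ProperSpace Z]
    [MeasurableSpace Z] [OpensMeasurableSpace Z] {μ : Measure Z} [IsFiniteMeasureOnCompacts μ]
    {F : Z → ℝ} (hF : Continuous F) {S : Set Z} (hS : Bornology.IsBounded S) :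
    IntegrableOn F S μ :=
  (hF.continuousOn.integrableOn_compact
    (Metric.isCompact_of_isClosed_isBounded isClosed_closure hS.closure)).mono_set subset_closure

theorem setIntegral_prod_volume {E F : Type*} [MeasureSpace E] [MeasureSpace F]
    [SFinite (volume : Measure E)] [SFinite (volume : Measure F)] {f : E × F → ℝ} {s : Set E}
    {t : Set F} (hf : IntegrableOn f (s ×ˢ t)) :
    ∫ z in s ×ˢ t, f z = ∫ x in s, ∫ y in t, f (x, y) :=
  setIntegral_prod f hf

theorem isBounded_timeCyl {E : Type*} [NormedAddCommGroup E] (T : ℝ) {G : Set E}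
    (hG : Bornology.IsBounded G) : Bornology.IsBounded (timeCyl T G) :=
  (Metric.isBounded_Ioo 0 T).prod hG

theorem timeCyl_isOpen {E : Type*} [NormedAddCommGroup E] (T : ℝ) {G : Set E}
    (hG : IsOpen G) : IsOpen (timeCyl T G) :=
  isOpen_Ioo.prod hG

end Products

section GreenCylinder

variable {Y : Type*} [NormedAddCommGroup Y] [NormedSpace ℝ Y] [FiniteDimensional ℝ Y]
  [MeasureSpace Y] [BorelSpace Y] [(volume : Measure Y).IsAddHaarMeasure]

/-- The fundamental theorem of calculus in the last variable of a space-time cylinder. -/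
theorem integral_fderiv_vertical {T h : ℝ} (hh : 0 < h) {S : Set Y}
    (hS : Bornology.IsBounded S) {Ψ : ℝ × (Y × ℝ) → ℝ} (hΨ : ContDiff ℝ 1 Ψ) :
    ∫ q in timeCyl T (S ×ˢ Ioo (-h) h), fderiv ℝ Ψ q (0, (0, 1)) =
      ∫ q in timeCyl T S, (Ψ (q.1, (q.2, h)) - Ψ (q.1, (q.2, -h))) := by
  have : ProperSpace Y := FiniteDimensional.proper ℝ Y
  have hc : Continuous fun q => fderiv ℝ Ψ q (0, (0, 1)) :=
    (hΨ.continuous_fderiv one_ne_zero).clm_apply continuous_const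
  have hintg : IntegrableOn (fun q => fderiv ℝ Ψ q (0, (0, 1))) (timeCyl T (S ×ˢ Ioo (-h) h)) :=
    hc.integrableOn_of_isBounded (isBounded_timeCyl T (hS.prod (Metric.isBounded_Ioo _ _)))
  have cΨ := hΨ.continuous
  have hintg2 : IntegrableOn (fun q : ℝ × Y => Ψ (q.1, (q.2, h)) - Ψ (q.1, (q.2, -h)))
      (timeCyl T S) :=
    (by fun_prop : Continuous fun q : ℝ × Y =>
      Ψ (q.1, (q.2, h)) - Ψ (q.1, (q.2, -h))).integrableOn_of_isBounded (isBounded_timeCyl T hS)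
  rw [timeCyl, setIntegral_prod_volume hintg, timeCyl, setIntegral_prod_volume hintg2]
  congr 1; ext t
  have hintg3 : IntegrableOn (fun r => fderiv ℝ Ψ (t, r) (0, (0, 1))) (S ×ˢ Ioo (-h) h) :=
    (hc.comp (by fun_prop : Continuous fun r => (t, r))).integrableOn_of_isBounded
      (hS.prod (Metric.isBounded_Ioo _ _))
  rw [setIntegral_prod_volume hintg3]
  congr 1; ext y
  rw [← integral_Ioc_eq_integral_Ioo, ← intervalIntegral.integral_of_le (by linarith),
    intervalIntegral.integral_eq_sub_of_hasDerivAt (f := fun z => Ψ (t, (y, z)))]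
  · intro z _
    have h1 : HasDerivAt (fun z : ℝ => (t, (y, z))) ((0, (0, 1)) : ℝ × (Y × ℝ)) z :=
      (hasDerivAt_const z t).prodMk ((hasDerivAt_const z y).prodMk (hasDerivAt_id z))
    have h2 := HasFDerivAt.comp_hasDerivAt (l := Ψ) (f := fun z : ℝ => (t, (y, z))) z
      ((hΨ.differentiable one_ne_zero) _).hasFDerivAt h1
    exact h2
  · exact (hc.comp (by fun_prop : Continuous fun z => (t, (y, z)))).intervalIntegrable _ _

end GreenCylinder

/-! ### Geometry of the pore and the divergence theorem in the bulk -/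

section PoreGeometry

/-- The plane as a product. -/
def planeEquiv : Plane ≃L[ℝ] ℝ × ℝ :=
  (EuclideanSpace.equiv (Fin 2) ℝ).trans (ContinuousLinearEquiv.finTwoArrow ℝ ℝ)

theorem planeEquiv_apply (v : Plane) : planeEquiv v = (v 0, v 1) := rfl

theorem planeEquiv_measurePreserving : MeasurePreserving planeEquiv volume volume :=
  (volume_preserving_finTwoArrow ℝ).comp
    (EuclideanSpace.volume_preserving_symm_measurableEquiv_toLp (Fin 2))

namespace Pore

variable (P : Pore)

theorem hasDerivAt_γ (s : ℝ) : HasDerivAt P.γ (deriv P.γ s) s :=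
  ((P.contDiff.differentiable (by simp)) s).hasDerivAt

theorem contDiff_deriv_γ : ContDiff ℝ 1 (deriv P.γ) := by
  have := P.contDiff
  rw [show (2 : WithTop ℕ∞) = 1 + 1 by norm_num] at this
  exact (contDiff_succ_iff_deriv.1 this).2.2

theorem continuous_γ : Continuous P.γ := P.contDiff.continuous

theorem continuous_deriv_γ : Continuous (deriv P.γ) := P.contDiff_deriv_γ.continuous

/-- The boundary curve of the cross section. -/
def loop : UnitSpeedLoop where
  L := P.len
  x s := P.γ s 0
  y s := P.γ s 1
  x' s := deriv P.γ s 0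
  y' s := deriv P.γ s 1
  x'' s := deriv (deriv P.γ) s 0
  y'' s := deriv (deriv P.γ) s 1
  L_pos := P.len_pos
  hx s := ((EuclideanSpace.proj (𝕜 := ℝ) (0 : Fin 2)).hasFDerivAt).comp_hasDerivAt s
    (P.hasDerivAt_γ s)
  hy s := ((EuclideanSpace.proj (𝕜 := ℝ) (1 : Fin 2)).hasFDerivAt).comp_hasDerivAt s
    (P.hasDerivAt_γ s)
  hx' s := ((EuclideanSpace.proj (𝕜 := ℝ) (0 : Fin 2)).hasFDerivAt).comp_hasDerivAt s
    ((P.contDiff_deriv_γ.differentiable one_ne_zero) s).hasDerivAt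
  hy' s := ((EuclideanSpace.proj (𝕜 := ℝ) (1 : Fin 2)).hasFDerivAt).comp_hasDerivAt s
    ((P.contDiff_deriv_γ.differentiable one_ne_zero) s).hasDerivAt
  hx'' := (EuclideanSpace.proj (𝕜 := ℝ) (0 : Fin 2)).continuous.comp
    (P.contDiff_deriv_γ.continuous_deriv le_rfl)
  hy'' := (EuclideanSpace.proj (𝕜 := ℝ) (1 : Fin 2)).continuous.comp
    (P.contDiff_deriv_γ.continuous_deriv le_rfl)
  unit s := by
    have h := P.unitSpeed s
    rw [EuclideanSpace.norm_eq, Real.sqrt_eq_one] at h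
    simpa [Fin.sum_univ_two] using h
  perx s := by simp only [P.periodic s]
  pery s := by simp only [P.periodic s]
  inj s t hx hy := by
    have hγ : P.γ s = P.γ t := by
      ext i; fin_cases i
      · exact hx
      · exact hy
    have e : ∀ r, P.γ (toIcoMod P.len_pos 0 r) = P.γ r := fun r => by
      rw [toIcoMod, P.periodic.sub_zsmul_eq]
    have m : ∀ r, toIcoMod P.len_pos 0 r ∈ Ico 0 P.len := fun r => by
      simpa using toIcoMod_mem_Ico P.len_pos 0 r
    have h := P.injOn (m s) (m t) (by rw [e, e, hγ])
    refine ⟨toIcoDiv P.len_pos 0 t - toIcoDiv P.len_pos 0 s, ?_⟩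
    simp only [toIcoMod, zsmul_eq_mul] at h
    push_cast
    linarith

/-- Positive τ moves against the outer normal `turn (deriv P.γ s)`; hence `inner_side` and
`outer_side` become the two sidedness conditions of `Bounds`. -/
theorem loop_tube (s τ : ℝ) :
    P.loop.tube (s, τ) = planeEquiv (P.γ s - τ • turn (deriv P.γ s)) := by
  simp [UnitSpeedLoop.tube, loop, planeEquiv_apply, turn]

theorem loop_bounds : P.loop.Bounds (planeEquiv '' P.A) where
  isOpen := planeEquiv.toHomeomorph.isOpenMap _ P.isOpen
  isBounded := planeEquiv.lipschitz.isBounded_image P.isBounded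
  frontier_eq := by
    have h := planeEquiv.toHomeomorph.image_frontier P.A
    rw [P.frontier_eq, ← range_comp] at h
    exact h.symm
  inner s := by
    filter_upwards [P.inner_side s] with τ hτ
    rw [loop_tube]
    exact ⟨_, hτ, rfl⟩
  outer s := by
    filter_upwards [P.outer_side s] with τ hτ
    rw [loop_tube]
    rintro ⟨z, hz, h⟩
    have := planeEquiv.injective h
    rw [this, neg_smul, sub_neg_eq_add] at hz
    exact hτ hz

/-- Green's formula on the cross section. -/
theorem green_section {φ : Plane → ℝ} (hφ : ContDiff ℝ 1 φ) (v : Plane) :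
    ∫ y in P.A, fderiv ℝ φ y v = ∫ s in 0..P.len, φ (P.γ s) *
      (v 0 * turn (deriv P.γ s) 0 + v 1 * turn (deriv P.γ s) 1) := by
  have hg := P.loop_bounds.green (φ := φ ∘ planeEquiv.symm)
    (hφ.comp planeEquiv.symm.contDiff) (planeEquiv v)
  have h1 : ∫ y in P.A, fderiv ℝ φ y v =
      ∫ q in planeEquiv '' P.A, fderiv ℝ (φ ∘ planeEquiv.symm) q (planeEquiv v) := by
    have hemb : MeasurableEmbedding planeEquiv := planeEquiv.toHomeomorph.measurableEmbedding
    rw [planeEquiv_measurePreserving.setIntegral_image_emb hemb]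
    congr 1; ext y
    have := planeEquiv.symm.comp_right_fderiv (f := φ) (x := planeEquiv y)
    rw [this]; simp
  rw [h1, hg]
  have e : ∀ s, planeEquiv.symm ((P.loop.x s, P.loop.y s) : ℝ × ℝ) = P.γ s := fun s => by
    rw [ContinuousLinearEquiv.symm_apply_eq]; rfl
  change ∫ s in 0..P.len, _ = _
  congr 1; ext s
  simp only [Function.comp_apply, e, planeEquiv_apply, turn]
  simp only [loop]
  simp
  ring_nf
  simp

theorem isOpen_bulk : IsOpen P.bulk := P.isOpen.prod isOpen_Ioo

theorem isBounded_bulk : Bornology.IsBounded P.bulk := P.isBounded.prod (Metric.isBounded_Ioo _ _)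

theorem isOpen_cell : IsOpen P.cell := isOpen_Ioo.prod isOpen_Ioo

theorem isBounded_cell : Bornology.IsBounded P.cell :=
  (Metric.isBounded_Ioo _ _).prod (Metric.isBounded_Ioo _ _)

theorem isOpen_strip : IsOpen P.strip := isOpen_univ.prod isOpen_Ioo

theorem continuous_lateral : Continuous P.lateral :=
  (P.continuous_γ.comp continuous_fst).prodMk continuous_snd

theorem continuous_turn : Continuous turn := by
  unfold turn
  refine (PiLp.continuous_toLp 2 _).comp (continuous_pi fun i => ?_)
  fin_cases i
  · exact (EuclideanSpace.proj (𝕜 := ℝ) (1 : Fin 2)).continuous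
  · exact (EuclideanSpace.proj (𝕜 := ℝ) (0 : Fin 2)).continuous.neg

theorem continuous_normalLat (j : Fin 3) : Continuous fun x => P.normalLat x j := by
  have h : Continuous fun x : ℝ × ℝ => turn (deriv P.γ x.1) :=
    continuous_turn.comp (P.continuous_deriv_γ.comp continuous_fst)
  fin_cases j
  · exact (EuclideanSpace.proj (𝕜 := ℝ) (0 : Fin 2)).continuous.comp h
  · exact (EuclideanSpace.proj (𝕜 := ℝ) (1 : Fin 2)).continuous.comp h
  · exact continuous_const

/-- Green's formula on the space-time cylinder in a horizontal direction. -/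
theorem green_horizontal (T : ℝ) {Ψ : ℝ × Space → ℝ} (hΨ : ContDiff ℝ 1 Ψ) (v : Plane) :
    ∫ q in timeCyl T P.bulk, fderiv ℝ Ψ q (0, (v, 0)) = ∫ q in timeCyl T P.cell,
      Ψ (q.1, P.lateral q.2) *
        (v 0 * turn (deriv P.γ q.2.1) 0 + v 1 * turn (deriv P.γ q.2.1) 1) := by
  have hc : Continuous fun q => fderiv ℝ Ψ q (0, (v, 0)) :=
    (hΨ.continuous_fderiv one_ne_zero).clm_apply continuous_const
  have cΨ := hΨ.continuous
  have cl := P.continuous_lateral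
  have ct : Continuous fun s => v 0 * turn (deriv P.γ s) 0 + v 1 * turn (deriv P.γ s) 1 := by
    have h := continuous_turn.comp P.continuous_deriv_γ
    exact (continuous_const.mul
      ((EuclideanSpace.proj (𝕜 := ℝ) (0 : Fin 2)).continuous.comp h)).add (continuous_const.mul
      ((EuclideanSpace.proj (𝕜 := ℝ) (1 : Fin 2)).continuous.comp h))
  set κ : ℝ → ℝ := fun s => v 0 * turn (deriv P.γ s) 0 + v 1 * turn (deriv P.γ s) 1 with hκ
  have hc2 : Continuous fun q : ℝ × (ℝ × ℝ) => Ψ (q.1, P.lateral q.2) * κ q.2.1 := by fun_prop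
  rw [timeCyl, setIntegral_prod_volume
    (hc.integrableOn_of_isBounded (isBounded_timeCyl T P.isBounded_bulk)), timeCyl,
    setIntegral_prod_volume
    (hc2.integrableOn_of_isBounded (isBounded_timeCyl T P.isBounded_cell))]
  congr 1; ext t
  have i1 : IntegrableOn (fun r => fderiv ℝ Ψ (t, r) (0, (v, 0))) (P.A ×ˢ Ioo (-P.h) P.h) :=
    (hc.comp (by fun_prop : Continuous fun r => (t, r))).integrableOn_of_isBounded
      P.isBounded_bulk
  have i2 : IntegrableOn (fun r : ℝ × ℝ => Ψ (t, P.lateral r) * κ r.1)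
      (Ioo 0 P.len ×ˢ Ioo (-P.h) P.h) :=
    (by fun_prop : Continuous fun r : ℝ × ℝ =>
      Ψ (t, P.lateral r) * κ r.1).integrableOn_of_isBounded P.isBounded_cell
  rw [bulk, setIntegral_prod_volume i1, cell, setIntegral_prod_volume i2]
  rw [IntegrableOn, Measure.volume_eq_prod, ← Measure.prod_restrict] at i1 i2
  -- With z as the outer variable, Green's formula applies on each cross section at fixed t and z.
  rw [integral_integral_swap (f := fun y z => fderiv ℝ Ψ (t, (y, z)) (0, (v, 0))) i1,
    integral_integral_swap (f := fun s z => Ψ (t, P.lateral (s, z)) * κ s) i2]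
  congr 1; ext z
  have hemb : ContDiff ℝ 1 fun y : Plane => ((t, (y, z)) : ℝ × Space) := by fun_prop
  have hg := P.green_section (hΨ.comp hemb) v
  have hd : ∀ y, fderiv ℝ (Ψ ∘ fun y : Plane => ((t, (y, z)) : ℝ × Space)) y v =
      fderiv ℝ Ψ (t, (y, z)) (0, (v, 0)) := fun y => by
    have h1 : HasFDerivAt (fun y : Plane => ((t, (y, z)) : ℝ × Space))
        ((0 : Plane →L[ℝ] ℝ).prod ((ContinuousLinearMap.id ℝ Plane).prod 0)) y :=
      (hasFDerivAt_const t y).prodMk ((hasFDerivAt_id y).prodMk (hasFDerivAt_const z y))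
    rw [(((hΨ.differentiable one_ne_zero) _).hasFDerivAt.comp y h1).fderiv]
    simp
  simp only [hd] at hg
  rw [hg, intervalIntegral.integral_of_le P.len_pos.le, integral_Ioc_eq_integral_Ioo]
  rfl

/-- The boundary integral of the normal component of a vector field. -/
def boundaryFlux (T : ℝ) (Ψ : Fin 3 → ℝ × Space → ℝ) : ℝ :=
  (∫ q in timeCyl T P.A, ∑ j, normalIn j * Ψ j (q.1, P.inlet q.2)) +
  (∫ q in timeCyl T P.A, ∑ j, normalOut j * Ψ j (q.1, P.outlet q.2)) +
  ∫ q in timeCyl T P.cell, ∑ j, P.normalLat q.2 j * Ψ j (q.1, P.lateral q.2)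

/-- The divergence theorem on the space-time cylinder. -/
theorem integral_divergence (T : ℝ) {Ψ : Fin 3 → ℝ × Space → ℝ} (hΨ : ∀ j, ContDiff ℝ 1 (Ψ j)) :
    ∫ q in timeCyl T P.bulk, ∑ j, fderiv ℝ (Ψ j) q (0, axis j) = P.boundaryFlux T Ψ := by
  have hintg : ∀ j, IntegrableOn (fun q => fderiv ℝ (Ψ j) q (0, axis j)) (timeCyl T P.bulk) :=
    fun j => (((hΨ j).continuous_fderiv one_ne_zero).clm_apply
      continuous_const).integrableOn_of_isBounded (isBounded_timeCyl T P.isBounded_bulk)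
  rw [integral_finsetSum _ fun j _ => hintg j, Fin.sum_univ_three]
  have h0 := P.green_horizontal T (hΨ 0) (EuclideanSpace.single 0 1)
  have h1 := P.green_horizontal T (hΨ 1) (EuclideanSpace.single 1 1)
  have h2 := integral_fderiv_vertical (T := T) P.h_pos P.isBounded (hΨ 2)
  have c0 := (hΨ 0).continuous
  have c1 := (hΨ 1).continuous
  have c2 := (hΨ 2).continuous
  have cl := P.continuous_lateral
  have ct : ∀ i : Fin 2, Continuous fun s => turn (deriv P.γ s) i := fun i =>
    (EuclideanSpace.proj (𝕜 := ℝ) i).continuous.comp (continuous_turn.comp P.continuous_deriv_γ)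
  have ct0 := ct 0
  have ct1 := ct 1
  simp at h0 h1
  simp only [axis, Matrix.cons_val_zero, Matrix.cons_val_one, Matrix.cons_val]
  have k0 : IntegrableOn (fun q : ℝ × (ℝ × ℝ) =>
      Ψ 0 (q.1, P.lateral q.2) * turn (deriv P.γ q.2.1) 0) (timeCyl T P.cell) :=
    ((c0.comp (continuous_fst.prodMk (cl.comp continuous_snd))).mul
      (ct0.comp (continuous_fst.comp continuous_snd))).integrableOn_of_isBounded
      (isBounded_timeCyl T P.isBounded_cell)
  have k1 : IntegrableOn (fun q : ℝ × (ℝ × ℝ) =>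
      Ψ 1 (q.1, P.lateral q.2) * turn (deriv P.γ q.2.1) 1) (timeCyl T P.cell) :=
    ((c1.comp (continuous_fst.prodMk (cl.comp continuous_snd))).mul
      (ct1.comp (continuous_fst.comp continuous_snd))).integrableOn_of_isBounded
      (isBounded_timeCyl T P.isBounded_cell)
  have k2 : IntegrableOn (fun q : ℝ × Plane => Ψ 2 (q.1, (q.2, P.h))) (timeCyl T P.A) :=
    (c2.comp (continuous_fst.prodMk (continuous_snd.prodMk
      continuous_const))).integrableOn_of_isBounded (isBounded_timeCyl T P.isBounded)
  have k3 : IntegrableOn (fun q : ℝ × Plane => Ψ 2 (q.1, (q.2, -P.h))) (timeCyl T P.A) :=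
    (c2.comp (continuous_fst.prodMk (continuous_snd.prodMk
      continuous_const))).integrableOn_of_isBounded (isBounded_timeCyl T P.isBounded)
  rw [integral_sub k2 k3] at h2
  rw [h0, h1, ← integral_add k0 k1]
  change _ + ∫ q in timeCyl T (P.A ×ˢ Ioo (-P.h) P.h), _ = _
  rw [h2, boundaryFlux]
  have e1 : ∀ q : ℝ × Plane, ∑ j, normalIn j * Ψ j (q.1, P.inlet q.2) =
      -Ψ 2 (q.1, (q.2, -P.h)) := fun q => by
    simp [Fin.sum_univ_three, normalIn, inlet]
  have e2 : ∀ q : ℝ × Plane, ∑ j, normalOut j * Ψ j (q.1, P.outlet q.2) =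
      Ψ 2 (q.1, (q.2, P.h)) := fun q => by
    simp [Fin.sum_univ_three, normalOut, outlet]
  have e3 : ∀ q : ℝ × (ℝ × ℝ), ∑ j, P.normalLat q.2 j * Ψ j (q.1, P.lateral q.2) =
      Ψ 0 (q.1, P.lateral q.2) * turn (deriv P.γ q.2.1) 0 +
        Ψ 1 (q.1, P.lateral q.2) * turn (deriv P.γ q.2.1) 1 := fun q => by
    simp [Fin.sum_univ_three, normalLat]; ring
  simp only [e1, e2, e3, integral_neg]
  ring

end Pore

end PoreGeometry

/-! ### L¹-convergence of smooth approximations and of their boundary values -/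

section Convergence

variable {Y : Type*} [MeasurableSpace Y] {μ : Measure Y}

/-- Convergence in `L¹(μ)` of a sequence of integrable functions. -/
structure L1Tendsto (μ : Measure Y) (F : ℕ → Y → ℝ) (F' : Y → ℝ) : Prop where
  int_seq : ∀ m, Integrable (F m) μ
  int : Integrable F' μ
  lim : Tendsto (fun m => eLpNorm (fun y => F m y - F' y) 1 μ) atTop (𝓝 0)

theorem L1Tendsto.const {f : Y → ℝ} (hf : Integrable f μ) : L1Tendsto μ (fun _ => f) f :=
  ⟨fun _ => hf, hf, by simp⟩

/-- The common form of the limits below: a bounded weight, a bounded continuous function of the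
strongly convergent `F`, and one linear factor `G`, usually a derivative. Separate index types allow
several functions inside the nonlinearity and a sum over directions outside. -/
theorem tendsto_integral_sum_comp_mul {ι κ : Type*} [Fintype ι] [Fintype κ]
    {F : ℕ → ι → Y → ℝ} {F' : ι → Y → ℝ} {G : ℕ → κ → Y → ℝ} {G' : κ → Y → ℝ}
    {B : κ → (ι → ℝ) → ℝ} {k : κ → Y → ℝ} {C D : κ → ℝ}
    (hB : ∀ j, Continuous (B j)) (hBC : ∀ j z, |B j z| ≤ C j)
    (hk : ∀ j, AEStronglyMeasurable (k j) μ) (hkD : ∀ j y, |k j y| ≤ D j)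
    (hF : ∀ i, L1Tendsto μ (fun m => F m i) (F' i))
    (hG : ∀ j, L1Tendsto μ (fun m => G m j) (G' j)) :
    Tendsto (fun m => ∫ y, ∑ j, k j y * (B j (fun i => F m i y) * G m j y) ∂μ) atTop
      (𝓝 (∫ y, ∑ j, k j y * (B j (fun i => F' i y) * G' j y) ∂μ)) := by
  have hintg : ∀ {H : ι → Y → ℝ} {g : Y → ℝ} (j : κ), (∀ i, Integrable (H i) μ) →
      Integrable g μ → Integrable (fun y => k j y * (B j (fun i => H i y) * g y)) μ :=
    fun {H g} j hH hg => by
      have : AEStronglyMeasurable (fun y => B j fun i => H i y) μ :=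
        (hB j).comp_aestronglyMeasurable
          (aemeasurable_pi_lambda _ fun i => (hH i).1.aemeasurable).aestronglyMeasurable
      exact (hg.bdd_mul (c := C j) this (ae_of_all _ fun y => hBC j _)).bdd_mul (c := D j) (hk j)
        (ae_of_all _ fun y => hkD j y)
  have h1 : ∀ m, ∫ y, ∑ j, k j y * (B j (fun i => F m i y) * G m j y) ∂μ =
      ∑ j, ∫ y, k j y * (B j (fun i => F m i y) * G m j y) ∂μ := fun m =>
    integral_finsetSum _ fun j _ => hintg j (fun i => (hF i).int_seq m) ((hG j).int_seq m)
  rw [integral_finsetSum _ fun j _ => hintg j (fun i => (hF i).int) (hG j).int]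
  simp only [h1]
  exact tendsto_finsetSum _ fun j _ => tendsto_integral_comp_mul (hB j) (hBC j) (hk j) (hkD j)
    (fun m i => ((hF i).int_seq m).1) (fun i => (hF i).int.1) (fun i => (hF i).lim)
    (fun m => ((hG j).int_seq m).1) (hG j).int (hG j).lim

theorem tendsto_eLpNorm_one_of_tendsto_eLpNorm [IsFiniteMeasure μ] {p : ENNReal} (hp : 1 ≤ p)
    {F : ℕ → Y → ℝ} (hF : ∀ m, AEStronglyMeasurable (F m) μ)
    (h : Tendsto (fun m => eLpNorm (F m) p μ) atTop (𝓝 0)) :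
    Tendsto (fun m => eLpNorm (F m) 1 μ) atTop (𝓝 0) := by
  have hc : μ univ ^ (1 / (1 : ENNReal).toReal - 1 / p.toReal) ≠ ⊤ := by
    refine ENNReal.rpow_ne_top_of_nonneg ?_ (measure_ne_top _ _)
    simp only [ENNReal.toReal_one, div_one, sub_nonneg]
    rcases eq_or_ne p ⊤ with rfl | hpt
    · simp
    · exact div_le_one_of_le₀ ((ENNReal.toReal_mono hpt hp).trans' (by simp)) ENNReal.toReal_nonneg
  have h0 := ENNReal.Tendsto.mul_const h (Or.inr hc)
  rw [zero_mul] at h0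
  exact tendsto_of_tendsto_of_tendsto_of_le_of_le tendsto_const_nhds h0 (fun _ => zero_le)
    fun m => eLpNorm_le_eLpNorm_mul_rpow_measure_univ hp (hF m)

theorem L1Tendsto.of_memLp [IsFiniteMeasure μ] {p : ENNReal} (hp : 1 ≤ p) {F : ℕ → Y → ℝ}
    {F' : Y → ℝ} (hF : ∀ m, Integrable (F m) μ) (hF' : MemLp F' p μ)
    (h : Tendsto (fun m => eLpNorm (fun y => F m y - F' y) p μ) atTop (𝓝 0)) :
    L1Tendsto μ F F' :=
  ⟨hF, hF'.integrable hp, tendsto_eLpNorm_one_of_tendsto_eLpNorm hp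
    (fun m => (hF m).1.sub hF'.1) h⟩

end Convergence

section Charts

variable {E Y : Type*} [NormedAddCommGroup E] [NormedSpace ℝ E] [MeasureSpace E] [BorelSpace E]
  [SecondCountableTopology E] [NormedAddCommGroup Y] [MeasureSpace Y] [BorelSpace Y]
  [SecondCountableTopology Y] [ProperSpace Y] [IsFiniteMeasureOnCompacts (volume : Measure Y)]
  [SFinite (volume : Measure Y)]

theorem volume_restrict_timeCyl (T : ℝ) (S : Set Y) :
    volume.restrict (timeCyl T S) = (volume.restrict (Ioo 0 T)).prod (volume.restrict S) :=
  (Measure.prod_restrict _ _).symm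

theorem map_timeCyl (T : ℝ) (S : Set Y) {ι : Y → E} (hι : Continuous ι) :
    (volume.restrict (timeCyl T S)).map (fun q : ℝ × Y => (q.1, ι q.2)) =
      timeProd T ((volume.restrict S).map ι) := by
  rw [timeProd, volume_restrict_timeCyl]
  have := Measure.map_prod_map (volume.restrict (Ioo 0 T)) (volume.restrict S)
    measurable_id hι.measurable
  rw [Measure.map_id] at this
  exact this.symm

theorem isFiniteMeasure_timeCyl (T : ℝ) {S : Set Y} (hS : Bornology.IsBounded S) :
    IsFiniteMeasure (volume.restrict (timeCyl T S)) := by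
  rw [volume_restrict_timeCyl]
  have : IsFiniteMeasure (volume.restrict S) := ⟨by
    rw [Measure.restrict_apply_univ]; exact hS.measure_lt_top⟩
  infer_instance

/-- Pulling back an `L^p`-convergent sequence of boundary values along a chart. -/
theorem L1Tendsto.pullback {T : ℝ} {S : Set Y} (hS : Bornology.IsBounded S) {ι : Y → E}
    (hι : Continuous ι) {ν : Measure E} [SFinite ν] (hν : (volume.restrict S).map ι ≤ ν)
    {p : ENNReal} (hp : 1 ≤ p) {F : ℕ → ℝ × E → ℝ} {F' : ℝ × E → ℝ} (hF : ∀ m, Continuous (F m))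
    (hF' : MemLp F' p (timeProd T ν))
    (h : Tendsto (fun m => eLpNorm (fun q => F m q - F' q) p (timeProd T ν)) atTop (𝓝 0)) :
    L1Tendsto (volume.restrict (timeCyl T S)) (fun m q => F m (q.1, ι q.2))
      (fun q => F' (q.1, ι q.2)) := by
  have := isFiniteMeasure_timeCyl T hS
  set j : ℝ × Y → ℝ × E := fun q => (q.1, ι q.2) with hj
  have hjc : Continuous j := continuous_fst.prodMk (hι.comp continuous_snd)
  have hle : (volume.restrict (timeCyl T S)).map j ≤ timeProd T ν := by
    rw [map_timeCyl T S hι]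
    exact Measure.prod_mono le_rfl hν
  have hmem : MemLp F' p ((volume.restrict (timeCyl T S)).map j) := hF'.mono_measure hle
  refine L1Tendsto.of_memLp hp
    (fun m => ((hF m).comp hjc).integrableOn_of_isBounded (isBounded_timeCyl T hS))
    (hmem.comp_of_map hjc.aemeasurable) ?_
  refine tendsto_of_tendsto_of_tendsto_of_le_of_le tendsto_const_nhds h (fun _ => zero_le)
    fun m => ?_
  have h1 := eLpNorm_map_measure (p := p)
    ((hF m).aestronglyMeasurable.sub hmem.1) hjc.aemeasurable
  calc _ = eLpNorm (fun q => F m q - F' q) p ((volume.restrict (timeCyl T S)).map j) := h1.symm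
    _ ≤ _ := eLpNorm_mono_measure _ hle

end Charts

section Approximation

variable {E : Type*} [NormedAddCommGroup E] [NormedSpace ℝ E] [FiniteDimensional ℝ E]
  [MeasureSpace E] [BorelSpace E] [(volume : Measure E).IsAddHaarMeasure]

theorem HasWeakDeriv.weakDerivOn {T : ℝ} {G : Set E} {v : ℝ × E} {f g : ℝ × E → ℝ}
    (h : HasWeakDeriv T G v f g) : WeakDerivOn volume (timeCyl T G) v f g :=
  ⟨h.locInt, h.locInt_deriv, h.byParts⟩

theorem continuous_fderiv_apply {X : Type*} [NormedAddCommGroup X] [NormedSpace ℝ X] {V : X → ℝ}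
    (hV : ContDiff ℝ ∞ V) (v : X) : ContDiff ℝ ∞ fun q => fderiv ℝ V q v :=
  (hV.fderiv_right (m := ∞) (by simp)).clm_apply contDiff_const

/-- The smooth approximations in the definition of the trace, with the derivatives of the
parabolic jet as limits. -/
theorem HasTrace.exists_approx {n : ℕ} {e : Fin n → E} {T : ℝ} {G G' : Set E} (hG : IsOpen G)
    (hGb : Bornology.IsBounded G) (hGG : G ⊆ G') {σ : Measure E} {p : ENNReal} (hp : 1 ≤ p)
    {f ft w : ℝ × E → ℝ} {Df Dw : Fin n → ℝ × E → ℝ} {D2f : Fin n → Fin n → ℝ × E → ℝ}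
    (hjet : HasParabolicJet e T G' G p f ft Df D2f) (htr : HasTrace e T G σ p f w Dw) :
    ∃ V : ℕ → ℝ × E → ℝ, (∀ m, ContDiff ℝ ∞ (V m)) ∧
      L1Tendsto (volume.restrict (timeCyl T G)) V f ∧
      (∀ j, L1Tendsto (volume.restrict (timeCyl T G))
        (fun m q => fderiv ℝ (V m) q (0, e j)) (Df j)) ∧
      (∀ j k, L1Tendsto (volume.restrict (timeCyl T G))
        (fun m q => fderiv ℝ (fun q' => fderiv ℝ (V m) q' (0, e j)) q (0, e k)) (D2f j k)) ∧
      Tendsto (fun m => eLpNorm (fun q => V m q - w q) p (timeProd T σ)) atTop (𝓝 0) ∧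
      (∀ j, Tendsto (fun m => eLpNorm (fun q => fderiv ℝ (V m) q (0, e j) - Dw j q) p
        (timeProd T σ)) atTop (𝓝 0)) := by
  have : ProperSpace E := FiniteDimensional.proper ℝ E
  obtain ⟨-, -, Df', D2f', hD, hD2, V, hV, h0, h1, h2, h3, h4⟩ := htr
  have hO : IsOpen (timeCyl T G) := timeCyl_isOpen T hG
  have hb := isBounded_timeCyl T hGb
  have hfin := isFiniteMeasure_timeCyl T hGb
  have hsub : timeCyl T G ⊆ timeCyl T G' := prod_mono_right hGG
  -- The definition of the trace carries its own weak derivatives; uniqueness identifies them with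
  -- those of the jet, first the gradient and then the Hessian.
  have u1 : ∀ j, Df' j =ᵐ[volume.restrict (timeCyl T G)] Df j := fun j =>
    (hD j).weakDerivOn.ae_unique hO ((hjet.weak_grad j).weakDerivOn.mono hsub) (ae_eq_refl _)
  have u2 : ∀ j k, D2f' j k =ᵐ[volume.restrict (timeCyl T G)] D2f j k := fun j k =>
    (hD2 j k).weakDerivOn.ae_unique hO ((hjet.weak_hess j k).weakDerivOn.mono hsub) (u1 j)
  refine ⟨V, hV, L1Tendsto.of_memLp hp
    (fun m => (hV m).continuous.integrableOn_of_isBounded hb) hjet.memLp h0,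
    fun j => L1Tendsto.of_memLp hp
      (fun m => (continuous_fderiv_apply (hV m) _).continuous.integrableOn_of_isBounded hb)
      (hjet.memLp_grad j) ((h1 j).congr fun m => eLpNorm_congr_ae ?_),
    fun j k => L1Tendsto.of_memLp hp
      (fun m => (continuous_fderiv_apply (continuous_fderiv_apply (hV m) _)
        _).continuous.integrableOn_of_isBounded hb)
      (hjet.memLp_hess j k) ((h2 j k).congr fun m => eLpNorm_congr_ae ?_), h3, h4⟩
  · filter_upwards [u1 j] with q hq using by rw [hq]
  · filter_upwards [u2 j k] with q hq using by rw [hq]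

end Approximation

section BulkTraces

namespace Pore

variable (P : Pore)

/-- `L¹`-convergence of boundary values on the three parts of `∂Ω`. -/
structure BdryTendsto (T : ℝ) (F : ℕ → ℝ × Space → ℝ) (F' : ℝ × Space → ℝ) : Prop where
  inl : L1Tendsto (volume.restrict (timeCyl T P.A)) (fun m q => F m (q.1, P.inlet q.2))
    (fun q => F' (q.1, P.inlet q.2))
  out : L1Tendsto (volume.restrict (timeCyl T P.A)) (fun m q => F m (q.1, P.outlet q.2))
    (fun q => F' (q.1, P.outlet q.2))
  lat : L1Tendsto (volume.restrict (timeCyl T P.cell)) (fun m q => F m (q.1, P.lateral q.2))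
    (fun q => F' (q.1, P.lateral q.2))

theorem continuous_inlet : Continuous P.inlet := continuous_id.prodMk continuous_const

theorem continuous_outlet : Continuous P.outlet := continuous_id.prodMk continuous_const

instance instSFiniteBoundaryMeasure : SFinite P.boundaryMeasure := by
  unfold boundaryMeasure surfaceMeasure; infer_instance

/-- The measure of each of the three parts is a summand of `boundaryMeasure`, so convergence for the
latter restricts to each part. -/
theorem BdryTendsto.of_eLpNorm {T : ℝ} {p : ENNReal} (hp : 1 ≤ p) {F : ℕ → ℝ × Space → ℝ}
    {F' : ℝ × Space → ℝ} (hF : ∀ m, Continuous (F m))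
    (hF' : MemLp F' p (timeProd T P.boundaryMeasure))
    (h : Tendsto (fun m => eLpNorm (fun q => F m q - F' q) p (timeProd T P.boundaryMeasure))
      atTop (𝓝 0)) : P.BdryTendsto T F F' where
  inl := L1Tendsto.pullback (ν := P.boundaryMeasure) P.isBounded P.continuous_inlet
    (Measure.le_add_right (Measure.le_add_right le_rfl)) hp hF hF' h
  out := L1Tendsto.pullback (ν := P.boundaryMeasure) P.isBounded P.continuous_outlet
    (Measure.le_add_right (Measure.le_add_left le_rfl)) hp hF hF' h
  lat := L1Tendsto.pullback (ν := P.boundaryMeasure) P.isBounded_cell P.continuous_lateral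
    (Measure.le_add_left le_rfl) hp hF hF' h

/-- Smooth functions `V m` approximating `f` together with its derivatives and its traces. -/
structure BulkApprox (T : ℝ) (f : ℝ × Space → ℝ) (Df : Fin 3 → ℝ × Space → ℝ)
    (D2f : Fin 3 → Fin 3 → ℝ × Space → ℝ) (w : ℝ × Space → ℝ) (Dw : Fin 3 → ℝ × Space → ℝ)
    (V : ℕ → ℝ × Space → ℝ) : Prop where
  smooth : ∀ m, ContDiff ℝ ∞ (V m)
  val : L1Tendsto (volume.restrict (timeCyl T P.bulk)) V f
  grad : ∀ j, L1Tendsto (volume.restrict (timeCyl T P.bulk))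
    (fun m q => fderiv ℝ (V m) q (0, axis j)) (Df j)
  hess : ∀ j k, L1Tendsto (volume.restrict (timeCyl T P.bulk))
    (fun m q => fderiv ℝ (fun q' => fderiv ℝ (V m) q' (0, axis j)) q (0, axis k)) (D2f j k)
  bdry : P.BdryTendsto T V w
  bdry_grad : ∀ j, P.BdryTendsto T (fun m q => fderiv ℝ (V m) q (0, axis j)) (Dw j)

theorem exists_bulkApprox {T : ℝ} {p : ENNReal} (hp : 1 ≤ p) {f ft w : ℝ × Space → ℝ}
    {Df Dw : Fin 3 → ℝ × Space → ℝ} {D2f : Fin 3 → Fin 3 → ℝ × Space → ℝ}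
    (hjet : HasParabolicJet axis T P.bulk P.bulk p f ft Df D2f)
    (htr : HasTrace axis T P.bulk P.boundaryMeasure p f w Dw) :
    ∃ V, P.BulkApprox T f Df D2f w Dw V := by
  obtain ⟨V, hV, h0, h1, h2, h3, h4⟩ :=
    htr.exists_approx P.isOpen_bulk P.isBounded_bulk subset_rfl hp hjet
  exact ⟨V, hV, h0, h1, h2,
    BdryTendsto.of_eLpNorm P hp (fun m => (hV m).continuous) htr.1 h3,
    fun j => BdryTendsto.of_eLpNorm P hp
      (fun m => (continuous_fderiv_apply (hV m) _).continuous) (htr.2.1 j) (h4 j)⟩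

end Pore

end BulkTraces

/-! ### Diffusion and divergence identities in the bulk -/

section BulkInequalities

theorem hasFDerivAt_time {E : Type*} [NormedAddCommGroup E] [NormedSpace ℝ E] {η : ℝ → ℝ}
    (hη : ContDiff ℝ ∞ η) (q : ℝ × E) : HasFDerivAt (fun q : ℝ × E => η q.1)
      (deriv η q.1 • ContinuousLinearMap.fst ℝ ℝ E) q :=
  ((hη.differentiable (by simp)) q.1).hasDerivAt.comp_hasFDerivAt q hasFDerivAt_fst

theorem contDiff_time {E : Type*} [NormedAddCommGroup E] [NormedSpace ℝ E] {η : ℝ → ℝ}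
    (hη : ContDiff ℝ ∞ η) : ContDiff ℝ ∞ (fun q : ℝ × E => η q.1) := hη.comp contDiff_fst

/-- A `C¹` function with continuous derivative `b'`. -/
theorem contDiff_one_of_hasDerivAt {b b' : ℝ → ℝ} (hb : ∀ s, HasDerivAt b (b' s) s)
    (hb' : Continuous b') : ContDiff ℝ 1 b :=
  contDiff_one_iff_deriv.2
    ⟨fun s => (hb s).differentiableAt, by rwa [funext fun s => (hb s).deriv]⟩

namespace Pore

variable (P : Pore) {T : ℝ}

theorem abs_normalIn_le (j : Fin 3) : |normalIn j| ≤ 1 := by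
  fin_cases j <;> simp [normalIn]

theorem abs_normalOut_le (j : Fin 3) : |normalOut j| ≤ 1 := by
  fin_cases j <;> simp [normalOut]

theorem abs_normalLat_le (x : ℝ × ℝ) (j : Fin 3) : |P.normalLat x j| ≤ 1 := by
  have h : ∀ i, |deriv P.γ x.1 i| ≤ 1 := fun i => by
    rw [← P.unitSpeed x.1]
    exact PiLp.norm_apply_le (deriv P.γ x.1) i
  fin_cases j
  · simpa [normalLat, turn] using h 1
  · simpa [normalLat, turn] using h 0
  · simp [normalLat]

theorem tendsto_boundaryFlux {ι : Type*} [Fintype ι] {F : ℕ → ι → ℝ × Space → ℝ}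
    {F' : ι → ℝ × Space → ℝ} {G : ℕ → Fin 3 → ℝ × Space → ℝ} {G' : Fin 3 → ℝ × Space → ℝ}
    {B : Fin 3 → (ι → ℝ) → ℝ} {η : ℝ → ℝ} {C D : ℝ} (hB : ∀ j, Continuous (B j))
    (hBC : ∀ j z, |B j z| ≤ C) (hη : Continuous η) (hηD : ∀ t, |η t| ≤ D)
    (hF : ∀ i, P.BdryTendsto T (fun m => F m i) (F' i))
    (hG : ∀ j, P.BdryTendsto T (fun m => G m j) (G' j)) :
    Tendsto (fun m => P.boundaryFlux T
        (fun j q => η q.1 * (B j (fun i => F m i q) * G m j q))) atTop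
      (𝓝 (P.boundaryFlux T (fun j q => η q.1 * (B j (fun i => F' i q) * G' j q)))) := by
  have hD : ∀ {ν : ℝ} (t : ℝ), |ν| ≤ 1 → |ν * η t| ≤ D := fun {ν} t hν => by
    rw [abs_mul]
    exact (mul_le_of_le_one_left (abs_nonneg _) hν).trans (hηD t)
  simp only [boundaryFlux, ← mul_assoc (normalIn _), ← mul_assoc (normalOut _),
    ← mul_assoc (P.normalLat _ _)]
  refine ((tendsto_integral_sum_comp_mul (C := fun _ => C) (D := fun _ => D) hB hBC
    (fun j => ?_) (fun j q => hD _ (abs_normalIn_le j)) (fun i => (hF i).inl)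
    (fun j => (hG j).inl)).add
    (tendsto_integral_sum_comp_mul (C := fun _ => C) (D := fun _ => D) hB hBC
    (fun j => ?_) (fun j q => hD _ (abs_normalOut_le j)) (fun i => (hF i).out)
    (fun j => (hG j).out))).add
    (tendsto_integral_sum_comp_mul (C := fun _ => C) (D := fun _ => D) hB hBC
    (fun j => ?_) (fun j q => hD _ (P.abs_normalLat_le _ j)) (fun i => (hF i).lat)
    (fun j => (hG j).lat))
  · exact (continuous_const.mul (hη.comp continuous_fst)).aestronglyMeasurable
  · exact (continuous_const.mul (hη.comp continuous_fst)).aestronglyMeasurable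
  · exact (((P.continuous_normalLat j).comp continuous_snd).mul
      (hη.comp continuous_fst)).aestronglyMeasurable

theorem BdryTendsto.const_one : P.BdryTendsto T (fun _ _ => 1) fun _ => 1 := by
  have := isFiniteMeasure_timeCyl T P.isBounded
  have := isFiniteMeasure_timeCyl T P.isBounded_cell
  exact ⟨L1Tendsto.const (integrable_const 1), L1Tendsto.const (integrable_const 1),
    L1Tendsto.const (integrable_const 1)⟩

variable {P}

/-- Kato's inequality in the bulk, with boundary terms. -/
theorem BulkApprox.kato {f w : ℝ × Space → ℝ} {Df Dw : Fin 3 → ℝ × Space → ℝ}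
    {D2f : Fin 3 → Fin 3 → ℝ × Space → ℝ} {V : ℕ → ℝ × Space → ℝ}
    (h : P.BulkApprox T f Df D2f w Dw V) {b b' : ℝ → ℝ} {C D : ℝ}
    (hb : ∀ s, HasDerivAt b (b' s) s) (hb'c : Continuous b') (hb' : ∀ s, 0 ≤ b' s)
    (hbC : ∀ s, |b s| ≤ C) {η : ℝ → ℝ} (hη : ContDiff ℝ ∞ η) (hη0 : ∀ t, 0 ≤ η t)
    (hηD : ∀ t, |η t| ≤ D) :
    ∫ q in timeCyl T P.bulk, ∑ j, η q.1 * (b (f q) * D2f j j q) ≤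
      P.boundaryFlux T fun j q => η q.1 * (b (w q) * Dw j q) := by
  have hbc := contDiff_one_of_hasDerivAt hb hb'c
  have L1 := tendsto_integral_sum_comp_mul (μ := volume.restrict (timeCyl T P.bulk))
    (ι := Fin 1) (κ := Fin 3) (F := fun m _ => V m) (F' := fun _ => f)
    (G := fun m j q => fderiv ℝ (fun q' => fderiv ℝ (V m) q' (0, axis j)) q (0, axis j))
    (G' := fun j => D2f j j) (B := fun _ z => b (z 0)) (k := fun _ q => η q.1)
    (C := fun _ => C) (D := fun _ => D) (fun _ => hbc.continuous.comp (continuous_apply 0))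
    (fun _ z => hbC _) (fun _ => (hη.continuous.comp continuous_fst).aestronglyMeasurable)
    (fun _ q => hηD _) (fun _ => h.val) (fun j => h.hess j j)
  have L2 := P.tendsto_boundaryFlux (T := T) (ι := Fin 1) (F := fun m _ => V m)
    (F' := fun _ => w) (G := fun m j q => fderiv ℝ (V m) q (0, axis j)) (G' := Dw)
    (B := fun _ z => b (z 0)) (C := C) (D := D)
    (fun _ => hbc.continuous.comp (continuous_apply 0))
    (fun _ z => hbC _) hη.continuous hηD (fun _ => h.bdry) h.bdry_grad
  refine le_of_tendsto_of_tendsto' L1 L2 fun m => ?_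
  have hV := h.smooth m
  have hVj := fun j => continuous_fderiv_apply hV (0, axis j)
  have cη : Continuous fun q : ℝ × Space => η q.1 := hη.continuous.comp continuous_fst
  -- The divergence theorem for the field η b(V) ∇V. Its divergence exceeds η b(V) ΔV by η
  -- b'(V)|∇V|² ≥ 0, which is discarded for each m, since the limit of this quadratic term is not
  -- under control.
  rw [← P.integral_divergence T (Ψ := fun j q => η q.1 * (b (V m q) * fderiv ℝ (V m) q (0, axis j)))
    fun j => ((contDiff_time hη).of_le (by simp)).mul
      ((hbc.comp (hV.of_le (by simp))).mul ((hVj j).of_le (by simp)))]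
  have hd : ∀ j q, fderiv ℝ (fun q => η q.1 * (b (V m q) * fderiv ℝ (V m) q (0, axis j))) q
      (0, axis j) = η q.1 * (b (V m q) *
        fderiv ℝ (fun q' => fderiv ℝ (V m) q' (0, axis j)) q (0, axis j)) +
        η q.1 * (b' (V m q) * (fderiv ℝ (V m) q (0, axis j)) ^ 2) := fun j q => by
    have h1 := (hb (V m q)).comp_hasFDerivAt q ((hV.differentiable (by simp)) q).hasFDerivAt
    have h2 := (hasFDerivAt_time hη q).mul
      (h1.mul (((hVj j).differentiable (by simp)) q).hasFDerivAt)
    have h3 : fderiv ℝ (fun q => η q.1 * (b (V m q) * fderiv ℝ (V m) q (0, axis j))) q = _ :=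
      h2.fderiv
    rw [h3]
    simp only [add_apply, smul_apply, smul_eq_mul, ContinuousLinearMap.coe_fst', mul_zero,
      add_zero, Function.comp_apply]
    ring
  have cVV := fun j => (continuous_fderiv_apply (hVj j) (0, axis j)).continuous
  have cVj := fun j => (hVj j).continuous
  have cb := hbc.continuous.comp hV.continuous
  have cb' := hb'c.comp hV.continuous
  have hbd := isBounded_timeCyl T P.isBounded_bulk
  simp only [hd]
  refine integral_mono ?_ ?_ fun q => Finset.sum_le_sum fun j _ => ?_
  · exact Continuous.integrableOn_of_isBounded (continuous_finsetSum _ fun j _ =>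
      cη.mul (cb.mul (cVV j))) hbd
  · exact Continuous.integrableOn_of_isBounded (continuous_finsetSum _ fun j _ =>
      (cη.mul (cb.mul (cVV j))).add (cη.mul (cb'.mul ((cVj j).pow 2)))) hbd
  · have := mul_nonneg (hη0 q.1) (mul_nonneg (hb' (V m q))
      (sq_nonneg (fderiv ℝ (V m) q (0, axis j))))
    simpa using this

/-- The divergence theorem for `η H(u) S(c)` with `H` and `S` bounded with bounded derivatives. -/
theorem BulkApprox.divergence_comp {u w : Fin 3 → ℝ × Space → ℝ}
    {Du Dw : Fin 3 → Fin 3 → ℝ × Space → ℝ} {D2u : Fin 3 → Fin 3 → Fin 3 → ℝ × Space → ℝ}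
    {U : Fin 3 → ℕ → ℝ × Space → ℝ}
    (hu : ∀ l, P.BulkApprox T (u l) (Du l) (D2u l) (w l) (Dw l) (U l))
    {c cB : ℝ × Space → ℝ} {Dc DcB : Fin 3 → ℝ × Space → ℝ}
    {D2c : Fin 3 → Fin 3 → ℝ × Space → ℝ} {V : ℕ → ℝ × Space → ℝ}
    (hc : P.BulkApprox T c Dc D2c cB DcB V) {S S' : ℝ → ℝ} {H : Fin 3 → (Fin 3 → ℝ) → ℝ}
    {C C' K K' D : ℝ} (hS : ∀ s, HasDerivAt S (S' s) s) (hS'c : Continuous S')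
    (hSC : ∀ s, |S s| ≤ C) (hS'C : ∀ s, |S' s| ≤ C') (hH : ∀ j, ContDiff ℝ 1 (H j))
    (hHK : ∀ j z, |H j z| ≤ K) (hHK' : ∀ j l z, |fderiv ℝ (H j) z (Pi.single l 1)| ≤ K')
    {η : ℝ → ℝ} (hη : ContDiff ℝ ∞ η) (hηD : ∀ t, |η t| ≤ D) :
    (∫ q in timeCyl T P.bulk, ∑ i : Fin 3 × Fin 3, η q.1 *
      (fderiv ℝ (H i.1) (fun l => u l q) (Pi.single i.2 1) * S (c q) * Du i.2 i.1 q)) +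
      ∫ q in timeCyl T P.bulk, ∑ j, η q.1 * (H j (fun l => u l q) * S' (c q) * Dc j q) =
    P.boundaryFlux T fun j q => η q.1 * (H j (fun l => w l q) * S (cB q) * 1) := by
  have hSc := contDiff_one_of_hasDerivAt hS hS'c
  have cη : Continuous fun q : ℝ × Space => η q.1 := hη.continuous.comp continuous_fst
  have cH' : ∀ j l, Continuous fun z => fderiv ℝ (H j) z (Pi.single l 1) := fun j l =>
    ((hH j).continuous_fderiv one_ne_zero).clm_apply continuous_const
  -- The nonlinearities involve four functions: index `none` stands for the concentration, `some l`
  -- for the l-th velocity component.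
  have hF : ∀ i : Option (Fin 3), L1Tendsto (volume.restrict (timeCyl T P.bulk))
      (fun m => i.elim (V m) fun l => U l m) (i.elim c u) := fun i => by
    cases i with
    | none => exact hc.val
    | some l => exact (hu l).val
  have hFB : ∀ i : Option (Fin 3), P.BdryTendsto T
      (fun m => i.elim (V m) fun l => U l m) (i.elim cB w) := fun i => by
    cases i with
    | none => exact hc.bdry
    | some l => exact (hu l).bdry
  have hab : ∀ {x y X Y : ℝ}, |x| ≤ X → |y| ≤ Y → |x * y| ≤ X * Y := fun {x y X Y} hx hy => by
    rw [abs_mul]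
    exact mul_le_mul hx hy (abs_nonneg _) ((abs_nonneg _).trans hx)
  have cev : Continuous fun z : Option (Fin 3) → ℝ => fun l => z (some l) :=
    continuous_pi fun l => continuous_apply _
  have L1 := tendsto_integral_sum_comp_mul (μ := volume.restrict (timeCyl T P.bulk))
    (ι := Option (Fin 3)) (κ := Fin 3 × Fin 3) (F := fun m i => i.elim (V m) fun l => U l m)
    (F' := fun i => i.elim c u)
    (G := fun m i q => fderiv ℝ (U i.2 m) q (0, axis i.1))
    (G' := fun i => Du i.2 i.1)
    (B := fun i z => fderiv ℝ (H i.1) (fun l => z (some l)) (Pi.single i.2 1) * S (z none))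
    (k := fun _ q => η q.1) (C := fun _ => K' * C) (D := fun _ => D)
    (fun i => ((cH' i.1 i.2).comp cev).mul (hSc.continuous.comp (continuous_apply _)))
    (fun i z => hab (hHK' _ _ _) (hSC _)) (fun _ => cη.aestronglyMeasurable)
    (fun _ q => hηD _) hF (fun i => (hu i.2).grad i.1)
  have L2 := tendsto_integral_sum_comp_mul (μ := volume.restrict (timeCyl T P.bulk))
    (ι := Option (Fin 3)) (κ := Fin 3) (F := fun m i => i.elim (V m) fun l => U l m)
    (F' := fun i => i.elim c u)
    (G := fun m j q => fderiv ℝ (V m) q (0, axis j)) (G' := Dc)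
    (B := fun j z => H j (fun l => z (some l)) * S' (z none))
    (k := fun _ q => η q.1) (C := fun _ => K * C') (D := fun _ => D)
    (fun j => ((hH j).continuous.comp cev).mul (hS'c.comp (continuous_apply _)))
    (fun i z => hab (hHK _ _) (hS'C _)) (fun _ => cη.aestronglyMeasurable)
    (fun _ q => hηD _) hF hc.grad
  -- The boundary term is entirely bounded, so the linear factor is the constant 1.
  have L3 := P.tendsto_boundaryFlux (T := T) (ι := Option (Fin 3))
    (F := fun m i => i.elim (V m) fun l => U l m) (F' := fun i => i.elim cB w)
    (G := fun _ _ _ => 1) (G' := fun _ _ => 1)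
    (B := fun j z => H j (fun l => z (some l)) * S (z none)) (C := K * C) (D := D)
    (fun j => ((hH j).continuous.comp cev).mul (hSc.continuous.comp (continuous_apply _)))
    (fun i z => hab (hHK _ _) (hSC _)) hη.continuous hηD hFB
    (fun _ => BdryTendsto.const_one P)
  refine tendsto_nhds_unique (L1.add L2) (L3.congr fun m => ?_)
  have hV := hc.smooth m
  have hU := fun l => (hu l).smooth m
  have hUc : ContDiff ℝ ∞ fun q => fun l => U l m q := contDiff_pi.2 hU
  have cU := hUc.continuous
  have cdU : ∀ j l, Continuous fun q => fderiv ℝ (U l m) q (0, axis j) := fun j l =>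
    (continuous_fderiv_apply (hU l) _).continuous
  have cdV : ∀ j, Continuous fun q => fderiv ℝ (V m) q (0, axis j) := fun j =>
    (continuous_fderiv_apply hV _).continuous
  have hbd := isBounded_timeCyl T P.isBounded_bulk
  simp only [Option.elim_some, Option.elim_none, mul_one]
  rw [← P.integral_divergence T
    (Ψ := fun j q => η q.1 * (H j (fun l => U l m q) * S (V m q)))
    fun j => ((contDiff_time hη).of_le (by simp)).mul
      (((hH j).comp (hUc.of_le (by simp))).mul (hSc.comp (hV.of_le (by simp)))),
    ← integral_add]
  · congr 1; ext q
    rw [Fintype.sum_prod_type, ← Finset.sum_add_distrib]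
    refine Finset.sum_congr rfl fun j _ => ?_
    have h0 : HasFDerivAt (fun q => fun l => U l m q)
        (ContinuousLinearMap.pi fun l => fderiv ℝ (U l m) q) q :=
      hasFDerivAt_pi.2 fun l => (((hU l).differentiable (by simp)) q).hasFDerivAt
    have h1 := (((hH j).differentiable (by simp)) (fun l => U l m q)).hasFDerivAt.comp q h0
    have h2 := (hS (V m q)).comp_hasFDerivAt q ((hV.differentiable (by simp)) q).hasFDerivAt
    have h3 := (hasFDerivAt_time hη q).mul (h1.mul h2)
    have h4 : fderiv ℝ (fun q => η q.1 * (H j (fun l => U l m q) * S (V m q))) q = _ := h3.fderiv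
    have h5 : (fderiv ℝ (H j) fun l => U l m q)
        (fun l => fderiv ℝ (U l m) q (0, axis j)) = ∑ l,
        fderiv ℝ (H j) (fun l => U l m q) (Pi.single l 1) * fderiv ℝ (U l m) q (0, axis j) := by
      conv_lhs => rw [pi_eq_sum_univ' (fun l => fderiv ℝ (U l m) q (0, axis j))]
      rw [map_sum]
      refine Finset.sum_congr rfl fun l _ => ?_
      rw [map_smul, smul_eq_mul, mul_comm]
    have h6 : (ContinuousLinearMap.pi fun l => fderiv ℝ (U l m) q) (0, axis j) =
      fun l => fderiv ℝ (U l m) q (0, axis j) := rfl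
    rw [h4]
    simp only [add_apply, smul_apply,
      ContinuousLinearMap.comp_apply, h6, h5, smul_eq_mul, ContinuousLinearMap.coe_fst',
      mul_zero, add_zero, Function.comp_apply]
    rw [mul_add, Finset.mul_sum, Finset.mul_sum, add_comm]
    congr 1
    · refine Finset.sum_congr rfl fun l _ => ?_
      ring
    · ring
  · refine Continuous.integrableOn_of_isBounded (continuous_finsetSum _ fun i _ => ?_) hbd
    exact cη.mul ((((cH' i.1 i.2).comp cU).mul (hSc.continuous.comp hV.continuous)).mul
      (cdU i.1 i.2))
  · refine Continuous.integrableOn_of_isBounded (continuous_finsetSum _ fun j _ => ?_) hbd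
    exact cη.mul ((((hH j).continuous.comp cU).mul (hS'c.comp hV.continuous)).mul (cdV j))

end Pore

end BulkInequalities

/-! ### Truncation and the convective term -/

section Weights

variable {Y : Type*} [MeasurableSpace Y] {μ : Measure Y}

/-- Dominated convergence for sums with uniformly bounded weights. -/
theorem tendsto_integral_sum_weight {κ : Type*} [Fintype κ] {a : ℕ → κ → Y → ℝ}
    {a' : κ → Y → ℝ} {g : κ → Y → ℝ} {M : ℝ}
    (ha : ∀ n j, AEStronglyMeasurable (a n j) μ) (haM : ∀ n j y, |a n j y| ≤ M)
    (hlim : ∀ j y, Tendsto (fun n => a n j y) atTop (𝓝 (a' j y)))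
    (hg : ∀ j, Integrable (g j) μ) :
    Tendsto (fun n => ∫ y, ∑ j, a n j y * g j y ∂μ) atTop
      (𝓝 (∫ y, ∑ j, a' j y * g j y ∂μ)) := by
  refine tendsto_integral_of_dominated_convergence (fun y => ∑ j, M * |g j y|) (fun n => ?_) ?_
    (fun n => ae_of_all _ fun y => ?_) (ae_of_all _ fun y => ?_)
  · exact Finset.aestronglyMeasurable_fun_sum _ fun j _ => (ha n j).mul (hg j).1
  · exact integrable_finsetSum _ fun j _ => (hg j).abs.const_mul M
  · refine (norm_sum_le _ _).trans (Finset.sum_le_sum fun j _ => ?_)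
    rw [Real.norm_eq_abs, abs_mul]
    exact mul_le_mul_of_nonneg_right (haM n j y) (abs_nonneg _)
  · exact tendsto_finsetSum _ fun j _ => (hlim j y).mul_const _

end Weights

section Truncation

/-- Truncated primitives of a nonpositive increasing function vanishing on `[0,∞)`. -/
theorem exists_truncated_primitive {b : ℝ → ℝ} (hb : Continuous b) (hbm : Monotone b)
    (hb1 : ∀ s, |b s| ≤ 1) (hb0 : ∀ s, 0 ≤ s → b s = 0) (k : ℕ) :
    ∃ S ζ : ℝ → ℝ, (∀ s, HasDerivAt S (ζ s * b s) s) ∧ Continuous ζ ∧ (∀ s, |ζ s| ≤ 1) ∧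
      (∀ s, -(k : ℝ) ≤ s → ζ s = 1) ∧ (∀ s, |S s| ≤ (k : ℝ) + 1) ∧ (∀ s, 0 ≤ S s) ∧
      ∀ s, S s ≤ s * b s := by
  -- ζ is 0 on (-∞, -k - 1] and 1 on [-k, ∞). The primitive S of ζ b is therefore constant below -k
  -- - 1, and |b| ≤ 1 bounds it by k + 1.
  set ζ : ℝ → ℝ := fun s => Real.smoothTransition (s + k + 1) with hζ
  have cζ : Continuous ζ := Real.smoothTransition.continuous.comp (by fun_prop)
  have cζb : Continuous fun s => ζ s * b s := cζ.mul hb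
  have hii : ∀ x y, IntervalIntegrable (fun s => ζ s * b s) volume x y := fun x y =>
    cζb.intervalIntegrable x y
  have ζ0 : ∀ s, 0 ≤ ζ s := fun s => Real.smoothTransition.nonneg _
  have ζ1 : ∀ s, ζ s ≤ 1 := fun s => Real.smoothTransition.le_one _
  have hbn : ∀ s, b s ≤ 0 := fun s => (hbm (le_max_left s 0)).trans_eq (hb0 _ (le_max_right _ _))
  have hbl : ∀ s, -1 ≤ b s := fun s => (abs_le.1 (hb1 s)).1
  set S : ℝ → ℝ := fun s => ∫ r in 0..s, ζ r * b r with hS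
  have Spos : ∀ s, 0 ≤ s → S s = 0 := fun s hs => by
    simp only [hS]
    rw [intervalIntegral.integral_congr (g := fun _ => 0)]
    · simp
    · intro r hr
      rw [uIcc_of_le hs] at hr
      simp [hb0 r hr.1]
  have Sneg : ∀ s, S s = ∫ r in s..0, -(ζ r * b r) := fun s => by
    rw [intervalIntegral.integral_neg, ← intervalIntegral.integral_symm]
  -- On [s, 0] the integrand -ζ b is at most -b(s), because b is nondecreasing and nonpositive. This
  -- bound is what the inflow condition needs.
  have Sle : ∀ s, s ≤ 0 → S s ≤ s * b s := fun s hs => by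
    rw [Sneg]
    have : ∫ r in s..0, -(ζ r * b r) ≤ ∫ _r in s..0, -b s := by
      refine intervalIntegral.integral_mono_on hs (hii _ _).neg
        (continuous_const.intervalIntegrable _ _) fun r hr => ?_
      have h1 := hbm hr.1
      nlinarith [ζ0 r, ζ1 r, hbn r]
    refine this.trans_eq ?_
    rw [intervalIntegral.integral_const, smul_eq_mul]; ring
  have S0 : ∀ s, 0 ≤ S s := fun s => by
    rcases le_total s 0 with hs | hs
    · rw [Sneg]
      exact intervalIntegral.integral_nonneg hs fun r _ => by nlinarith [ζ0 r, hbn r]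
    · exact (Spos s hs).ge
  have Sbd : ∀ s, S s ≤ (k : ℝ) + 1 := fun s => by
    have hk : (0 : ℝ) ≤ k := Nat.cast_nonneg k
    rcases le_total 0 s with hs | hs
    · rw [Spos s hs]; positivity
    · rcases le_total (-((k : ℝ) + 1)) s with h | h
      · have := Sle s hs
        nlinarith [hbl s, hbn s]
      · have h1 : S s = S (-((k : ℝ) + 1)) := by
          simp only [hS]
          rw [← intervalIntegral.integral_add_adjacent_intervals (hii 0 (-((k : ℝ) + 1)))
            (hii _ s), intervalIntegral.integral_congr (a := -((k : ℝ) + 1)) (g := fun _ => 0)]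
          · simp
          · intro r hr
            rw [uIcc_of_ge h] at hr
            have : ζ r = 0 := Real.smoothTransition.zero_of_nonpos (by linarith [hr.2])
            simp [this]
        rw [h1]
        have h2 := Sle (-((k : ℝ) + 1)) (by linarith)
        nlinarith [hbl (-((k : ℝ) + 1))]
  refine ⟨S, ζ, fun s => ?_, cζ, fun s => by rw [abs_of_nonneg (ζ0 s)]; exact ζ1 s,
    fun s hs => Real.smoothTransition.one_of_one_le (by linarith),
    fun s => by rw [abs_of_nonneg (S0 s)]; exact Sbd s, S0, fun s => ?_⟩
  · exact intervalIntegral.integral_hasDerivAt_right (hii 0 s)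
      cζb.aestronglyMeasurable.stronglyMeasurableAtFilter cζb.continuousAt
  · rcases le_total s 0 with hs | hs
    · exact Sle s hs
    · rw [Spos s hs, hb0 s hs, mul_zero]

end Truncation

section Convection

namespace Pore

variable {P : Pore} {T : ℝ}

theorem aestronglyMeasurable_comp_fst {Y : Type*} [TopologicalSpace Y] [MeasurableSpace Y]
    [OpensMeasurableSpace Y] [SecondCountableTopology Y]
    {η : ℝ → ℝ} (hη : Continuous η) {μ : Measure (ℝ × Y)} :
    AEStronglyMeasurable (fun q : ℝ × Y => η q.1) μ :=
  (hη.comp continuous_fst).aestronglyMeasurable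

/-- The convective term in divergence form: `∫ η S'(c) u·∇c = ∫_{∂Ω} η (u·ν) S(c)` for bounded
`S`, if `div u = 0` and `u·∇c` is integrable. -/
theorem BulkApprox.convection {u w : Fin 3 → ℝ × Space → ℝ}
    {Du Dw : Fin 3 → Fin 3 → ℝ × Space → ℝ} {D2u : Fin 3 → Fin 3 → Fin 3 → ℝ × Space → ℝ}
    {U : Fin 3 → ℕ → ℝ × Space → ℝ}
    (hu : ∀ l, P.BulkApprox T (u l) (Du l) (D2u l) (w l) (Dw l) (U l))
    {c cB : ℝ × Space → ℝ} {Dc DcB : Fin 3 → ℝ × Space → ℝ}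
    {D2c : Fin 3 → Fin 3 → ℝ × Space → ℝ} {V : ℕ → ℝ × Space → ℝ}
    (hc : P.BulkApprox T c Dc D2c cB DcB V)
    (hdiv : ∀ᵐ q ∂volume.restrict (timeCyl T P.bulk), ∑ j, Du j j q = 0)
    (hintg : Integrable (fun q => ∑ j, u j q * Dc j q) (volume.restrict (timeCyl T P.bulk)))
    {S S' : ℝ → ℝ} {C C' D : ℝ} (hS : ∀ s, HasDerivAt S (S' s) s) (hS'c : Continuous S')
    (hSC : ∀ s, |S s| ≤ C) (hS'C : ∀ s, |S' s| ≤ C')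
    {η : ℝ → ℝ} (hη : ContDiff ℝ ∞ η) (hηD : ∀ t, |η t| ≤ D) :
    ∫ q in timeCyl T P.bulk, η q.1 * S' (c q) * ∑ j, u j q * Dc j q =
      P.boundaryFlux T fun j q => η q.1 * S (cB q) * w j q := by
  have hSc := contDiff_one_of_hasDerivAt hS hS'c
  obtain ⟨χ, hχ, hχc, -, hχ0, hχ1, W, hW, h0W, hone⟩ := exists_cutoff (X := Fin 3 → ℝ)
    (isCompact_singleton (x := 0)) isOpen_univ (subset_univ _)
  have h0W : (0 : Fin 3 → ℝ) ∈ W := h0W rfl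
  -- The velocity is truncated by one scalar factor common to all components: only the sum u·∇c is
  -- known to be integrable, not the single products, so the truncation must act on the sum as a
  -- whole.
  set κ : Fin 3 → (Fin 3 → ℝ) → ℝ := fun j z => χ z * z j with hκ
  have hκc : ∀ j, ContDiff ℝ 1 (κ j) := fun j =>
    (hχ.of_le (by simp)).mul (contDiff_apply ℝ ℝ j)
  have hκs : ∀ j, HasCompactSupport (κ j) := fun j => hχc.mul_right
  have hκ' : ∀ j l, Continuous fun z => fderiv ℝ (κ j) z (Pi.single l 1) := fun j l =>
    ((hκc j).continuous_fderiv one_ne_zero).clm_apply continuous_const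
  choose K₀ hK₀ using fun j => (hκc j).continuous.bounded_above_of_compact_support (hκs j)
  choose K₁ hK₁ using fun j l => (hκ' j l).bounded_above_of_compact_support
    (((hκs j).fderiv ℝ).comp_left (g := fun A : (Fin 3 → ℝ) →L[ℝ] ℝ => A (Pi.single l 1))
      (by simp))
  set K := ∑ j, |K₀ j|
  have hK : ∀ j z, |κ j z| ≤ K := fun j z => (hK₀ j z).trans ((le_abs_self _).trans
    (Finset.single_le_sum (f := fun j => |K₀ j|) (fun _ _ => abs_nonneg _) (Finset.mem_univ j)))
  set K' := ∑ i : Fin 3 × Fin 3, |K₁ i.1 i.2|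
  have hK' : ∀ j l z, |fderiv ℝ (κ j) z (Pi.single l 1)| ≤ K' := fun j l z =>
    (hK₁ j l z).trans ((le_abs_self _).trans
    (Finset.single_le_sum (f := fun i : Fin 3 × Fin 3 => |K₁ i.1 i.2|)
      (fun _ _ => abs_nonneg _) (Finset.mem_univ (j, l))))
  have hκ0 : ∀ j l, fderiv ℝ (κ j) 0 (Pi.single l 1) = if l = j then 1 else 0 := fun j l => by
    have : κ j =ᶠ[𝓝 0] fun z => z j := by
      filter_upwards [hW.mem_nhds h0W] with z hz
      simp [hκ, hone z hz]
    rw [this.fderiv_eq, (hasFDerivAt_apply j (0 : Fin 3 → ℝ)).fderiv]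
    simp [Pi.single_apply, eq_comm]
  -- rescaling
  set N : ℕ → ℝ := fun n => ((n : ℝ) + 1)⁻¹ with hN
  have hNpos : ∀ n, 0 < N n := fun n => by simp only [hN]; positivity
  have hN0 : Tendsto N atTop (𝓝 0) := by
    simpa [hN, one_div] using tendsto_one_div_add_atTop_nhds_zero_nat (𝕜 := ℝ)
  have hNz : ∀ z : Fin 3 → ℝ, Tendsto (fun n => N n • z) atTop (𝓝 0) := fun z => by
    simpa using hN0.smul_const z
  have hχlim : ∀ z : Fin 3 → ℝ, Tendsto (fun n => χ (N n • z)) atTop (𝓝 1) := fun z => by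
    have := (hχ.continuous.tendsto 0).comp (hNz z)
    rwa [hone 0 h0W] at this
  -- Rescaling leaves the first derivatives bounded uniformly in n and makes them converge to the
  -- identity matrix. Hence the derivatives of the truncated field produce S(c) div u = 0 in the
  -- limit, although the bound on H itself grows with n.
  set H : ℕ → Fin 3 → (Fin 3 → ℝ) → ℝ := fun n j z => (N n)⁻¹ * κ j (N n • z) with hH
  have hHχ : ∀ n j z, H n j z = χ (N n • z) * z j := fun n j z => by
    have := (hNpos n).ne'
    simp only [hH, hκ, Pi.smul_apply, smul_eq_mul]
    field_simp
  have hHc : ∀ n j, ContDiff ℝ 1 (H n j) := fun n j =>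
    contDiff_const.mul ((hκc j).comp (contDiff_const_smul _))
  have hHd : ∀ n j z v, fderiv ℝ (H n j) z v = fderiv ℝ (κ j) (N n • z) v := fun n j z v => by
    have h1 : HasFDerivAt (fun z : Fin 3 → ℝ => N n • z)
      (N n • ContinuousLinearMap.id ℝ (Fin 3 → ℝ)) z := (hasFDerivAt_id z).const_smul (N n)
    have h2 := ((((hκc j).differentiable one_ne_zero) (N n • z)).hasFDerivAt.comp z h1).const_mul
      (N n)⁻¹
    have h3 : fderiv ℝ (H n j) z = _ := h2.fderiv
    rw [h3]
    simp only [smul_apply, ContinuousLinearMap.comp_apply, ContinuousLinearMap.id_apply,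
      map_smul, smul_eq_mul]
    rw [← mul_assoc, inv_mul_cancel₀ (hNpos n).ne', one_mul]
  have key := fun n => BulkApprox.divergence_comp hu hc hS hS'c hSC hS'C (hHc n)
    (K := (N n)⁻¹ * K) (K' := K')
    (fun j z => by
      simp only [hH, abs_mul, abs_of_pos (inv_pos.2 (hNpos n))]
      exact mul_le_mul_of_nonneg_left (hK _ _) (inv_pos.2 (hNpos n)).le)
    (fun j l z => by rw [hHd]; exact hK' _ _ _) hη hηD
  have hab : ∀ {x y X Y : ℝ}, |x| ≤ X → |y| ≤ Y → |x * y| ≤ X * Y := fun {x y X Y} hx hy => by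
    rw [abs_mul]
    exact mul_le_mul hx hy (abs_nonneg _) ((abs_nonneg _).trans hx)
  have hχab : ∀ z, |χ z| ≤ 1 := fun z => by rw [abs_of_nonneg (hχ0 z)]; exact hχ1 z
  have mu : AEMeasurable (fun q => fun l => u l q) (volume.restrict (timeCyl T P.bulk)) :=
    aemeasurable_pi_lambda _ fun l => (hu l).val.int.1.aemeasurable
  have mη : AEStronglyMeasurable (fun q : ℝ × Space => η q.1)
    (volume.restrict (timeCyl T P.bulk)) := aestronglyMeasurable_comp_fst hη.continuous
  -- first term
  have T1 := tendsto_integral_sum_weight (μ := volume.restrict (timeCyl T P.bulk))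
    (κ := Fin 3 × Fin 3) (a := fun n i q => η q.1 *
      (fderiv ℝ (κ i.1) (N n • fun l => u l q) (Pi.single i.2 1) * S (c q)))
    (a' := fun i q => η q.1 * ((if i.2 = i.1 then 1 else 0) * S (c q)))
    (g := fun i => Du i.2 i.1) (M := D * (K' * C))
    (fun n i => mη.mul (((hκ' i.1 i.2).comp_aestronglyMeasurable
      (mu.const_smul (N n)).aestronglyMeasurable).mul
      (hSc.continuous.comp_aestronglyMeasurable hc.val.int.1)))
    (fun n i q => hab (hηD _) (hab (hK' _ _ _) (hSC _)))
    (fun i q => by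
      have := ((hκ' i.1 i.2).tendsto 0).comp (hNz fun l => u l q)
      rw [hκ0] at this
      exact (this.mul_const _).const_mul _)
    (fun i => (hu i.2).grad i.1 |>.int)
  have T1z : ∫ q in timeCyl T P.bulk, ∑ i : Fin 3 × Fin 3,
      η q.1 * ((if i.2 = i.1 then 1 else 0) * S (c q)) * Du i.2 i.1 q = 0 := by
    refine integral_eq_zero_of_ae ?_
    filter_upwards [hdiv] with q hq
    rw [Fintype.sum_prod_type]
    have : ∀ j, ∑ l, η q.1 * ((if l = j then 1 else 0) * S (c q)) * Du l j q =
        η q.1 * S (c q) * Du j j q := fun j => by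
      rw [Finset.sum_eq_single j]
      · simp
      · intro l _ hl; simp [hl]
      · simp
    simp only [this, ← Finset.mul_sum, hq, mul_zero, Pi.zero_apply]
  -- second term
  have T2 := tendsto_integral_sum_weight (μ := volume.restrict (timeCyl T P.bulk))
    (κ := Fin 1) (a := fun n _ q => η q.1 * (χ (N n • fun l => u l q) * S' (c q)))
    (a' := fun _ q => η q.1 * (1 * S' (c q))) (g := fun _ q => ∑ j, u j q * Dc j q)
    (M := D * (1 * C'))
    (fun n _ => mη.mul ((hχ.continuous.comp_aestronglyMeasurable
      (mu.const_smul (N n)).aestronglyMeasurable).mul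
      (hS'c.comp_aestronglyMeasurable hc.val.int.1)))
    (fun n i q => hab (hηD _) (hab (hχab _) (hS'C _)))
    (fun i q => ((hχlim _).mul_const _).const_mul _) (fun _ => hintg)
  simp only [Fin.sum_univ_one, one_mul] at T2
  -- boundary terms
  have hL : ∀ {Y : Type} [TopologicalSpace Y] [MeasurableSpace Y] [BorelSpace Y]
      [SecondCountableTopology Y] {μ : Measure (ℝ × Y)} {ι : Y → Space} {ν : Fin 3 → Y → ℝ},
      (∀ j, Continuous (ν j)) → (∀ j y, |ν j y| ≤ 1) →
      (∀ j, Integrable (fun q : ℝ × Y => w j (q.1, ι q.2)) μ) →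
      Integrable (fun q : ℝ × Y => cB (q.1, ι q.2)) μ →
      Tendsto (fun n => ∫ q : ℝ × Y, ∑ j, ν j q.2 * (η q.1 *
        (H n j (fun l => w l (q.1, ι q.2)) * S (cB (q.1, ι q.2)) * 1)) ∂μ) atTop
      (𝓝 (∫ q : ℝ × Y, ∑ j, ν j q.2 * (η q.1 * S (cB (q.1, ι q.2)) * w j (q.1, ι q.2)) ∂μ)) := by
    intro Y _ _ _ _ μ ι ν hν hν1 hw hcB
    have mw : AEMeasurable (fun q : ℝ × Y => fun l => w l (q.1, ι q.2)) μ :=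
      aemeasurable_pi_lambda _ fun l => (hw l).1.aemeasurable
    have := tendsto_integral_sum_weight (μ := μ) (κ := Fin 3)
      (a := fun n j q => ν j q.2 * (η q.1 *
        (χ (N n • fun l => w l (q.1, ι q.2)) * S (cB (q.1, ι q.2)))))
      (a' := fun j q => ν j q.2 * (η q.1 * (1 * S (cB (q.1, ι q.2)))))
      (g := fun j q => w j (q.1, ι q.2)) (M := 1 * (D * (1 * C)))
      (fun n j => ((hν j).comp continuous_snd).aestronglyMeasurable.mul
        ((aestronglyMeasurable_comp_fst hη.continuous).mul ((hχ.continuous.comp_aestronglyMeasurable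
        (mw.const_smul (N n)).aestronglyMeasurable).mul
        (hSc.continuous.comp_aestronglyMeasurable hcB.1))))
      (fun n j q => hab (hν1 _ _) (hab (hηD _) (hab (hχab _) (hSC _))))
      (fun j q => (((hχlim _).mul_const _).const_mul _).const_mul _) hw
    convert this using 5 with n q j j
    · simp only [hHχ]; ring
    · ring
  have T3 : Tendsto (fun n => P.boundaryFlux T fun j q => η q.1 *
      (H n j (fun l => w l q) * S (cB q) * 1)) atTop
      (𝓝 (P.boundaryFlux T fun j q => η q.1 * S (cB q) * w j q)) :=
    ((hL (ι := P.inlet) (ν := fun j _ => normalIn j) (fun j => continuous_const)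
      (fun j _ => abs_normalIn_le j) (fun j => (hu j).bdry.inl.int) hc.bdry.inl.int).add
    (hL (ι := P.outlet) (ν := fun j _ => normalOut j) (fun j => continuous_const)
      (fun j _ => abs_normalOut_le j) (fun j => (hu j).bdry.out.int) hc.bdry.out.int)).add
    (hL (ι := P.lateral) (ν := fun j y => P.normalLat y j) P.continuous_normalLat
      (fun j y => P.abs_normalLat_le y j) (fun j => (hu j).bdry.lat.int) hc.bdry.lat.int)
  rw [T1z] at T1
  have := tendsto_nhds_unique ((T1.add T2).congr fun n => ?_) T3
  · rw [zero_add] at this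
    exact this
  · rw [← key n]
    congr 1
    · congr 1; ext q
      refine Finset.sum_congr rfl fun i _ => ?_
      rw [hHd]; ring
    · congr 1; ext q
      rw [Finset.mul_sum]
      refine Finset.sum_congr rfl fun j _ => ?_
      rw [hHχ]; ring

end Pore

end Convection

/-! ### Chain rule in time -/

section TimeDerivative

theorem tendsto_integral_cutoff {Y : Type*} [MeasurableSpace Y] {μ : Measure Y} {χ : ℕ → Y → ℝ}
    {g : Y → ℝ} (hχ : ∀ n, AEStronglyMeasurable (χ n) μ) (hχ1 : ∀ n y, |χ n y| ≤ 1)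
    (hlim : ∀ᵐ y ∂μ, ∀ᶠ n in atTop, χ n y = 1) (hg : Integrable g μ) :
    Tendsto (fun n => ∫ y, χ n y * g y ∂μ) atTop (𝓝 (∫ y, g y ∂μ)) := by
  refine tendsto_integral_of_dominated_convergence (fun y => |g y|)
    (fun n => (hχ n).mul hg.1) hg.abs (fun n => ae_of_all _ fun y => ?_) ?_
  · rw [Real.norm_eq_abs, abs_mul]
    exact mul_le_of_le_one_left (abs_nonneg _) (hχ1 n y)
  · filter_upwards [hlim] with y hy
    exact tendsto_const_nhds.congr' (hy.mono fun n hn => by simp only [hn, one_mul])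

theorem tsupport_fst_mul_snd_subset {X Y : Type*} [TopologicalSpace X] [TopologicalSpace Y]
    {η : X → ℝ} {χ : Y → ℝ} :
    tsupport (fun q : X × Y => η q.1 * χ q.2) ⊆ tsupport η ×ˢ tsupport χ := by
  refine closure_minimal (fun q hq => ?_) ((isClosed_tsupport η).prod (isClosed_tsupport χ))
  exact ⟨subset_tsupport _ (left_ne_zero_of_mul hq), subset_tsupport _ (right_ne_zero_of_mul hq)⟩

theorem hasCompactSupport_fst_mul_snd {X Y : Type*} [TopologicalSpace X] [TopologicalSpace Y]
    {η : X → ℝ} {χ : Y → ℝ} (hη : HasCompactSupport η) (hχ : HasCompactSupport χ) :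
    HasCompactSupport (fun q : X × Y => η q.1 * χ q.2) :=
  (hη.isCompact.prod hχ.isCompact).of_isClosed_subset (isClosed_tsupport _)
    tsupport_fst_mul_snd_subset

variable {E : Type*} [NormedAddCommGroup E] [NormedSpace ℝ E] [FiniteDimensional ℝ E]
  [MeasureSpace E] [BorelSpace E] [(volume : Measure E).IsAddHaarMeasure]

theorem abs_le_of_hasDerivAt {β b : ℝ → ℝ} {C : ℝ} (hβ : ∀ s, HasDerivAt β (b s) s)
    (hβ0 : β 0 = 0) (hbC : ∀ s, |b s| ≤ C) (s : ℝ) : |β s| ≤ C * |s| := by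
  have := Convex.norm_image_sub_le_of_norm_hasDerivWithin_le (f := β) (f' := b) (C := C)
    (s := univ) (x := 0) (y := s) (fun x _ => (hβ x).hasDerivWithinAt) (fun x _ => hbC x)
    convex_univ (mem_univ _) (mem_univ _)
  simpa [hβ0] using this

theorem integrable_comp_of_hasDerivAt {Y : Type*} [MeasurableSpace Y] {μ : Measure Y}
    {β b : ℝ → ℝ} {C : ℝ} (hβ : ∀ s, HasDerivAt β (b s) s)
    (hβ0 : β 0 = 0) (hbC : ∀ s, |b s| ≤ C) {f : Y → ℝ} (hf : Integrable f μ) :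
    Integrable (fun y => β (f y)) μ :=
  (hf.abs.const_mul C).mono' ((continuous_iff_continuousAt.2 fun s =>
    (hβ s).continuousAt).comp_aestronglyMeasurable hf.1)
    (ae_of_all _ fun _ => abs_le_of_hasDerivAt hβ hβ0 hbC _)

/-- The chain rule for the weak time derivative, tested with functions of time. -/
theorem HasWeakDeriv.time_chain_rule {T : ℝ} {G : Set E} (hG : IsOpen G) {f ft : ℝ × E → ℝ}
    (h : HasWeakDeriv T G (1, 0) f ft) (hf : IntegrableOn f (timeCyl T G))
    (hft : IntegrableOn ft (timeCyl T G)) {β b : ℝ → ℝ} {C : ℝ}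
    (hβ : ∀ s, HasDerivAt β (b s) s) (hβ0 : β 0 = 0) (hb : Continuous b)
    (hbC : ∀ s, |b s| ≤ C) {η : ℝ → ℝ} (hη : ContDiff ℝ ∞ η) (hηc : HasCompactSupport η)
    (hηT : tsupport η ⊆ Ioo 0 T) :
    ∫ q in timeCyl T G, β (f q) * deriv η q.1 = -∫ q in timeCyl T G, η q.1 * (b (f q) * ft q) := by
  have : ProperSpace E := FiniteDimensional.proper ℝ E
  -- A function of time alone is not compactly supported in (0,T) × G. Spatial cutoffs supply this,
  -- and they commute with the time derivative, so they disappear in the limit without a boundary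
  -- term.
  obtain ⟨χ, hχ, hχc, hχG, hχ0, hχ1, hχl⟩ := exists_cutoff_seq hG
  obtain ⟨D, hD⟩ := hη.continuous.bounded_above_of_compact_support hηc
  have hη' : Continuous (deriv η) := hη.continuous_deriv (by simp)
  obtain ⟨D', hD'⟩ := hη'.bounded_above_of_compact_support hηc.deriv
  have hm : MeasurableSet (timeCyl T G) := (timeCyl_isOpen T hG).measurableSet
  have mχ : ∀ n, AEStronglyMeasurable (fun q : ℝ × E => χ n q.2)
    (volume.restrict (timeCyl T G)) := fun n =>
      ((hχ n).continuous.comp continuous_snd).aestronglyMeasurable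
  have hχab : ∀ n (q : ℝ × E), |χ n q.2| ≤ 1 := fun n q => by
    rw [abs_of_nonneg (hχ0 n _)]; exact hχ1 n _
  have hlim : ∀ᵐ q ∂volume.restrict (timeCyl T G), ∀ᶠ n in atTop, χ n q.2 = 1 := by
    filter_upwards [ae_restrict_mem hm] with q hq using hχl _ hq.2
  have L1 := tendsto_integral_cutoff mχ hχab hlim
    ((integrable_comp_of_hasDerivAt hβ hβ0 hbC hf).mul_bdd (c := D')
      (hη'.comp continuous_fst).aestronglyMeasurable (ae_of_all _ fun q => hD' q.1))
  have L2 := tendsto_integral_cutoff mχ hχab hlim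
    ((hft.bdd_mul (c := C) (hb.comp_aestronglyMeasurable hf.1)
      (ae_of_all _ fun q => hbC _)).bdd_mul (c := D)
      (hη.continuous.comp continuous_fst).aestronglyMeasurable (ae_of_all _ fun q => hD q.1))
  refine tendsto_nhds_unique L1 (L2.neg.congr fun n => ?_)
  have key := h.weakDerivOn.chain_rule (timeCyl_isOpen T hG) hβ hb hbC
    (φ := fun q => η q.1 * χ n q.2)
    ((contDiff_time hη).mul ((hχ n).comp contDiff_snd))
    (hasCompactSupport_fst_mul_snd hηc (hχc n))
    (tsupport_fst_mul_snd_subset.trans (prod_mono hηT (hχG n)))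
  have hd : ∀ q : ℝ × E, fderiv ℝ (fun q : ℝ × E => η q.1 * χ n q.2) q (1, 0) =
      χ n q.2 * deriv η q.1 := fun q => by
    have h1 : HasFDerivAt (fun q : ℝ × E => χ n q.2)
        ((fderiv ℝ (χ n) q.2).comp (ContinuousLinearMap.snd ℝ ℝ E)) q :=
      (((hχ n).differentiable (by simp)) q.2).hasFDerivAt.comp q hasFDerivAt_snd
    have h2 : fderiv ℝ (fun q : ℝ × E => η q.1 * χ n q.2) q = _ :=
      ((hasFDerivAt_time hη q).mul h1).fderiv
    rw [h2]
    simp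
  simp only [hd] at key
  rw [neg_eq_iff_eq_neg]
  calc _ = ∫ q in timeCyl T G, b (f q) * ft q * (η q.1 * χ n q.2) := by
        congr 1; ext q; simp only [Function.comp_apply]; ring
    _ = -∫ q in timeCyl T G, β (f q) * (χ n q.2 * deriv η q.1) := by rw [key, neg_neg]
    _ = _ := by congr 2; ext q; simp only [Function.comp_apply]; ring

end TimeDerivative

/-! ### Divergence and inflow trace of the velocity -/

section VelocityTraces

theorem integrableOn_mul_of_hasCompactSupport {X : Type*} [TopologicalSpace X] [MeasurableSpace X]
    [OpensMeasurableSpace X] [SecondCountableTopology X] {μ : Measure X}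
    {O : Set X} {w φ : X → ℝ} (hw : LocallyIntegrableOn w O μ) (hφ : Continuous φ)
    (hφc : HasCompactSupport φ) (hφO : tsupport φ ⊆ O) :
    IntegrableOn (fun x => w x * φ x) O μ := by
  obtain ⟨D, hD⟩ := hφ.bounded_above_of_compact_support hφc
  have h1 : IntegrableOn w (tsupport φ) μ := hw.integrableOn_compact_subset hφO hφc
  have h2 : IntegrableOn (fun x => w x * φ x) (tsupport φ) μ :=
    Integrable.mul_bdd (c := D) h1 hφ.aestronglyMeasurable (ae_of_all _ hD)
  exact ((integrableOn_iff_integrable_of_support_subset fun x hx => by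
    by_contra hx'
    exact hx (by simp [image_eq_zero_of_notMem_tsupport hx'])).1 h2).integrableOn

/-- The weak derivatives move from the test function to u, and a locally integrable function
orthogonal to all test functions vanishes almost everywhere. -/
theorem ae_sum_weakDeriv_eq_zero {E : Type*} [NormedAddCommGroup E] [NormedSpace ℝ E]
    [FiniteDimensional ℝ E]
    [MeasureSpace E] [BorelSpace E] [(volume : Measure E).IsAddHaarMeasure] {T : ℝ} {G : Set E}
    (hG : IsOpen G) {n : ℕ} {e : Fin n → E} {u Du : Fin n → ℝ × E → ℝ}
    (h : ∀ j, HasWeakDeriv T G (0, e j) (u j) (Du j))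
    (hdiv : ∀ φ : ℝ × E → ℝ, ContDiff ℝ ∞ φ → HasCompactSupport φ → tsupport φ ⊆ timeCyl T G →
      ∫ q in timeCyl T G, ∑ j, u j q * fderiv ℝ φ q (0, e j) = 0) :
    ∀ᵐ q ∂volume.restrict (timeCyl T G), ∑ j, Du j q = 0 := by
  have : ProperSpace E := FiniteDimensional.proper ℝ E
  have hO := timeCyl_isOpen T hG
  have hloc : LocallyIntegrableOn (fun q => ∑ j, Du j q) (timeCyl T G) := fun q hq => by
    choose s hs hsi using fun j => (h j).locInt_deriv q hq
    exact ⟨⋂ j, s j, Filter.iInter_mem.2 hs, integrable_finsetSum _ fun j _ =>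
      (hsi j).mono_set (iInter_subset _ j)⟩
  have key := hO.ae_eq_zero_of_integral_contDiff_smul_eq_zero (μ := volume)
    (f := fun q => ∑ j, Du j q) hloc fun φ hφ hφc hφO => ?_
  · rwa [← ae_restrict_iff' hO.measurableSet] at key
  · rw [← setIntegral_eq_integral_of_forall_compl_eq_zero (s := timeCyl T G)
      fun x hx => by simp [image_eq_zero_of_notMem_tsupport fun hh => hx (hφO hh)]]
    have h0 := hdiv φ hφ hφc hφO
    have hdc : ∀ j, Continuous fun q => fderiv ℝ φ q (0, e j) := fun j =>
      (continuous_fderiv_apply hφ _).continuous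
    have hs : ∀ j, tsupport (fun q => fderiv ℝ φ q (0, e j)) ⊆ tsupport φ := fun j =>
      closure_minimal (fun q hq => by
        by_contra hx
        exact hq (by simp [fderiv_eq_zero_of_notMem_tsupport hx])) (isClosed_tsupport φ)
    have i1 : ∀ j, IntegrableOn (fun q => u j q * fderiv ℝ φ q (0, e j)) (timeCyl T G) := fun j =>
      integrableOn_mul_of_hasCompactSupport (h j).locInt (hdc j)
        (hφc.of_isClosed_subset (isClosed_tsupport _) (hs j)) ((hs j).trans hφO)
    have i2 : ∀ j, IntegrableOn (fun q => Du j q * φ q) (timeCyl T G) := fun j =>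
      integrableOn_mul_of_hasCompactSupport (h j).locInt_deriv hφ.continuous hφc hφO
    rw [integral_finsetSum _ fun j _ => i1 j, Finset.sum_congr rfl fun j _ =>
      (h j).byParts φ hφ hφc hφO, Finset.sum_neg_distrib, neg_eq_zero,
      ← integral_finsetSum _ fun j _ => i2 j] at h0
    rw [← h0]
    congr 1; ext q
    rw [smul_eq_mul, mul_comm, Finset.sum_mul]

namespace Pore

variable {P : Pore} {T : ℝ}

/-- The boundary values on the inflow area are determined by the values in the bulk. -/
theorem BulkApprox.exists_inlet_integral (P : Pore) : ∃ χ : ℝ → ℝ, ∀ {T : ℝ}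
    {f w : ℝ × Space → ℝ} {Df Dw : Fin 3 → ℝ × Space → ℝ}
    {D2f : Fin 3 → Fin 3 → ℝ × Space → ℝ} {V : ℕ → ℝ × Space → ℝ},
    P.BulkApprox T f Df D2f w Dw V →
    ∀ φ : ℝ × Plane → ℝ, ContDiff ℝ ∞ φ → HasCompactSupport φ →
    ∫ q in timeCyl T P.A, φ q * w (q.1, P.inlet q.2) =
      -((∫ q in timeCyl T P.bulk, φ (q.1, q.2.1) * deriv χ q.2.2 * f q) +
      ∫ q in timeCyl T P.bulk, φ (q.1, q.2.1) * χ q.2.2 * Df 2 q) := by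
  -- χ is 1 at z = -h and 0 at z = h, so the vertical fundamental theorem of calculus applied to φ χ
  -- f sees the inflow area only. It is chosen before the function and its trace, so that two traces
  -- can be compared.
  obtain ⟨χ, hχ, hχc, hχO, hχ0, hχ1, W, hW, h0W, hone⟩ := exists_cutoff (X := ℝ)
    (isCompact_singleton (x := -P.h)) (isOpen_Iio (a := P.h))
    (by simpa using (neg_lt_self P.h_pos))
  have χin : χ (-P.h) = 1 := hone _ (h0W rfl)
  have χout : χ P.h = 0 := image_eq_zero_of_notMem_tsupport fun hh =>
    lt_irrefl P.h (mem_Iio.1 (hχO hh))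
  have hχ' : Continuous (deriv χ) := hχ.continuous_deriv (by simp)
  refine ⟨χ, fun {T f w Df Dw D2f V} h φ hφ hφc => ?_⟩
  obtain ⟨D, hD⟩ := hφ.continuous.bounded_above_of_compact_support hφc
  obtain ⟨D', hD'⟩ := hχ'.bounded_above_of_compact_support hχc.deriv
  have hab : ∀ {x y X Y : ℝ}, |x| ≤ X → |y| ≤ Y → |x * y| ≤ X * Y := fun {x y X Y} hx hy => by
    rw [abs_mul]
    exact mul_le_mul hx hy (abs_nonneg _) ((abs_nonneg _).trans hx)
  have cφ : Continuous fun q : ℝ × Space => φ (q.1, q.2.1) := hφ.continuous.comp (by fun_prop)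
  have cχ : Continuous fun q : ℝ × Space => χ q.2.2 := hχ.continuous.comp (by fun_prop)
  have cχ' : Continuous fun q : ℝ × Space => deriv χ q.2.2 := hχ'.comp (by fun_prop)
  have L : ∀ {Y : Type} [MeasurableSpace Y] {μ : Measure Y} {F : ℕ → Y → ℝ} {F' k : Y → ℝ}
      {M : ℝ}, AEStronglyMeasurable k μ → (∀ y, |k y| ≤ M) → L1Tendsto μ F F' →
      Tendsto (fun m => ∫ y, k y * F m y ∂μ) atTop (𝓝 (∫ y, k y * F' y ∂μ)) := by
    intro Y _ μ F F' k M hk hkM hF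
    have := tendsto_integral_sum_comp_mul (μ := μ) (ι := Fin 1) (κ := Fin 1)
      (F := fun m _ => F m) (F' := fun _ => F') (G := fun m _ => F m) (G' := fun _ => F')
      (B := fun _ _ => 1) (k := fun _ => k) (C := fun _ => 1) (D := fun _ => M)
      (fun _ => continuous_const) (fun _ _ => by simp) (fun _ => hk) (fun _ => hkM)
      (fun _ => hF) (fun _ => hF)
    simpa using this
  have L1 := L (cφ.mul cχ').aestronglyMeasurable (fun q => hab (hD _) (hD' _)) h.val
  have L2 := L (cφ.mul cχ).aestronglyMeasurable (M := D * 1)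
    (fun q => hab (hD _) (by rw [abs_of_nonneg (hχ0 _)]; exact hχ1 _)) (h.grad 2)
  have L3 := L hφ.continuous.aestronglyMeasurable hD h.bdry.inl
  refine tendsto_nhds_unique L3 ((L1.add L2).neg.congr fun m => ?_)
  have hV := h.smooth m
  have hφ2 : ContDiff ℝ ∞ fun q : ℝ × Space => φ (q.1, q.2.1) := hφ.comp (by fun_prop)
  have hχ2 : ContDiff ℝ ∞ fun q : ℝ × Space => χ q.2.2 := hχ.comp (by fun_prop)
  have key := integral_fderiv_vertical (T := T) P.h_pos P.isBounded
    (Ψ := fun q : ℝ × (Plane × ℝ) => φ (q.1, q.2.1) * χ q.2.2 * V m q)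
    (((hφ2.mul hχ2).mul hV).of_le (by simp))
  simp only [χin, χout, mul_zero, zero_mul, mul_one, zero_sub] at key
  rw [integral_neg] at key
  rw [neg_eq_iff_eq_neg]
  refine Eq.trans ?_ key
  have cV := hV.continuous
  have cVz := (continuous_fderiv_apply hV (0, axis 2)).continuous
  have hb := isBounded_timeCyl T P.isBounded_bulk
  refine (integral_add (((cφ.mul cχ').mul cV).integrableOn_of_isBounded hb)
    (((cφ.mul cχ).mul cVz).integrableOn_of_isBounded hb)).symm.trans ?_
  change ∫ q in timeCyl T P.bulk, _ = ∫ q in timeCyl T P.bulk, _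
  congr 1; ext q
  have h1 : HasFDerivAt (fun q : ℝ × Space => φ (q.1, q.2.1))
      ((fderiv ℝ φ (q.1, q.2.1)).comp ((ContinuousLinearMap.fst ℝ ℝ Space).prod
        ((ContinuousLinearMap.fst ℝ Plane ℝ).comp (ContinuousLinearMap.snd ℝ ℝ Space)))) q := by
    have h0 : HasFDerivAt (fun q : ℝ × Space => ((q.1, q.2.1) : ℝ × Plane))
      ((ContinuousLinearMap.fst ℝ ℝ Space).prod
        ((ContinuousLinearMap.fst ℝ Plane ℝ).comp (ContinuousLinearMap.snd ℝ ℝ Space))) q :=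
      hasFDerivAt_fst.prodMk (hasFDerivAt_fst.comp q hasFDerivAt_snd)
    exact HasFDerivAt.comp (g := φ) q ((hφ.differentiable (by simp)) _).hasFDerivAt h0
  have h2 : HasFDerivAt (fun q : ℝ × Space => χ q.2.2)
      (deriv χ q.2.2 • ((ContinuousLinearMap.snd ℝ Plane ℝ).comp
        (ContinuousLinearMap.snd ℝ ℝ Space))) q := by
    have h0 : HasFDerivAt (fun q : ℝ × Space => q.2.2) ((ContinuousLinearMap.snd ℝ Plane ℝ).comp
        (ContinuousLinearMap.snd ℝ ℝ Space)) q := hasFDerivAt_snd.comp q hasFDerivAt_snd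
    exact HasDerivAt.comp_hasFDerivAt (h₂ := χ) q
      ((hχ.differentiable (by simp)) _).hasDerivAt h0
  have h3 : fderiv ℝ (fun q : ℝ × (Plane × ℝ) => φ (q.1, q.2.1) * χ q.2.2 * V m q) q = _ :=
    ((h1.mul h2).mul ((hV.differentiable (by simp)) q).hasFDerivAt).fderiv
  rw [h3]
  have hax : (axis 2 : Space) = (0, 1) := rfl
  have hz : fderiv ℝ φ (q.1, q.2.1) (0, 0) = 0 := map_zero _
  simp [hax, hz]
  ring

/-- The sign conditions on u·ν and the inflow boundary condition refer to separately given traces of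
the velocity. They agree on the inflow area because the formula of `exists_inlet_integral` involves
only values in the bulk. -/
theorem BulkApprox.inlet_unique {f w w' : ℝ × Space → ℝ} {Df Dw Dw' : Fin 3 → ℝ × Space → ℝ}
    {D2f : Fin 3 → Fin 3 → ℝ × Space → ℝ} {V V' : ℕ → ℝ × Space → ℝ}
    (h : P.BulkApprox T f Df D2f w Dw V) (h' : P.BulkApprox T f Df D2f w' Dw' V') :
    ∀ᵐ q ∂volume.restrict (timeCyl T P.A), w (q.1, P.inlet q.2) = w' (q.1, P.inlet q.2) := by
  obtain ⟨χ, hχ⟩ := BulkApprox.exists_inlet_integral P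
  have hO := timeCyl_isOpen T P.isOpen
  have i1 := h.bdry.inl.int
  have i2 := h'.bdry.inl.int
  have i3 : IntegrableOn (fun q : ℝ × Plane => w (q.1, P.inlet q.2) - w' (q.1, P.inlet q.2))
    (timeCyl T P.A) := i1.sub' i2
  have key := hO.ae_eq_zero_of_integral_contDiff_smul_eq_zero (μ := volume)
    i3.locallyIntegrableOn fun φ hφ hφc hφO => ?_
  · rw [← ae_restrict_iff' hO.measurableSet] at key
    filter_upwards [key] with q hq using sub_eq_zero.1 hq
  · rw [← setIntegral_eq_integral_of_forall_compl_eq_zero (s := timeCyl T P.A)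
      fun x hx => by simp [image_eq_zero_of_notMem_tsupport fun hh => hx (hφO hh)]]
    obtain ⟨D, hD⟩ := hφ.continuous.bounded_above_of_compact_support hφc
    have mφ := hφ.continuous.aestronglyMeasurable (μ := volume.restrict (timeCyl T P.A))
    simp only [smul_eq_mul, mul_sub]
    rw [integral_sub (i1.bdd_mul (c := D) mφ (ae_of_all _ hD))
      (i2.bdd_mul (c := D) mφ (ae_of_all _ hD)), hχ h φ hφ hφc, hχ h' φ hφ hφc, sub_self]

end Pore

end VelocityTraces

/-! ### Balance of the negative part in the bulk -/

section BulkEstimate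

/-- A smooth bounded approximation `b` of the derivative of the negative part: `b` is increasing,
takes values in `[-1, 0]` and vanishes on `[0, ∞)`. -/
structure IsNegStep (b b' : ℝ → ℝ) : Prop where
  hasDerivAt : ∀ s, HasDerivAt b (b' s) s
  cont_deriv : Continuous b'
  deriv_nonneg : ∀ s, 0 ≤ b' s
  abs_le : ∀ s, |b s| ≤ 1
  eq_zero : ∀ s, 0 ≤ s → b s = 0

theorem IsNegStep.continuous {b b' : ℝ → ℝ} (h : IsNegStep b b') : Continuous b :=
  (contDiff_one_of_hasDerivAt h.hasDerivAt h.cont_deriv).continuous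

theorem IsNegStep.monotone {b b' : ℝ → ℝ} (h : IsNegStep b b') : Monotone b :=
  monotone_of_deriv_nonneg (fun s => (h.hasDerivAt s).differentiableAt)
    fun s => by rw [(h.hasDerivAt s).deriv]; exact h.deriv_nonneg s

theorem IsNegStep.nonpos {b b' : ℝ → ℝ} (h : IsNegStep b b') (s : ℝ) : b s ≤ 0 :=
  (h.monotone (le_max_left s 0)).trans_eq (h.eq_zero _ (le_max_right _ _))

theorem integrable_weight_mul {Y : Type*} [TopologicalSpace Y] [MeasurableSpace Y]
    [BorelSpace Y] [SecondCountableTopology Y] {μ : Measure (ℝ × Y)} {η b : ℝ → ℝ} {D C : ℝ}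
    (hη : Continuous η) (hηD : ∀ t, |η t| ≤ D) (hb : Continuous b) (hbC : ∀ s, |b s| ≤ C)
    {f g : ℝ × Y → ℝ} (hf : AEStronglyMeasurable f μ) (hg : Integrable g μ) :
    Integrable (fun q => η q.1 * (b (f q) * g q)) μ :=
  (hg.bdd_mul (c := C) (hb.comp_aestronglyMeasurable hf) (ae_of_all _ fun _ => hbC _)).bdd_mul
    (c := D) (Pore.aestronglyMeasurable_comp_fst hη) (ae_of_all _ fun q => hηD q.1)

namespace Pore

variable {P : Pore} {T : ℝ}

/-- Convection does not create negative parts: it is bounded below by the flux through the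
inflow area. -/
theorem BulkApprox.le_integral_convection {u w : Fin 3 → ℝ × Space → ℝ}
    {Du Dw : Fin 3 → Fin 3 → ℝ × Space → ℝ} {D2u : Fin 3 → Fin 3 → Fin 3 → ℝ × Space → ℝ}
    {U : Fin 3 → ℕ → ℝ × Space → ℝ}
    (hu : ∀ l, P.BulkApprox T (u l) (Du l) (D2u l) (w l) (Dw l) (U l))
    {c cB : ℝ × Space → ℝ} {Dc DcB : Fin 3 → ℝ × Space → ℝ}
    {D2c : Fin 3 → Fin 3 → ℝ × Space → ℝ} {V : ℕ → ℝ × Space → ℝ}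
    (hc : P.BulkApprox T c Dc D2c cB DcB V)
    (hdiv : ∀ᵐ q ∂volume.restrict (timeCyl T P.bulk), ∑ j, Du j j q = 0)
    (hintg : Integrable (fun q => ∑ j, u j q * Dc j q) (volume.restrict (timeCyl T P.bulk)))
    (hwin : ∀ᵐ q ∂volume.restrict (timeCyl T P.A),
      ∑ j, w j (q.1, P.inlet q.2) * normalIn j ≤ 0)
    (hwlat : ∀ᵐ q ∂volume.restrict (timeCyl T P.cell),
      ∑ j, w j (q.1, P.lateral q.2) * P.normalLat q.2 j = 0)
    (hwout : ∀ᵐ q ∂volume.restrict (timeCyl T P.A),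
      0 ≤ ∑ j, w j (q.1, P.outlet q.2) * normalOut j) {d : ℝ}
    (hin : ∀ᵐ q ∂volume.restrict (timeCyl T P.A),
      (∑ j, w j (q.1, P.inlet q.2) * normalIn j) * cB (q.1, P.inlet q.2) ≤
        d * ∑ j, normalIn j * DcB j (q.1, P.inlet q.2))
    {b b' : ℝ → ℝ} (hb : IsNegStep b b') {η : ℝ → ℝ} {D : ℝ} (hη : ContDiff ℝ ∞ η)
    (hη0 : ∀ t, 0 ≤ η t) (hηD : ∀ t, |η t| ≤ D) :
    d * ∫ q in timeCyl T P.A,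
        ∑ j, normalIn j * (η q.1 * (b (cB (q.1, P.inlet q.2)) * DcB j (q.1, P.inlet q.2))) ≤
      ∫ q in timeCyl T P.bulk, η q.1 * (b (c q) * ∑ j, u j q * Dc j q) := by
  -- The primitive of b is unbounded, so the divergence identity is applied to its truncations S_k;
  -- the factors ζ_k tend to 1.
  choose S ζ hS hζc hζ1 hζk hSk hS0 hSb using
    exists_truncated_primitive hb.continuous hb.monotone hb.abs_le hb.eq_zero
  have L : Tendsto (fun k : ℕ => ∫ q in timeCyl T P.bulk,
      ζ k (c q) * (η q.1 * (b (c q) * ∑ j, u j q * Dc j q))) atTop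
      (𝓝 (∫ q in timeCyl T P.bulk, η q.1 * (b (c q) * ∑ j, u j q * Dc j q))) := by
    refine tendsto_integral_cutoff
      (fun k => (hζc k).comp_aestronglyMeasurable hc.val.int.1) (fun k q => hζ1 k _)
      (ae_of_all _ fun q => ?_)
      (integrable_weight_mul hη.continuous hηD hb.continuous hb.abs_le hc.val.int.1 hintg)
    obtain ⟨k, hk⟩ := exists_nat_ge (-c q)
    filter_upwards [eventually_ge_atTop k] with m hm
    refine hζk m _ ?_
    have : (k : ℝ) ≤ m := by exact_mod_cast hm
    linarith
  refine ge_of_tendsto' L fun k => ?_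
  have hζb : ∀ s, |ζ k s * b s| ≤ 1 := fun s => by
    rw [abs_mul]; exact mul_le_one₀ (hζ1 k s) (abs_nonneg _) (hb.abs_le s)
  have key := BulkApprox.convection hu hc hdiv hintg (hS k)
    ((hζc k).mul hb.continuous) (hSk k) hζb hη hηD
  have e : ∫ q in timeCyl T P.bulk, ζ k (c q) * (η q.1 * (b (c q) * ∑ j, u j q * Dc j q)) =
      ∫ q in timeCyl T P.bulk, η q.1 * (ζ k (c q) * b (c q)) * ∑ j, u j q * Dc j q := by
    congr 1; ext q; ring
  have cS : Continuous (S k) := continuous_iff_continuousAt.2 fun s => (hS k s).continuousAt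
  rw [e, key, boundaryFlux, ← integral_const_mul]
  have h1 : ∫ q in timeCyl T P.cell, ∑ j, P.normalLat q.2 j *
      (η q.1 * S k (cB (q.1, P.lateral q.2)) * w j (q.1, P.lateral q.2)) = 0 := by
    refine integral_eq_zero_of_ae ?_
    filter_upwards [hwlat] with q hq
    have : ∀ j, P.normalLat q.2 j * (η q.1 * S k (cB (q.1, P.lateral q.2)) *
        w j (q.1, P.lateral q.2)) = η q.1 * S k (cB (q.1, P.lateral q.2)) *
        (w j (q.1, P.lateral q.2) * P.normalLat q.2 j) := fun j => by ring
    simp only [this, ← Finset.mul_sum, hq, mul_zero, Pi.zero_apply]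
  have h2 : 0 ≤ ∫ q in timeCyl T P.A, ∑ j, normalOut j *
      (η q.1 * S k (cB (q.1, P.outlet q.2)) * w j (q.1, P.outlet q.2)) := by
    refine integral_nonneg_of_ae ?_
    filter_upwards [hwout] with q hq
    have : ∀ j, normalOut j * (η q.1 * S k (cB (q.1, P.outlet q.2)) *
        w j (q.1, P.outlet q.2)) = η q.1 * S k (cB (q.1, P.outlet q.2)) *
        (w j (q.1, P.outlet q.2) * normalOut j) := fun j => by ring
    simp only [this, ← Finset.mul_sum, Pi.zero_apply]
    exact mul_nonneg (mul_nonneg (hη0 _) (hS0 _ _)) hq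
  rw [h1, add_zero]
  refine le_add_of_le_of_nonneg (integral_mono_ae ?_ ?_ ?_) h2
  · refine (integrable_finsetSum _ fun j _ => ?_).const_mul d
    exact (integrable_weight_mul hη.continuous hηD hb.continuous hb.abs_le hc.bdry.inl.int.1
      (hc.bdry_grad j).inl.int).const_mul _
  · refine integrable_finsetSum _ fun j _ => ?_
    have := (integrable_weight_mul hη.continuous hηD cS (hSk k) hc.bdry.inl.int.1
      (hu j).bdry.inl.int).const_mul (normalIn j)
    simpa only [mul_assoc] using this
  · filter_upwards [hwin, hin] with q h3 h4
    have e1 : ∀ j, normalIn j * (η q.1 * (b (cB (q.1, P.inlet q.2)) *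
        DcB j (q.1, P.inlet q.2))) = η q.1 * b (cB (q.1, P.inlet q.2)) *
        (normalIn j * DcB j (q.1, P.inlet q.2)) := fun j => by ring
    have e2 : ∀ j, normalIn j * (η q.1 * S k (cB (q.1, P.inlet q.2)) *
        w j (q.1, P.inlet q.2)) = η q.1 * S k (cB (q.1, P.inlet q.2)) *
        (w j (q.1, P.inlet q.2) * normalIn j) := fun j => by ring
    simp only [e1, e2, ← Finset.mul_sum]
    set s := cB (q.1, P.inlet q.2)
    set ν := ∑ j, w j (q.1, P.inlet q.2) * normalIn j
    set δ := ∑ j, normalIn j * DcB j (q.1, P.inlet q.2)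
    -- With ν = u·ν ≤ 0, the bound S ≤ s b(s) reverses to S ν ≥ s b(s) ν, and b ≤ 0 turns the inflow
    -- condition ν s ≤ dδ into b ν s ≥ d b δ. Together they compare the convective flux with the
    -- diffusive one.
    have h5 : s * b s * ν ≤ S k s * ν := mul_le_mul_of_nonpos_right (hSb k s) h3
    have h6 : b s * (d * δ) ≤ b s * (ν * s) := mul_le_mul_of_nonpos_left h4 (hb.nonpos s)
    have h7 : d * (b s * δ) ≤ S k s * ν := by linarith
    have := mul_le_mul_of_nonneg_left h7 (hη0 q.1)
    linarith

/-- The negative part of a solution in the bulk changes only through the active surface. -/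
theorem BulkApprox.integral_time_deriv_le {u w : Fin 3 → ℝ × Space → ℝ}
    {Du Dw : Fin 3 → Fin 3 → ℝ × Space → ℝ} {D2u : Fin 3 → Fin 3 → Fin 3 → ℝ × Space → ℝ}
    {U : Fin 3 → ℕ → ℝ × Space → ℝ}
    (hu : ∀ l, P.BulkApprox T (u l) (Du l) (D2u l) (w l) (Dw l) (U l))
    {c ct f cB : ℝ × Space → ℝ} {Dc DcB : Fin 3 → ℝ × Space → ℝ}
    {D2c : Fin 3 → Fin 3 → ℝ × Space → ℝ} {V : ℕ → ℝ × Space → ℝ}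
    (hc : P.BulkApprox T c Dc D2c cB DcB V)
    (hdiv : ∀ᵐ q ∂volume.restrict (timeCyl T P.bulk), ∑ j, Du j j q = 0)
    (hwin : ∀ᵐ q ∂volume.restrict (timeCyl T P.A),
      ∑ j, w j (q.1, P.inlet q.2) * normalIn j ≤ 0)
    (hwlat : ∀ᵐ q ∂volume.restrict (timeCyl T P.cell),
      ∑ j, w j (q.1, P.lateral q.2) * P.normalLat q.2 j = 0)
    (hwout : ∀ᵐ q ∂volume.restrict (timeCyl T P.A),
      0 ≤ ∑ j, w j (q.1, P.outlet q.2) * normalOut j) {d : ℝ} (hd : 0 < d)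
    (hct : Integrable ct (volume.restrict (timeCyl T P.bulk)))
    (hf : Integrable f (volume.restrict (timeCyl T P.bulk)))
    (hf0 : ∀ᵐ q ∂volume.restrict (timeCyl T P.bulk), 0 ≤ f q)
    (heq : ∀ᵐ q ∂volume.restrict (timeCyl T P.bulk),
      ct q + ∑ j, u j q * Dc j q - d * ∑ j, D2c j j q = f q)
    (hin : ∀ᵐ q ∂volume.restrict (timeCyl T P.A),
      (∑ j, w j (q.1, P.inlet q.2) * normalIn j) * cB (q.1, P.inlet q.2) ≤
        d * ∑ j, normalIn j * DcB j (q.1, P.inlet q.2))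
    {R : ℝ × (ℝ × ℝ) → ℝ}
    (hlat : ∀ᵐ q ∂volume.restrict (timeCyl T P.cell),
      -d * ∑ j, P.normalLat q.2 j * P.pull (DcB j) q = R q)
    (hout : ∀ᵐ q ∂volume.restrict (timeCyl T P.A),
      -d * ∑ j, normalOut j * DcB j (q.1, P.outlet q.2) = 0)
    {b b' : ℝ → ℝ} (hb : IsNegStep b b') {η : ℝ → ℝ} {D : ℝ} (hη : ContDiff ℝ ∞ η)
    (hη0 : ∀ t, 0 ≤ η t) (hηD : ∀ t, |η t| ≤ D) :
    ∫ q in timeCyl T P.bulk, η q.1 * (b (c q) * ct q) ≤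
      -∫ q in timeCyl T P.cell, η q.1 * (b (P.pull cB q) * R q) := by
  have hΔ : Integrable (fun q => ∑ j, D2c j j q) (volume.restrict (timeCyl T P.bulk)) :=
    integrable_finsetSum _ fun j _ => (hc.hess j j).int
  -- For a product of two L^p functions integrability is not automatic; here it follows because all
  -- other terms of the equation are integrable.
  have hF : Integrable (fun q => ∑ j, u j q * Dc j q) (volume.restrict (timeCyl T P.bulk)) := by
    refine ((hf.sub hct).add (hΔ.const_mul d)).congr ?_
    filter_upwards [heq] with q hq
    simp only [Pi.add_apply, Pi.sub_apply]
    linarith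
  have hconv := BulkApprox.le_integral_convection hu hc hdiv hF hwin hwlat hwout hin hb hη hη0 hηD
  have hkato := hc.kato hb.hasDerivAt hb.cont_deriv hb.deriv_nonneg hb.abs_le hη hη0 hηD
  have hI : ∀ {g : ℝ × Space → ℝ}, Integrable g (volume.restrict (timeCyl T P.bulk)) →
      Integrable (fun q => η q.1 * (b (c q) * g q)) (volume.restrict (timeCyl T P.bulk)) :=
    fun hg => integrable_weight_mul hη.continuous hηD hb.continuous hb.abs_le hc.val.int.1 hg
  have e1 : ∫ q in timeCyl T P.bulk, η q.1 * (b (c q) * ct q) =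
      (∫ q in timeCyl T P.bulk, η q.1 * (b (c q) * f q)) -
      (∫ q in timeCyl T P.bulk, η q.1 * (b (c q) * ∑ j, u j q * Dc j q)) +
      d * ∫ q in timeCyl T P.bulk, η q.1 * (b (c q) * ∑ j, D2c j j q) := by
    rw [← integral_const_mul, ← integral_sub (hI hf) (hI hF),
      ← integral_add ((hI hf).sub' (hI hF)) ((hI hΔ).const_mul d)]
    refine integral_congr_ae ?_
    filter_upwards [heq] with q hq
    rw [← hq]; ring
  have e2 : ∫ q in timeCyl T P.bulk, ∑ j, η q.1 * (b (c q) * D2c j j q) =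
      ∫ q in timeCyl T P.bulk, η q.1 * (b (c q) * ∑ j, D2c j j q) := by
    simp only [Finset.mul_sum]
  have e3 : ∫ q in timeCyl T P.bulk, η q.1 * (b (c q) * f q) ≤ 0 := by
    refine integral_nonpos_of_ae ?_
    filter_upwards [hf0] with q hq
    exact mul_nonpos_of_nonneg_of_nonpos (hη0 _)
      (mul_nonpos_of_nonpos_of_nonneg (hb.nonpos _) hq)
  have e4 : ∫ q in timeCyl T P.A, ∑ j, normalOut j *
      (η q.1 * (b (cB (q.1, P.outlet q.2)) * DcB j (q.1, P.outlet q.2))) = 0 := by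
    refine integral_eq_zero_of_ae ?_
    filter_upwards [hout] with q hq
    have h0 : ∑ j, normalOut j * DcB j (q.1, P.outlet q.2) = 0 :=
      (mul_eq_zero.1 hq).resolve_left (neg_ne_zero.2 hd.ne')
    have : ∀ j, normalOut j * (η q.1 * (b (cB (q.1, P.outlet q.2)) *
        DcB j (q.1, P.outlet q.2))) = η q.1 * b (cB (q.1, P.outlet q.2)) *
        (normalOut j * DcB j (q.1, P.outlet q.2)) := fun j => by ring
    simp only [this, ← Finset.mul_sum, h0, mul_zero, Pi.zero_apply]
  have e5 : d * ∫ q in timeCyl T P.cell, ∑ j, P.normalLat q.2 j *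
      (η q.1 * (b (cB (q.1, P.lateral q.2)) * DcB j (q.1, P.lateral q.2))) =
      -∫ q in timeCyl T P.cell, η q.1 * (b (P.pull cB q) * R q) := by
    rw [← integral_const_mul, ← integral_neg]
    refine integral_congr_ae ?_
    filter_upwards [hlat] with q hq
    have : ∀ j, P.normalLat q.2 j * (η q.1 * (b (cB (q.1, P.lateral q.2)) *
        DcB j (q.1, P.lateral q.2))) = η q.1 * b (P.pull cB q) *
        (P.normalLat q.2 j * P.pull (DcB j) q) := fun j => by simp only [pull]; ring
    simp only [this, ← Finset.mul_sum]
    rw [← hq]; ring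
  rw [e2] at hkato
  have := mul_le_mul_of_nonneg_left hkato hd.le
  simp only [boundaryFlux, e4, add_zero, mul_add, e5] at this
  rw [e1]
  linarith

end Pore

end BulkEstimate

/-! ### Periodicity and unfolding of the active surface -/

section Translation

variable {X : Type*} [NormedAddCommGroup X] [NormedSpace ℝ X] [FiniteDimensional ℝ X]
  [MeasurableSpace X] [BorelSpace X] {μ : Measure X} [μ.IsAddHaarMeasure]

theorem setIntegral_comp_add {O O' : Set X} {a : X} (h : ∀ x, x + a ∈ O ↔ x ∈ O') (F : X → ℝ) :
    ∫ x in O', F (x + a) ∂μ = ∫ x in O, F x ∂μ := by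
  have := (measurePreserving_add_right μ a).setIntegral_preimage_emb
    (Homeomorph.addRight a).measurableEmbedding F O
  rw [← this]
  congr 2
  ext x
  exact (h x).symm

theorem integrableOn_comp_add {O O' : Set X} {a : X} (h : ∀ x, x + a ∈ O ↔ x ∈ O')
    {F : X → ℝ} : IntegrableOn (fun x => F (x + a)) O' μ ↔ IntegrableOn F O μ := by
  have h1 := (measurePreserving_add_right μ a).integrableOn_comp_preimage
    (Homeomorph.addRight a).measurableEmbedding (f := F) (s := O)
  have h2 : (fun x => x + a) ⁻¹' O = O' := by ext x; exact h x
  rwa [h2] at h1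

/-- Together with `WeakDerivOn.ae_unique`, this makes the weak derivatives of a periodic function
periodic. -/
theorem WeakDerivOn.comp_add {O : Set X} {v a : X} {f g : X → ℝ} (hO : IsOpen O)
    (h : WeakDerivOn μ O v f g) (ha : ∀ x, x + a ∈ O ↔ x ∈ O) :
    WeakDerivOn μ O v (fun x => f (x + a)) (fun x => g (x + a)) := by
  have : ProperSpace X := FiniteDimensional.proper ℝ X
  have hloc : ∀ {f : X → ℝ}, LocallyIntegrableOn f O μ →
      LocallyIntegrableOn (fun x => f (x + a)) O μ := fun {f} hf => by
    rw [locallyIntegrableOn_iff hO.isLocallyClosed] at hf ⊢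
    intro K hKO hK
    refine (integrableOn_comp_add (O := (fun x => x + a) '' K) fun x => ?_).2
      (hf _ ?_ (hK.image (by fun_prop)))
    · exact (add_left_injective a).mem_set_image
    · rintro _ ⟨x, hx, rfl⟩
      exact (ha x).2 (hKO hx)
  refine ⟨hloc h.locInt, hloc h.locInt_deriv, fun φ hφ hφc hφO => ?_⟩
  have hφ' : ContDiff ℝ ∞ fun x => φ (x - a) := hφ.comp (by fun_prop)
  have hts : tsupport (fun x => φ (x - a)) ⊆ (fun x => x - a) ⁻¹' tsupport φ :=
    closure_minimal (fun x hx => subset_tsupport φ hx)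
      ((isClosed_tsupport φ).preimage (by fun_prop))
  have hc' : HasCompactSupport fun x => φ (x - a) :=
    hφc.comp_homeomorph (Homeomorph.subRight a)
  have key := h.byParts (fun x => φ (x - a)) hφ' hc' fun x hx => by
    have := (ha (x - a)).2 (hφO (hts hx))
    rwa [sub_add_cancel] at this
  rw [← setIntegral_comp_add ha, ← setIntegral_comp_add ha (fun x => g x * φ (x - a))] at key
  simpa only [fderiv_comp_sub, add_sub_cancel_right] using key

end Translation

section Unfolding

/-- A smooth function which is `≥ 0`, supported in `[0, 2L]`, and whose translates by `L` add up
to one. -/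
theorem exists_periodic_partition {L : ℝ} (hL : 0 < L) : ∃ ρ : ℝ → ℝ, ContDiff ℝ ∞ ρ ∧
    HasCompactSupport ρ ∧ (∀ s, 0 ≤ ρ s) ∧ (∀ s, s ∉ Ioo 0 (2 * L) → ρ s = 0) ∧
    (∀ s, s ∉ Ioo 0 (2 * L) → deriv ρ s = 0) ∧
    (∀ s ∈ Ioo 0 L, ρ s + ρ (s + L) = 1) ∧ ∀ s ∈ Ioo 0 L, deriv ρ s + deriv ρ (s + L) = 0 := by
  set B : ℝ → ℝ := fun s => Real.smoothTransition (s / L) with hB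
  have cB : ContDiff ℝ ∞ B := Real.smoothTransition.contDiff.comp (by fun_prop)
  have B0 : ∀ s, s ≤ 0 → B s = 0 := fun s hs =>
    Real.smoothTransition.zero_of_nonpos (div_nonpos_of_nonpos_of_nonneg hs hL.le)
  have B1 : ∀ s, L ≤ s → B s = 1 := fun s hs =>
    Real.smoothTransition.one_of_one_le ((one_le_div hL).2 hs)
  have Bn : ∀ s, 0 ≤ B s := fun s => Real.smoothTransition.nonneg _
  have Bl : ∀ s, B s ≤ 1 := fun s => Real.smoothTransition.le_one _
  -- B rises from 0 to 1 on [0, L], so on (0, L) the sum of ρ and its translate telescopes to B(s +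
  -- L) - B(s - L) = 1.
  set ρ : ℝ → ℝ := fun s => B s - B (s - L) with hρ
  have cρ : ContDiff ℝ ∞ ρ := cB.sub (cB.comp (by fun_prop))
  have ρn : ∀ s, 0 ≤ ρ s := fun s => by
    simp only [hρ]
    rcases le_total s L with hs | hs
    · rw [B0 (s - L) (by linarith)]; simpa using Bn s
    · rw [B1 s hs]; linarith [Bl (s - L)]
  have ρz : ∀ s, s ∉ Ioo 0 (2 * L) → ρ s = 0 := fun s hs => by
    simp only [hρ]
    rcases le_or_gt s 0 with h | h
    · rw [B0 s h, B0 _ (by linarith), sub_zero]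
    · have : 2 * L ≤ s := not_lt.1 fun h' => hs ⟨h, h'⟩
      rw [B1 s (by linarith), B1 _ (by linarith), sub_self]
  have sum1 : ∀ s ∈ Ioo 0 L, ρ s + ρ (s + L) = 1 := fun s hs => by
    simp only [hρ]
    rw [B0 (s - L) (by linarith [hs.2]), B1 (s + L) (by linarith [hs.1]), add_sub_cancel_right]
    ring
  have dρ : ∀ s, HasDerivAt ρ (deriv ρ s) s := fun s =>
    ((cρ.differentiable (by simp)) s).hasDerivAt
  refine ⟨ρ, cρ, ?_, ρn, ρz, fun s hs => ?_, sum1, fun s hs => ?_⟩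
  · refine HasCompactSupport.intro (isCompact_Icc (a := 0) (b := 2 * L)) fun s hs => ρz s ?_
    exact fun h => hs (Ioo_subset_Icc_self h)
  -- The derivative vanishes at the end points as well, where ρ ≥ 0 attains its minimum.
  · have : IsLocalMin ρ s := Filter.Eventually.of_forall fun r => by
      rw [ρz s hs]; exact ρn r
    exact this.deriv_eq_zero
  · have h1 : HasDerivAt (fun r => ρ r + ρ (r + L)) (deriv ρ s + deriv ρ (s + L)) s :=
      (dρ s).add ((dρ (s + L)).comp_add_const s L)
    have h2 : HasDerivAt (fun r => ρ r + ρ (r + L)) 0 s := by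
      refine (hasDerivAt_const s (1 : ℝ)).congr_of_eventuallyEq ?_
      filter_upwards [isOpen_Ioo.mem_nhds hs] with r hr using sum1 r hr
    exact h1.unique h2

namespace Pore

variable (P : Pore) {T : ℝ}

/-- The translation by one period in the parameters of the active surface. -/
def shift : ℝ × (ℝ × ℝ) := (0, (P.len, 0))

theorem add_shift_mem_strip (q : ℝ × (ℝ × ℝ)) :
    q + P.shift ∈ timeCyl T P.strip ↔ q ∈ timeCyl T P.strip := by
  simp [shift, timeCyl, strip]

theorem pull_add_shift (v : ℝ × Space → ℝ) (q : ℝ × (ℝ × ℝ)) :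
    P.pull v (q + P.shift) = P.pull v q := by
  simp [shift, pull, lateral, P.periodic q.2.1]

theorem cell_subset_strip : P.cell ⊆ P.strip := prod_mono (subset_univ _) subset_rfl

/-- Integrals over the strip of functions supported in two periods. -/
theorem setIntegral_strip {F : ℝ × (ℝ × ℝ) → ℝ} (h0 : ∀ q, q.2.1 ∉ Ioo 0 (2 * P.len) → F q = 0)
    (h1 : IntegrableOn F (timeCyl T P.cell))
    (h2 : IntegrableOn (fun q => F (q + P.shift)) (timeCyl T P.cell)) :
    ∫ q in timeCyl T P.strip, F q = ∫ q in timeCyl T P.cell, (F q + F (q + P.shift)) := by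
  set C' : Set (ℝ × (ℝ × ℝ)) := timeCyl T (Ioo P.len (2 * P.len) ×ˢ Ioo (-P.h) P.h) with hC'
  have hmem : ∀ q, q + P.shift ∈ C' ↔ q ∈ timeCyl T P.cell := fun q => by
    simp only [hC', timeCyl, cell, shift, mem_prod, mem_Ioo, Prod.fst_add, Prod.snd_add, add_zero]
    constructor <;> rintro ⟨h1, h2, h3⟩ <;> refine ⟨h1, ⟨?_, ?_⟩, h3⟩ <;> linarith [h2.1, h2.2]
  have hsub : timeCyl T P.cell ∪ C' ⊆ timeCyl T P.strip :=
    union_subset (prod_mono_right P.cell_subset_strip)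
      (prod_mono_right (prod_mono (subset_univ _) subset_rfl))
  have hdisj : Disjoint (timeCyl T P.cell) C' := by
    rw [Set.disjoint_left]
    rintro q ⟨-, h3, -⟩ ⟨-, h4, -⟩
    exact lt_irrefl _ (h3.2.trans h4.1)
  have hC'm : MeasurableSet C' :=
    (timeCyl_isOpen T (isOpen_Ioo.prod isOpen_Ioo)).measurableSet
  -- The common edge of the two periods is a null set.
  have hnull : ∀ᵐ q : ℝ × (ℝ × ℝ), q.2.1 ≠ P.len := by
    have : Measure.QuasiMeasurePreserving (fun q : ℝ × (ℝ × ℝ) => q.2.1) volume volume :=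
      Measure.quasiMeasurePreserving_fst.comp Measure.quasiMeasurePreserving_snd
    exact this.ae (Measure.ae_ne volume P.len)
  have h2' : IntegrableOn F C' := (integrableOn_comp_add hmem).1 h2
  rw [integral_add h1 h2, setIntegral_comp_add hmem, ← setIntegral_union hdisj hC'm h1 h2']
  refine setIntegral_eq_of_subset_of_ae_sdiff_eq_zero
    (timeCyl_isOpen T P.isOpen_strip).measurableSet.nullMeasurableSet hsub ?_
  filter_upwards [hnull] with q hq hq'
  refine h0 q fun hs => hq'.2 ?_
  rcases lt_or_gt_of_ne hq with h | h
  · exact Or.inl ⟨hq'.1.1, ⟨hs.1, h⟩, hq'.1.2.2⟩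
  · exact Or.inr ⟨hq'.1.1, ⟨h, hs.2⟩, hq'.1.2.2⟩

end Pore

end Unfolding

/-! ### Balance of the negative part on the active surface -/

section SurfaceEstimate

namespace Pore

variable {P : Pore} {T : ℝ}

/-- Kato's inequality on the active surface in the direction along `∂A`. -/
theorem kato_along {p : ENNReal} (hp : 1 ≤ p) {w wt : ℝ × (ℝ × ℝ) → ℝ}
    {Dw : Fin 2 → ℝ × (ℝ × ℝ) → ℝ} {D2w : Fin 2 → Fin 2 → ℝ × (ℝ × ℝ) → ℝ}
    (hjet : HasParabolicJet surfAxis T P.strip P.cell p w wt Dw D2w)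
    (hper : ∀ q, w (q + P.shift) = w q) {b b' : ℝ → ℝ} (hb : IsNegStep b b') {η : ℝ → ℝ}
    (hη : ContDiff ℝ ∞ η) (hηc : HasCompactSupport η) (hηT : tsupport η ⊆ Ioo 0 T)
    (hη0 : ∀ t, 0 ≤ η t) :
    ∫ q in timeCyl T P.cell, η q.1 * (b (w q) * D2w 0 0 q) ≤ 0 := by
  have hfin := isFiniteMeasure_timeCyl T P.isBounded_cell
  have hO : IsOpen (timeCyl T P.strip) := timeCyl_isOpen T P.isOpen_strip
  have hCO : timeCyl T P.cell ⊆ timeCyl T P.strip := prod_mono_right P.cell_subset_strip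
  have hCm : MeasurableSet (timeCyl T P.cell) := (timeCyl_isOpen T P.isOpen_cell).measurableSet
  have W1 := (hjet.weak_grad 0).weakDerivOn
  have W2 := (hjet.weak_hess 0 0).weakDerivOn
  -- Uniqueness of weak derivatives passes the periodicity of w on to its first derivative and then
  -- to its second.
  have per1 : ∀ᵐ q ∂volume.restrict (timeCyl T P.strip), Dw 0 (q + P.shift) = Dw 0 q :=
    (W1.comp_add hO P.add_shift_mem_strip).ae_unique hO W1 (ae_of_all _ hper)
  have per2 : ∀ᵐ q ∂volume.restrict (timeCyl T P.strip), D2w 0 0 (q + P.shift) = D2w 0 0 q :=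
    (W2.comp_add hO P.add_shift_mem_strip).ae_unique hO W2 per1
  replace per1 := ae_restrict_of_ae_restrict_of_subset hCO per1
  replace per2 := ae_restrict_of_ae_restrict_of_subset hCO per2
  obtain ⟨D, hD⟩ := hη.continuous.bounded_above_of_compact_support hηc
  obtain ⟨ρ, hρ, hρc, hρ0, hρz, hρz', hρs, hρs'⟩ := exists_periodic_partition P.len_pos
  have cρ' : Continuous (deriv ρ) := hρ.continuous_deriv (by simp)
  obtain ⟨K, hK⟩ := hρ.continuous.bounded_above_of_compact_support hρc
  obtain ⟨K', hK'⟩ := cρ'.bounded_above_of_compact_support hρc.deriv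
  obtain ⟨χ, hχ, hχc, hχG, hχ0, hχ1, hχl⟩ := exists_cutoff_seq (X := ℝ)
    (isOpen_Ioo (a := -P.h) (b := P.h))
  have hχab : ∀ n z, |χ n z| ≤ 1 := fun n z => by rw [abs_of_nonneg (hχ0 n z)]; exact hχ1 n z
  have hI : ∀ {g : ℝ × (ℝ × ℝ) → ℝ}, MemLp g p (volume.restrict (timeCyl T P.cell)) →
      Integrable (fun q => η q.1 * (b (w q) * g q)) (volume.restrict (timeCyl T P.cell)) :=
    fun hg => integrable_weight_mul hη.continuous hD hb.continuous hb.abs_le hjet.memLp.1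
      (hg.integrable hp)
  have L := tendsto_integral_cutoff (μ := volume.restrict (timeCyl T P.cell))
    (χ := fun n q => χ n q.2.2)
    (fun n => ((hχ n).continuous.comp (by fun_prop)).aestronglyMeasurable)
    (fun n q => hχab n _)
    (by filter_upwards [ae_restrict_mem hCm] with q hq using hχl _ hq.2.2)
    (hI (hjet.memLp_hess 0 0))
  refine le_of_tendsto' L fun n => ?_
  -- Around the circumference there is no boundary, so an interior test function on the strip is
  -- used. After folding back to one period, ρ and its translate add up to 1 in front of the second
  -- derivative, and their derivatives cancel in front of the first. The cutoff in z is not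
  -- differentiated in this direction.
  have key := W1.kato W2 hO hb.hasDerivAt hb.cont_deriv hb.deriv_nonneg hb.abs_le
    (φ := fun q => η q.1 * (ρ q.2.1 * χ n q.2.2))
    ((contDiff_time hη).mul ((hρ.comp (by fun_prop)).mul ((hχ n).comp (by fun_prop))))
    (fun q => mul_nonneg (hη0 _) (mul_nonneg (hρ0 _) (hχ0 n _)))
    (hasCompactSupport_fst_mul_snd (η := η) (χ := fun x : ℝ × ℝ => ρ x.1 * χ n x.2) hηc
      (hasCompactSupport_fst_mul_snd hρc (hχc n)))
    ((tsupport_fst_mul_snd_subset (η := η) (χ := fun x : ℝ × ℝ => ρ x.1 * χ n x.2)).trans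
      (prod_mono hηT (tsupport_fst_mul_snd_subset.trans (prod_mono (subset_univ _) (hχG n)))))
  have hd : ∀ q : ℝ × (ℝ × ℝ), fderiv ℝ (fun q : ℝ × (ℝ × ℝ) => η q.1 * (ρ q.2.1 * χ n q.2.2)) q
      (0, surfAxis 0) = η q.1 * (deriv ρ q.2.1 * χ n q.2.2) := fun q => by
    have h1 : HasFDerivAt (fun q : ℝ × (ℝ × ℝ) => ρ q.2.1) (deriv ρ q.2.1 •
        ((ContinuousLinearMap.fst ℝ ℝ ℝ).comp (ContinuousLinearMap.snd ℝ ℝ (ℝ × ℝ)))) q :=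
      HasDerivAt.comp_hasFDerivAt (h₂ := ρ) q ((hρ.differentiable (by simp)) _).hasDerivAt
        (hasFDerivAt_fst.comp q hasFDerivAt_snd)
    have h2 : HasFDerivAt (fun q : ℝ × (ℝ × ℝ) => χ n q.2.2) (deriv (χ n) q.2.2 •
        ((ContinuousLinearMap.snd ℝ ℝ ℝ).comp (ContinuousLinearMap.snd ℝ ℝ (ℝ × ℝ)))) q :=
      HasDerivAt.comp_hasFDerivAt (h₂ := χ n) q (((hχ n).differentiable (by simp)) _).hasDerivAt
        (hasFDerivAt_snd.comp q hasFDerivAt_snd)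
    have h3 : fderiv ℝ (fun q : ℝ × (ℝ × ℝ) => η q.1 * (ρ q.2.1 * χ n q.2.2)) q = _ :=
      ((hasFDerivAt_time hη q).mul (h1.mul h2)).fderiv
    rw [h3]
    have hax : surfAxis 0 = (1, 0) := rfl
    simp only [hax, add_apply, smul_apply, smul_eq_mul, ContinuousLinearMap.comp_apply,
      ContinuousLinearMap.coe_fst', ContinuousLinearMap.coe_snd']
    ring
  simp only [hd] at key
  have hun : ∀ {r : ℝ → ℝ} {M : ℝ} {g : ℝ × (ℝ × ℝ) → ℝ}, Continuous r → (∀ s, ‖r s‖ ≤ M) →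
      (∀ s, s ∉ Ioo 0 (2 * P.len) → r s = 0) → MemLp g p (volume.restrict (timeCyl T P.cell)) →
      (∀ᵐ q ∂volume.restrict (timeCyl T P.cell), g (q + P.shift) = g q) →
      ∫ q in timeCyl T P.strip, η q.1 * (r q.2.1 * χ n q.2.2) * (b (w q) * g q) =
      ∫ q in timeCyl T P.cell,
        (r q.2.1 + r (q.2.1 + P.len)) * (χ n q.2.2 * (η q.1 * (b (w q) * g q))) := by
    intro r M g hr hrM hrz hg hgp
    have i0 : ∀ a : ℝ, Integrable (fun q => r (q.2.1 + a) *
        (χ n q.2.2 * (η q.1 * (b (w q) * g q)))) (volume.restrict (timeCyl T P.cell)) := fun a =>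
      ((hI hg).bdd_mul (c := 1) ((hχ n).continuous.comp (by fun_prop)).aestronglyMeasurable
        (ae_of_all _ fun q => hχab n q.2.2)).bdd_mul (c := M)
        (hr.comp (by fun_prop : Continuous fun q : ℝ × (ℝ × ℝ) => q.2.1 + a)).aestronglyMeasurable
        (ae_of_all _ fun q => hrM (q.2.1 + a))
    have e0 : ∀ᵐ q ∂volume.restrict (timeCyl T P.cell), r (q.2.1 + P.len) *
        (χ n q.2.2 * (η q.1 * (b (w q) * g q))) =
        η (q + P.shift).1 * (r (q + P.shift).2.1 * χ n (q + P.shift).2.2) *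
        (b (w (q + P.shift)) * g (q + P.shift)) := by
      filter_upwards [hgp] with q hq
      rw [hq, hper]
      simp only [shift, Prod.fst_add, Prod.snd_add, add_zero]
      ring
    rw [P.setIntegral_strip (F := fun q => η q.1 * (r q.2.1 * χ n q.2.2) * (b (w q) * g q))
      (fun q hq => by rw [hrz _ hq]; ring)
      ((i0 0).congr (ae_of_all _ fun q => by simp only [add_zero]; ring)) ((i0 P.len).congr e0)]
    refine integral_congr_ae ?_
    filter_upwards [e0] with q hq
    rw [← hq]
    ring
  rw [hun hρ.continuous hK hρz (hjet.memLp_hess 0 0) per2,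
    hun cρ' hK' hρz' (hjet.memLp_grad 0) per1] at key
  have e1 : ∫ q in timeCyl T P.cell, (deriv ρ q.2.1 + deriv ρ (q.2.1 + P.len)) *
      (χ n q.2.2 * (η q.1 * (b (w q) * Dw 0 q))) = 0 :=
    setIntegral_eq_zero_of_forall_eq_zero fun q hq => by rw [hρs' _ hq.2.1, zero_mul]
  rw [e1, neg_zero] at key
  refine le_trans (le_of_eq ?_) key
  exact setIntegral_congr_fun hCm fun q hq => by
    simp only [hρs _ hq.2.1, one_mul]

instance instSFiniteRimMeasure : SFinite P.rimMeasure := by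
  unfold rimMeasure; infer_instance

/-- Kato's inequality on the active surface in the direction of the axis of the pore. -/
theorem kato_axial {p : ENNReal} (hp : 1 ≤ p) {w wt wR : ℝ × (ℝ × ℝ) → ℝ}
    {Dw DwR : Fin 2 → ℝ × (ℝ × ℝ) → ℝ} {D2w : Fin 2 → Fin 2 → ℝ × (ℝ × ℝ) → ℝ}
    (hjet : HasParabolicJet surfAxis T P.strip P.cell p w wt Dw D2w)
    (htr : HasTrace surfAxis T P.cell P.rimMeasure p w wR DwR)
    (hrim : ∀ᵐ q ∂timeProd T P.rimMeasure, DwR 1 q = 0)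
    {b b' : ℝ → ℝ} (hb : IsNegStep b b') {η : ℝ → ℝ} {D : ℝ}
    (hη : ContDiff ℝ ∞ η) (hηD : ∀ t, |η t| ≤ D) (hη0 : ∀ t, 0 ≤ η t) :
    ∫ q in timeCyl T P.cell, η q.1 * (b (w q) * D2w 1 1 q) ≤ 0 := by
  -- In the axial direction there is a genuine boundary with a condition on traces, so the
  -- approximations from the trace definition replace mollification.
  obtain ⟨V, hV, h0, -, h2, h3, h4⟩ :=
    htr.exists_approx P.isOpen_cell P.isBounded_cell P.cell_subset_strip hp hjet
  have hbC := contDiff_one_of_hasDerivAt hb.hasDerivAt hb.cont_deriv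
  have hVz := fun m => continuous_fderiv_apply (hV m) (0, surfAxis 1)
  have hS : Bornology.IsBounded (Ioo 0 P.len) := Metric.isBounded_Ioo _ _
  have hrimT : ∀ {z : ℝ}, (volume.restrict (Ioo 0 P.len)).map (fun s => (s, z)) ≤ P.rimMeasure →
      Tendsto (fun m => ∫ q in timeCyl T (Ioo 0 P.len),
        η q.1 * (b (V m (q.1, (q.2, z))) * fderiv ℝ (V m) (q.1, (q.2, z)) (0, surfAxis 1)))
        atTop (𝓝 0) := fun {z} hz => by
    have hι : Continuous fun s : ℝ => (s, z) := by fun_prop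
    have A := L1Tendsto.pullback (T := T) hS hι (ν := P.rimMeasure) hz hp
      (fun m => (hV m).continuous) htr.1 h3
    have B := L1Tendsto.pullback (T := T) hS hι (ν := P.rimMeasure) hz hp
      (fun m => (hVz m).continuous) (htr.2.1 1) (h4 1)
    have := tendsto_integral_sum_comp_mul (ι := Fin 1) (κ := Fin 1)
      (μ := volume.restrict (timeCyl T (Ioo 0 P.len)))
      (F := fun m _ q => V m (q.1, (q.2, z))) (F' := fun _ q => wR (q.1, (q.2, z)))
      (G := fun m _ q => fderiv ℝ (V m) (q.1, (q.2, z)) (0, surfAxis 1))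
      (G' := fun _ q => DwR 1 (q.1, (q.2, z))) (B := fun _ z => b (z 0))
      (k := fun _ q => η q.1) (C := fun _ => 1) (D := fun _ => D)
      (fun _ => hb.continuous.comp (continuous_apply 0)) (fun _ _ => hb.abs_le _)
      (fun _ => aestronglyMeasurable_comp_fst hη.continuous) (fun _ q => hηD _)
      (fun _ => A) (fun _ => B)
    simp only [Finset.univ_unique, Fin.default_eq_zero, Finset.sum_singleton] at this
    convert this using 2
    symm
    refine integral_eq_zero_of_ae ?_
    have hle : (volume.restrict (timeCyl T (Ioo 0 P.len))).map
        (fun q : ℝ × ℝ => (q.1, (q.2, z))) ≤ timeProd T P.rimMeasure := by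
      rw [map_timeCyl T (Ioo 0 P.len) hι]
      exact Measure.prod_mono le_rfl hz
    have hae := ae_of_ae_map
      (by fun_prop : AEMeasurable (fun q : ℝ × ℝ => (q.1, (q.2, z)))
        (volume.restrict (timeCyl T (Ioo 0 P.len)))) (hrim.filter_mono (ae_mono hle))
    filter_upwards [hae] with q hq
    simp [hq]
  have L1 := tendsto_integral_sum_comp_mul (ι := Fin 1) (κ := Fin 1)
    (F := fun m _ => V m) (F' := fun _ => w)
    (G := fun m _ q => fderiv ℝ (fun q' => fderiv ℝ (V m) q' (0, surfAxis 1)) q (0, surfAxis 1))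
    (G' := fun _ => D2w 1 1) (B := fun _ z => b (z 0))
    (k := fun _ q => η q.1) (C := fun _ => 1) (D := fun _ => D)
    (fun _ => hb.continuous.comp (continuous_apply 0)) (fun _ _ => hb.abs_le _)
    (fun _ => aestronglyMeasurable_comp_fst hη.continuous) (fun _ q => hηD _)
    (fun _ => h0) (fun _ => h2 1 1)
  simp only [Finset.univ_unique, Fin.default_eq_zero, Finset.sum_singleton] at L1
  have L2 := (hrimT (z := P.h) (Measure.le_add_left le_rfl)).sub
    (hrimT (z := -P.h) (Measure.le_add_right le_rfl))
  rw [sub_zero] at L2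
  refine le_of_tendsto_of_tendsto' L1 L2 fun m => ?_
  have cη : Continuous fun q : ℝ × (ℝ × ℝ) => η q.1 := hη.continuous.comp continuous_fst
  have cη' : Continuous fun q : ℝ × ℝ => η q.1 := hη.continuous.comp continuous_fst
  have cb := hb.continuous.comp (hV m).continuous
  have cb' := hb.cont_deriv.comp (hV m).continuous
  have cVz := (hVz m).continuous
  have cVzz := (continuous_fderiv_apply (hVz m) (0, surfAxis 1)).continuous
  -- The divergence of η b(V) ∂_z V yields rim terms that vanish in the limit by the no-flux
  -- condition, and the term η b'(V)(∂_z V)² ≥ 0, which is discarded.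
  have key := integral_fderiv_vertical (T := T) P.h_pos hS
    (Ψ := fun q => η q.1 * (b (V m q) * fderiv ℝ (V m) q (0, surfAxis 1)))
    (((contDiff_time hη).of_le (by simp)).mul
      ((hbC.comp ((hV m).of_le (by simp))).mul ((hVz m).of_le (by simp))))
  have ir : ∀ z : ℝ, IntegrableOn (fun q : ℝ × ℝ => η q.1 * (b (V m (q.1, (q.2, z))) *
      fderiv ℝ (V m) (q.1, (q.2, z)) (0, surfAxis 1))) (timeCyl T (Ioo 0 P.len)) := fun z =>
    (cη'.mul ((cb.comp (by fun_prop : Continuous fun q : ℝ × ℝ => (q.1, (q.2, z)))).mul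
      (cVz.comp (by fun_prop : Continuous fun q : ℝ × ℝ =>
        (q.1, (q.2, z)))))).integrableOn_of_isBounded (isBounded_timeCyl T hS)
  rw [← integral_sub (ir _) (ir _), ← key]
  have hbd := isBounded_timeCyl T P.isBounded_cell
  have hd : ∀ q, fderiv ℝ (fun q => η q.1 * (b (V m q) * fderiv ℝ (V m) q (0, surfAxis 1))) q
      (0, (0, 1)) = η q.1 * (b (V m q) *
        fderiv ℝ (fun q' => fderiv ℝ (V m) q' (0, surfAxis 1)) q (0, surfAxis 1)) +
        η q.1 * (b' (V m q) * (fderiv ℝ (V m) q (0, surfAxis 1)) ^ 2) := fun q => by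
    have h1 := (hb.hasDerivAt (V m q)).comp_hasFDerivAt q
      (((hV m).differentiable (by simp)) q).hasFDerivAt
    have h2 := (hasFDerivAt_time hη q).mul
      (h1.mul (((hVz m).differentiable (by simp)) q).hasFDerivAt)
    have h3 : fderiv ℝ (fun q => η q.1 * (b (V m q) * fderiv ℝ (V m) q (0, surfAxis 1))) q = _ :=
      h2.fderiv
    have hax : ((0, 1) : ℝ × ℝ) = surfAxis 1 := rfl
    rw [h3, hax]
    simp only [add_apply, smul_apply, smul_eq_mul, ContinuousLinearMap.coe_fst', mul_zero,
      add_zero, Function.comp_apply]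
    ring
  simp only [hd]
  change _ ≤ ∫ q in timeCyl T P.cell, _
  refine integral_mono ?_ ?_ fun q => ?_
  · exact (cη.mul (cb.mul cVzz)).integrableOn_of_isBounded hbd
  · exact ((cη.mul (cb.mul cVzz)).add
      (cη.mul (cb'.mul (cVz.pow 2)))).integrableOn_of_isBounded hbd
  · have := mul_nonneg (hη0 q.1) (mul_nonneg (hb.deriv_nonneg (V m q))
      (sq_nonneg (fderiv ℝ (V m) q (0, surfAxis 1))))
    simpa using this

/-- The negative part of a solution on the active surface changes only through the sorption. -/
theorem surface_integral_time_deriv_le {p : ENNReal} (hp : 1 ≤ p) {w wt wR : ℝ × (ℝ × ℝ) → ℝ}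
    {Dw DwR : Fin 2 → ℝ × (ℝ × ℝ) → ℝ} {D2w : Fin 2 → Fin 2 → ℝ × (ℝ × ℝ) → ℝ}
    (hjet : HasParabolicJet surfAxis T P.strip P.cell p w wt Dw D2w)
    (htr : HasTrace surfAxis T P.cell P.rimMeasure p w wR DwR)
    (hper : ∀ q, w (q + P.shift) = w q)
    (hrim : ∀ᵐ q ∂timeProd T P.rimMeasure, DwR 1 q = 0) {d : ℝ} (hd : 0 < d)
    {R Q : ℝ × (ℝ × ℝ) → ℝ} (hR : Integrable R (volume.restrict (timeCyl T P.cell)))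
    (hQ : ∀ q, w q < 0 → 0 ≤ Q q)
    (heq : ∀ᵐ q ∂volume.restrict (timeCyl T P.cell), wt q - d * ∑ j, D2w j j q = R q + Q q)
    {b b' : ℝ → ℝ} (hb : IsNegStep b b') {η : ℝ → ℝ} (hη : ContDiff ℝ ∞ η)
    (hηc : HasCompactSupport η) (hηT : tsupport η ⊆ Ioo 0 T) (hη0 : ∀ t, 0 ≤ η t) :
    ∫ q in timeCyl T P.cell, η q.1 * (b (w q) * wt q) ≤
      ∫ q in timeCyl T P.cell, η q.1 * (b (w q) * R q) := by
  have hfin := isFiniteMeasure_timeCyl T P.isBounded_cell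
  obtain ⟨D, hD⟩ := hη.continuous.bounded_above_of_compact_support hηc
  have k0 := kato_along hp hjet hper hb hη hηc hηT hη0
  have k1 := kato_axial hp hjet htr hrim hb hη hD hη0
  have hI : ∀ {g : ℝ × (ℝ × ℝ) → ℝ}, Integrable g (volume.restrict (timeCyl T P.cell)) →
      Integrable (fun q => η q.1 * (b (w q) * g q)) (volume.restrict (timeCyl T P.cell)) :=
    fun hg => integrable_weight_mul hη.continuous hD hb.continuous hb.abs_le hjet.memLp.1 hg
  have i0 := hI ((hjet.memLp_hess 0 0).integrable hp)
  have i1 := hI ((hjet.memLp_hess 1 1).integrable hp)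
  have h1 : ∫ q in timeCyl T P.cell, η q.1 * (b (w q) * wt q) ≤
      ∫ q in timeCyl T P.cell, (η q.1 * (b (w q) * R q) +
        d * (η q.1 * (b (w q) * D2w 0 0 q) + η q.1 * (b (w q) * D2w 1 1 q))) := by
    refine integral_mono_ae (hI (hjet.memLp_dt.integrable hp))
      ((hI hR).fun_add ((i0.fun_add i1).const_mul d)) ?_
    filter_upwards [heq] with q hq
    rw [Fin.sum_univ_two] at hq
    -- Q, the chemical reaction in the application, is dropped pointwise before integration: it is
    -- nonnegative where b can be nonzero.
    have h2 : η q.1 * (b (w q) * Q q) ≤ 0 := by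
      rcases lt_or_ge (w q) 0 with h | h
      · exact mul_nonpos_of_nonneg_of_nonpos (hη0 _)
          (mul_nonpos_of_nonpos_of_nonneg (hb.nonpos _) (hQ q h))
      · rw [hb.eq_zero _ h]; simp
    have h3 : wt q = d * (D2w 0 0 q + D2w 1 1 q) + R q + Q q := by linarith
    simp only [h3]
    linarith
  rw [integral_add (hI hR) ((i0.fun_add i1).const_mul d), integral_const_mul,
    integral_add i0 i1] at h1
  nlinarith [mul_nonneg hd.le (neg_nonneg.2 k0), mul_nonneg hd.le (neg_nonneg.2 k1)]

end Pore

end SurfaceEstimate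

/-! ### Smooth approximation of the negative part -/

section NegativePart

/-- Smooth approximations of the negative part and of its derivative. -/
theorem exists_negStep_seq : ∃ b b' β : ℕ → ℝ → ℝ, (∀ n, IsNegStep (b n) (b' n)) ∧
    (∀ n s, HasDerivAt (β n) (b n s) s) ∧ (∀ n, β n 0 = 0) ∧
    (∀ s, Tendsto (fun n => b n s) atTop (𝓝 (if s < 0 then -1 else 0))) ∧
    ∀ s, Tendsto (fun n => β n s) atTop (𝓝 (max 0 (-s))) := by
  set B := Real.smoothTransition with hB
  have cB : ContDiff ℝ 1 B := Real.smoothTransition.contDiff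
  -- b_n is -1 for s ≤ -1/(n + 1) and exactly 0 for s ≥ 0, so the pointwise limit at the origin is
  -- 0, the value attached to nonnegative concentrations.
  set b : ℕ → ℝ → ℝ := fun n s => -B (-((n : ℝ) + 1) * s) with hb
  have hstep : ∀ n, IsNegStep (b n) fun s => ((n : ℝ) + 1) * deriv B (-((n : ℝ) + 1) * s) :=
    fun n => by
      have hn : (0 : ℝ) < n + 1 := by positivity
      refine ⟨fun s => ?_, ?_, fun s => ?_, fun s => ?_, fun s hs => ?_⟩
      · have h1 : HasDerivAt (fun s : ℝ => -((n : ℝ) + 1) * s) (-((n : ℝ) + 1)) s := by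
          simpa using (hasDerivAt_id s).const_mul (-((n : ℝ) + 1))
        have h2 := ((((cB.differentiable one_ne_zero) _).hasDerivAt).comp s h1).neg
        rw [mul_neg, neg_neg, mul_comm] at h2
        exact h2
      · exact continuous_const.mul ((cB.continuous_deriv le_rfl).comp (by fun_prop))
      · exact mul_nonneg hn.le (Real.smoothTransition.monotone.deriv_nonneg)
      · rw [hb, abs_neg, abs_of_nonneg (Real.smoothTransition.nonneg _)]
        exact Real.smoothTransition.le_one _
      · simp only [hb]
        rw [hB, Real.smoothTransition.zero_of_nonpos (by nlinarith), neg_zero]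
  have hneg : ∀ s < 0, Tendsto (fun n => b n s) atTop (𝓝 (-1)) := fun s hs => by
    obtain ⟨k, hk⟩ := exists_nat_ge ((-s)⁻¹)
    refine tendsto_const_nhds.congr' ?_
    filter_upwards [eventually_ge_atTop k] with n hn
    have h1 : (k : ℝ) ≤ n := by exact_mod_cast hn
    have h2 : (-s)⁻¹ * (-s) = 1 := inv_mul_cancel₀ (by linarith)
    simp only [hb]
    rw [hB, Real.smoothTransition.one_of_one_le (by nlinarith)]
  refine ⟨b, _, fun n s => ∫ r in 0..s, b n r, hstep, fun n s => ?_, fun n => by simp,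
    fun s => ?_, fun s => ?_⟩
  · have hc := (hstep n).continuous
    exact intervalIntegral.integral_hasDerivAt_right (hc.intervalIntegrable _ _)
      hc.aestronglyMeasurable.stronglyMeasurableAtFilter hc.continuousAt
  · split_ifs with hs
    · exact hneg s hs
    · exact tendsto_const_nhds.congr fun n => ((hstep n).eq_zero s (not_lt.1 hs)).symm
  · rcases le_or_gt 0 s with hs | hs
    · rw [max_eq_left (by linarith)]
      refine tendsto_const_nhds.congr fun n => ?_
      simp only
      rw [intervalIntegral.integral_congr (g := fun _ => 0)]
      · simp
      · intro r hr
        rw [uIcc_of_le hs] at hr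
        exact (hstep n).eq_zero r hr.1
    · rw [max_eq_right (by linarith)]
      have h1 : -s = ∫ _r in 0..s, (-1 : ℝ) := by simp
      rw [h1]
      refine intervalIntegral.tendsto_integral_filter_of_dominated_convergence (fun _ => 1)
        (Eventually.of_forall fun n => (hstep n).continuous.aestronglyMeasurable)
        (Eventually.of_forall fun n => ae_of_all _ fun r _ => (hstep n).abs_le r)
        (continuous_const.intervalIntegrable _ _) ?_
      filter_upwards [Measure.ae_ne volume (0 : ℝ)] with r hr hr'
      rw [uIoc_of_ge hs.le] at hr'
      exact hneg r (lt_of_le_of_ne hr'.2 hr)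

theorem tendsto_integral_comp_of_bounded {Y : Type*} [MeasurableSpace Y] {μ : Measure Y}
    {a : ℕ → ℝ → ℝ} {a' : ℝ → ℝ} {C : ℝ} (ha : ∀ n, Continuous (a n)) (haC : ∀ n s, |a n s| ≤ C)
    (hlim : ∀ s, Tendsto (fun n => a n s) atTop (𝓝 (a' s))) {f g : Y → ℝ}
    (hf : AEStronglyMeasurable f μ) (hg : Integrable g μ) :
    Tendsto (fun n => ∫ y, a n (f y) * g y ∂μ) atTop (𝓝 (∫ y, a' (f y) * g y ∂μ)) := by
  have := tendsto_integral_sum_weight (κ := Fin 1) (a := fun n _ y => a n (f y))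
    (a' := fun _ y => a' (f y)) (g := fun _ => g)
    (fun n _ => (ha n).comp_aestronglyMeasurable hf) (fun n _ _ => haC n _) (fun _ _ => hlim _)
    (fun _ => hg)
  simpa using this

/-- Since |b n| ≤ 1 and β n 0 = 0, |β n s| ≤ |s|, which gives the dominating function. -/
theorem tendsto_integral_primitive {Y : Type*} [MeasurableSpace Y] {μ : Measure Y}
    {β b : ℕ → ℝ → ℝ} {β' : ℝ → ℝ} {D : ℝ} (hβ : ∀ n s, HasDerivAt (β n) (b n s) s)
    (hβ0 : ∀ n, β n 0 = 0) (hb : ∀ n s, |b n s| ≤ 1)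
    (hlim : ∀ s, Tendsto (fun n => β n s) atTop (𝓝 (β' s))) {f g : Y → ℝ}
    (hf : Integrable f μ) (hg : AEStronglyMeasurable g μ) (hgD : ∀ y, |g y| ≤ D) :
    Tendsto (fun n => ∫ y, β n (f y) * g y ∂μ) atTop (𝓝 (∫ y, β' (f y) * g y ∂μ)) := by
  refine tendsto_integral_of_dominated_convergence (fun y => |f y| * D) (fun n => ?_)
    (hf.abs.mul_const D) (fun n => ae_of_all _ fun y => ?_)
    (ae_of_all _ fun y => (hlim _).mul_const _)
  · exact (integrable_comp_of_hasDerivAt (hβ n) (hβ0 n) (hb n) hf).1.mul hg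
  · rw [Real.norm_eq_abs, abs_mul]
    refine mul_le_mul ?_ (hgD y) (abs_nonneg _) (abs_nonneg _)
    simpa using abs_le_of_hasDerivAt (hβ n) (hβ0 n) (hb n) (f y)

end NegativePart

/-! ### Smallness of the negative parts near the initial time -/

section Decay

variable {E : Type*} [NormedAddCommGroup E] [NormedSpace ℝ E] [FiniteDimensional ℝ E]
  [MeasureSpace E] [BorelSpace E] [(volume : Measure E).IsAddHaarMeasure]

/-- The mass of the negative part tends to zero at time zero if the initial value is
nonnegative. -/
theorem HasInitialValue.negPart_small {T : ℝ} {G : Set E} (hG : Bornology.IsBounded G)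
    {p : ENNReal} (hp : 1 ≤ p) {f : ℝ × E → ℝ} {f₀ : E → ℝ}
    (h : HasInitialValue (volume.restrict G) p f f₀)
    (hf : IntegrableOn f (timeCyl T G)) (hf₀ : ∀ᵐ x ∂volume.restrict G, 0 ≤ f₀ x) {δ : ℝ}
    (hδ : 0 < δ) : ∃ τ > 0, ∀ᵐ t ∂volume.restrict (Ioo 0 T), t < τ →
      |∫ x in G, max 0 (-f (t, x))| ≤ δ := by
  have : ProperSpace E := FiniteDimensional.proper ℝ E
  have hfinG : IsFiniteMeasure (volume.restrict G) := ⟨by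
    rw [Measure.restrict_apply_univ]; exact hG.measure_lt_top⟩
  set m := volume.restrict G with hm
  -- The Hölder constant of the embedding of L^p into L¹ on the bounded set G.
  set C := m univ ^ (1 / (1 : ENNReal).toReal - 1 / p.toReal) with hC
  have hCt : C ≠ ⊤ := by
    refine ENNReal.rpow_ne_top_of_nonneg ?_ (measure_ne_top _ _)
    simp only [ENNReal.toReal_one, div_one, sub_nonneg]
    rcases eq_or_ne p ⊤ with rfl | hpt
    · simp
    · exact div_le_one_of_le₀ ((ENNReal.toReal_mono hpt hp).trans' (by simp)) ENNReal.toReal_nonneg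
  have h0 : Tendsto (fun t : ℝ => eLpNorm (fun x => f (t, x) - f₀ x) p m * C)
      (𝓝[>] (0 : ℝ) ⊓ ae (volume : Measure ℝ)) (𝓝 0) := by
    simpa using ENNReal.Tendsto.mul_const h (Or.inr hCt)
  have h1 := h0.eventually_le_const (u := ENNReal.ofReal δ) (by simpa using hδ)
  obtain ⟨s, hs, s', hs', hss⟩ := eventually_inf.1 h1
  obtain ⟨τ, hτ, hτs⟩ := mem_nhdsGT_iff_exists_Ioo_subset.1 hs
  refine ⟨τ, hτ, ?_⟩
  have hf' : Integrable f ((volume.restrict (Ioo 0 T)).prod m) := by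
    rw [hm, ← volume_restrict_timeCyl]; exact hf
  filter_upwards [hf'.prod_right_ae, ae_restrict_mem measurableSet_Ioo,
    ae_restrict_of_ae (s := Ioo 0 T) hs'] with t h2 h3 h4 h5
  have h6 := hss t ⟨hτs ⟨h3.1, h5⟩, h4⟩
  have h7 : AEStronglyMeasurable (fun x => max 0 (-f (t, x))) m :=
    (by fun_prop : Continuous fun r : ℝ => max 0 (-r)).comp_aestronglyMeasurable h2.1
  have h8 : ‖∫ x in G, max 0 (-f (t, x))‖ₑ ≤ ENNReal.ofReal δ := by
    refine (enorm_integral_le_lintegral_enorm _).trans ?_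
    rw [← eLpNorm_one_eq_lintegral_enorm]
    refine (eLpNorm_le_eLpNorm_mul_rpow_measure_univ hp h7).trans (le_trans ?_ h6)
    refine mul_le_mul_left (eLpNorm_mono_ae ?_) _
    -- As f₀ ≥ 0, the negative part of f is at most |f - f₀|.
    filter_upwards [hf₀] with x hx
    rw [Real.norm_eq_abs, Real.norm_eq_abs, abs_of_nonneg (le_max_left _ _)]
    exact max_le (abs_nonneg _) (by linarith [neg_le_abs (f (t, x) - f₀ x)])
  rwa [Real.enorm_eq_ofReal_abs, ENNReal.ofReal_le_ofReal_iff hδ.le] at h8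

/-- Integrals over shrinking initial time layers tend to zero. -/
theorem tendsto_integral_initial_layer {T : ℝ} {G : Set E} {F : ℝ × E → ℝ}
    (hF : IntegrableOn F (timeCyl T G))
    (hsmall : ∀ δ > 0, ∃ τ > 0, ∀ᵐ t ∂volume.restrict (Ioo 0 T), t < τ →
      |∫ x in G, F (t, x)| ≤ δ) {k : ℕ → ℝ → ℝ} {M : ℝ} (hk : ∀ n, Continuous (k n))
    (hkM : ∀ n t, |k n t| ≤ M * ((n : ℝ) + 1))
    (hk0 : ∀ (n : ℕ) t, 2 / ((n : ℝ) + 1) < t → k n t = 0) :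
    Tendsto (fun n => ∫ q in timeCyl T G, k n q.1 * F q) atTop (𝓝 0) := by
  have : ProperSpace E := FiniteDimensional.proper ℝ E
  have hM : 0 ≤ M := by
    have := (abs_nonneg _).trans (hkM 0 0)
    simpa using this
  have e : ∀ n, ∫ q in timeCyl T G, k n q.1 * F q =
      ∫ t in Ioo 0 T, k n t * ∫ x in G, F (t, x) := fun n => by
    rw [timeCyl, setIntegral_prod_volume]
    · simp only [integral_const_mul]
    · exact Integrable.bdd_mul (c := M * ((n : ℝ) + 1)) hF
        ((hk n).comp continuous_fst).aestronglyMeasurable (ae_of_all _ fun q => hkM n q.1)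
  simp only [e]
  rw [Metric.tendsto_atTop]
  intro ε hε
  -- The weight has size M(n + 1) on a layer of length at most 2/(n + 1), which contributes a factor
  -- 2M. This choice of δ leaves εM/(2M + 1) < ε.
  obtain ⟨τ, hτ, hs⟩ := hsmall (ε / (2 * M + 1) / 2) (by positivity)
  obtain ⟨N, hN⟩ := exists_nat_gt (2 / τ)
  refine ⟨N, fun n hn => ?_⟩
  have hn' : (N : ℝ) ≤ n := by exact_mod_cast hn
  have hn0 : (0 : ℝ) < n + 1 := by positivity
  have hlt : 2 / ((n : ℝ) + 1) < τ := by
    rw [div_lt_iff₀ hn0]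
    rw [div_lt_iff₀ hτ] at hN
    nlinarith
  have e2 : ∫ t in Ioo 0 T, k n t * ∫ x in G, F (t, x) =
      ∫ t in Ioo 0 T ∩ Iic (2 / ((n : ℝ) + 1)), k n t * ∫ x in G, F (t, x) := by
    refine (setIntegral_eq_of_subset_of_forall_sdiff_eq_zero measurableSet_Ioo inter_subset_left
      fun t ht => ?_)
    rw [hk0 n t (not_le.1 fun h => ht.2 ⟨ht.1, h⟩), zero_mul]
  have hsub : Ioo 0 T ∩ Iic (2 / ((n : ℝ) + 1)) ⊆ Ioc 0 (2 / ((n : ℝ) + 1)) :=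
    fun t ht => ⟨ht.1.1, ht.2⟩
  have hvol : volume.real (Ioo 0 T ∩ Iic (2 / ((n : ℝ) + 1))) ≤ 2 / ((n : ℝ) + 1) := by
    refine (measureReal_mono hsub (by simp)).trans_eq ?_
    simp only [Real.volume_real_Ioc, sub_zero, sup_eq_left]
    positivity
  have hb := norm_setIntegral_le_of_norm_le_const_ae (μ := volume)
    (s := Ioo 0 T ∩ Iic (2 / ((n : ℝ) + 1))) (f := fun t => k n t * ∫ x in G, F (t, x))
    (C := M * ((n : ℝ) + 1) * (ε / (2 * M + 1) / 2))
    ((measure_mono hsub).trans_lt (by simp)) (by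
      filter_upwards [ae_restrict_of_ae_restrict_of_subset inter_subset_left hs,
        ae_restrict_mem (measurableSet_Ioo.inter measurableSet_Iic)] with t h1 h2
      rw [Real.norm_eq_abs, abs_mul]
      exact mul_le_mul (hkM n t) (h1 (lt_of_le_of_lt h2.2 hlt)) (abs_nonneg _) (by positivity))
  rw [dist_zero_right, e2]
  refine hb.trans_lt ?_
  calc M * ((n : ℝ) + 1) * (ε / (2 * M + 1) / 2) * volume.real _
      ≤ M * ((n : ℝ) + 1) * (ε / (2 * M + 1) / 2) * (2 / ((n : ℝ) + 1)) :=
        mul_le_mul_of_nonneg_left hvol (by positivity)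
    _ = ε * (M / (2 * M + 1)) := by field_simp
    _ < ε := by
        refine mul_lt_of_lt_one_right hε ?_
        rw [div_lt_one (by positivity)]
        linarith

end Decay

/-! ### Test functions in time and vanishing of the mass -/

section Uniqueness

/-- Test functions `η n` in time whose derivatives are `-ψ` up to an initial layer. -/
theorem exists_time_test_seq {T : ℝ} (hT : 0 < T) {ψ : ℝ → ℝ} (hψ : ContDiff ℝ ∞ ψ)
    (hψc : HasCompactSupport ψ) (hψT : tsupport ψ ⊆ Ioo 0 T) (hψ0 : ∀ t, 0 ≤ ψ t) :
    ∃ (η k χ : ℕ → ℝ → ℝ) (M : ℝ), (∀ n, ContDiff ℝ ∞ (η n)) ∧ (∀ n, HasCompactSupport (η n)) ∧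
      (∀ n, tsupport (η n) ⊆ Ioo 0 T) ∧ (∀ n t, 0 ≤ η n t) ∧
      (∀ n t, deriv (η n) t = k n t - χ n t * ψ t) ∧ (∀ n, Continuous (k n)) ∧
      (∀ n t, |k n t| ≤ M * ((n : ℝ) + 1)) ∧
      (∀ (n : ℕ) t, 2 / ((n : ℝ) + 1) < t → k n t = 0) ∧ (∀ n, Continuous (χ n)) ∧
      (∀ n t, |χ n t| ≤ 1) ∧ ∀ t > 0, ∀ᶠ n in atTop, χ n t = 1 := by
  -- The last time in the support of ψ; inserting T/2 covers the case of an empty support.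
  obtain ⟨T', hT', hT'max⟩ := (hψc.isCompact.insert (T / 2)).exists_isGreatest
    (insert_nonempty _ _)
  have hT'T : T' < T := by
    rcases hT' with rfl | h
    · linarith
    · exact (hψT h).2
  have hψz : ∀ t, T' < t → ψ t = 0 := fun t ht => image_eq_zero_of_notMem_tsupport fun h =>
    not_lt.2 (hT'max (mem_insert_of_mem _ h)) ht
  -- θ(t) is the integral of ψ from t to T': it is nonnegative, vanishes after T' and has derivative
  -- -ψ.
  set θ : ℝ → ℝ := fun t => -∫ s in T'..t, ψ s with hθ
  have dθ : ∀ t, HasDerivAt θ (-ψ t) t := fun t =>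
    (intervalIntegral.integral_hasDerivAt_right (hψ.continuous.intervalIntegrable _ _)
      hψ.continuous.aestronglyMeasurable.stronglyMeasurableAtFilter hψ.continuous.continuousAt).neg
  have cθ : ContDiff ℝ ∞ θ := contDiff_infty_iff_deriv.2
    ⟨fun t => (dθ t).differentiableAt, by rw [funext fun t => (dθ t).deriv]; exact hψ.neg⟩
  have θz : ∀ t, T' ≤ t → θ t = 0 := fun t ht => by
    simp only [hθ]
    rw [intervalIntegral.integral_of_le ht, setIntegral_eq_zero_of_forall_eq_zero
      fun s hs => hψz s hs.1, neg_zero]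
  have θ0 : ∀ t, 0 ≤ θ t := fun t => by
    rcases le_total T' t with ht | ht
    · exact (θz t ht).ge
    · simp only [hθ]
      rw [← intervalIntegral.integral_symm]
      exact intervalIntegral.integral_nonneg ht fun s _ => hψ0 s
  set B := Real.smoothTransition with hB
  have cB : ContDiff ℝ ∞ B := Real.smoothTransition.contDiff
  have cB' : Continuous (deriv B) := cB.continuous_deriv (by simp)
  have dB : ∀ s, HasDerivAt B (deriv B s) s := fun s => ((cB.differentiable (by simp)) s).hasDerivAt
  have B0 : ∀ s, s ≤ 0 → deriv B s = 0 := fun s hs => by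
    have : IsLocalMin B s := Filter.Eventually.of_forall fun r => by
      rw [hB, Real.smoothTransition.zero_of_nonpos hs]; exact Real.smoothTransition.nonneg r
    exact this.deriv_eq_zero
  have B1 : ∀ s, 1 ≤ s → deriv B s = 0 := fun s hs => by
    have : IsLocalMax B s := Filter.Eventually.of_forall fun r => by
      rw [hB, Real.smoothTransition.one_of_one_le hs]; exact Real.smoothTransition.le_one r
    exact this.deriv_eq_zero
  obtain ⟨M₁, hM₁⟩ := (isCompact_Icc (a := (0 : ℝ)) (b := 1)).exists_bound_of_continuousOn
    cB'.continuousOn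
  obtain ⟨M₂, hM₂⟩ := (isCompact_Icc (a := (0 : ℝ)) (b := 2)).exists_bound_of_continuousOn
    cθ.continuous.continuousOn
  have hM₁0 : 0 ≤ M₁ := (norm_nonneg _).trans (hM₁ 0 ⟨le_rfl, zero_le_one⟩)
  have hM₂0 : 0 ≤ M₂ := (norm_nonneg _).trans (hM₂ 0 ⟨le_rfl, zero_le_two⟩)
  have hnpos : ∀ n : ℕ, (0 : ℝ) < n + 1 := fun n => by positivity
  have hlow : ∀ (n : ℕ) t, t ≤ 1 / ((n : ℝ) + 1) → ((n : ℝ) + 1) * t - 1 ≤ 0 := fun n t ht => by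
    rw [le_div_iff₀ (hnpos n)] at ht
    linarith
  have ηz : ∀ (n : ℕ) t, t ∉ Icc (1 / ((n : ℝ) + 1)) T' →
      B (((n : ℝ) + 1) * t - 1) * θ t = 0 := fun n t ht => by
    rcases le_or_gt t (1 / ((n : ℝ) + 1)) with h | h
    · rw [hB, Real.smoothTransition.zero_of_nonpos (hlow n t h), zero_mul]
    · rw [θz t (not_lt.1 fun h' => ht ⟨h.le, h'.le⟩), mul_zero]
  -- θ need not vanish at time 0, so it is multiplied by a factor that is 0 up to 1/(n + 1) and 1
  -- from 2/(n + 1) on. The derivative of this factor is the layer term k.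
  refine ⟨fun n t => B (((n : ℝ) + 1) * t - 1) * θ t,
    fun n t => ((n : ℝ) + 1) * deriv B (((n : ℝ) + 1) * t - 1) * θ t,
    fun n t => B (((n : ℝ) + 1) * t - 1), M₁ * M₂, fun n => ?_, fun n => ?_, fun n => ?_,
    fun n t => ?_, fun n t => ?_, fun n => ?_, fun n t => ?_, fun n t ht => ?_, fun n => ?_,
    fun n t => ?_, fun t ht => ?_⟩
  · exact (cB.comp (by fun_prop)).mul cθ
  · exact HasCompactSupport.intro isCompact_Icc fun t ht => ηz n t ht
  · refine (closure_minimal (fun t ht => ?_) isClosed_Icc).trans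
      (Icc_subset_Ioo (one_div_pos.2 (hnpos n)) hT'T)
    by_contra h
    exact ht (ηz n t h)
  · exact mul_nonneg (Real.smoothTransition.nonneg _) (θ0 t)
  · have h1 : HasDerivAt (fun t : ℝ => ((n : ℝ) + 1) * t - 1) ((n : ℝ) + 1) t := by
      simpa using ((hasDerivAt_id t).const_mul ((n : ℝ) + 1)).sub_const 1
    have h2 : HasDerivAt (fun t : ℝ => B (((n : ℝ) + 1) * t - 1) * θ t) _ t :=
      (HasDerivAt.comp (h₂ := B) t (dB _) h1).mul (dθ t)
    rw [h2.deriv]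
    simp only [Function.comp_apply]
    ring
  · exact (continuous_const.mul (cB'.comp (by fun_prop))).mul cθ.continuous
  · by_cases h : ((n : ℝ) + 1) * t - 1 ∈ Icc (0 : ℝ) 1
    · have ht : t ∈ Icc (0 : ℝ) 2 := by
        have h0 : (0 : ℝ) ≤ n := Nat.cast_nonneg n
        constructor <;> nlinarith [h.1, h.2]
      have := mul_le_mul (hM₁ _ h) (hM₂ _ ht) (norm_nonneg _) hM₁0
      rw [Real.norm_eq_abs, Real.norm_eq_abs] at this
      rw [abs_mul, abs_mul, abs_of_pos (hnpos n)]
      nlinarith [hnpos n]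
    · have : deriv B (((n : ℝ) + 1) * t - 1) = 0 := by
        rcases le_or_gt (((n : ℝ) + 1) * t - 1) 0 with h' | h'
        · exact B0 _ h'
        · exact B1 _ (not_lt.1 fun h'' => h ⟨h'.le, h''.le⟩)
      simp only [this]
      simpa using mul_nonneg (mul_nonneg hM₁0 hM₂0) (hnpos n).le
  · rw [div_lt_iff₀ (hnpos n)] at ht
    have h1 : deriv B (((n : ℝ) + 1) * t - 1) = 0 := B1 _ (by linarith)
    simp only [h1, mul_zero, zero_mul]
  · exact cB.continuous.comp (by fun_prop)
  · rw [hB, abs_of_nonneg (Real.smoothTransition.nonneg _)]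
    exact Real.smoothTransition.le_one _
  · obtain ⟨N, hN⟩ := exists_nat_ge (2 / t)
    filter_upwards [eventually_ge_atTop N] with n hn
    have hn' : (N : ℝ) ≤ n := by exact_mod_cast hn
    rw [div_le_iff₀ ht] at hN
    exact Real.smoothTransition.one_of_one_le (by nlinarith)

variable {E E' : Type*} [NormedAddCommGroup E] [NormedSpace ℝ E] [FiniteDimensional ℝ E]
  [MeasureSpace E] [BorelSpace E] [(volume : Measure E).IsAddHaarMeasure]
  [NormedAddCommGroup E'] [NormedSpace ℝ E'] [FiniteDimensional ℝ E']
  [MeasureSpace E'] [BorelSpace E'] [(volume : Measure E').IsAddHaarMeasure]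

/-- The layer term k disappears because the mass near time zero is small, and χ tends to 1, which
leaves -ψ. -/
theorem tendsto_integral_time_test {T : ℝ} {G : Set E} (hG : IsOpen G) {F : ℝ × E → ℝ}
    (hF : IntegrableOn F (timeCyl T G))
    (hsmall : ∀ δ > 0, ∃ τ > 0, ∀ᵐ t ∂volume.restrict (Ioo 0 T), t < τ →
      |∫ x in G, F (t, x)| ≤ δ) {ψ : ℝ → ℝ} (hψ : Continuous ψ) (hψ1 : ∀ t, |ψ t| ≤ 1)
    {k χ η' : ℕ → ℝ → ℝ} {M : ℝ} (hη' : ∀ n t, η' n t = k n t - χ n t * ψ t)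
    (hk : ∀ n, Continuous (k n)) (hkM : ∀ n t, |k n t| ≤ M * ((n : ℝ) + 1))
    (hk0 : ∀ (n : ℕ) t, 2 / ((n : ℝ) + 1) < t → k n t = 0) (hχ : ∀ n, Continuous (χ n))
    (hχ1 : ∀ n t, |χ n t| ≤ 1) (hχl : ∀ t > 0, ∀ᶠ n in atTop, χ n t = 1) :
    Tendsto (fun n => ∫ q in timeCyl T G, F q * η' n q.1) atTop
      (𝓝 (-∫ q in timeCyl T G, ψ q.1 * F q)) := by
  have : ProperSpace E := FiniteDimensional.proper ℝ E
  have i1 : Integrable (fun q : ℝ × E => ψ q.1 * F q) (volume.restrict (timeCyl T G)) :=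
    Integrable.bdd_mul (c := 1) hF (hψ.comp continuous_fst).aestronglyMeasurable
      (ae_of_all _ fun q => hψ1 q.1)
  have L1 := tendsto_integral_initial_layer hF hsmall hk hkM hk0
  have L2 := tendsto_integral_cutoff (χ := fun n (q : ℝ × E) => χ n q.1)
    (μ := volume.restrict (timeCyl T G))
    (fun n => ((hχ n).comp continuous_fst).aestronglyMeasurable) (fun n q => hχ1 n _)
    (by filter_upwards [ae_restrict_mem (timeCyl_isOpen T hG).measurableSet] with q hq
          using hχl _ hq.1.1) i1
  have L := L1.sub L2
  rw [zero_sub] at L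
  refine L.congr fun n => ?_
  rw [← integral_sub]
  · congr 1; ext q
    rw [hη']; ring
  · exact Integrable.bdd_mul (c := M * ((n : ℝ) + 1)) hF
      ((hk n).comp continuous_fst).aestronglyMeasurable (ae_of_all _ fun q => hkM n q.1)
  · exact i1.bdd_mul (c := 1) ((hχ n).comp continuous_fst).aestronglyMeasurable
      (ae_of_all _ fun q => hχ1 n q.1)

/-- Two nonnegative functions whose total mass does not increase in time and vanishes initially
are zero. -/
theorem ae_eq_zero_of_mass_nonincreasing {T : ℝ} (hT : 0 < T) {G : Set E} (hG : IsOpen G)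
    {G' : Set E'} (hG' : IsOpen G') {F : ℝ × E → ℝ} {F' : ℝ × E' → ℝ}
    (hF : IntegrableOn F (timeCyl T G)) (hF' : IntegrableOn F' (timeCyl T G'))
    (hF0 : ∀ q, 0 ≤ F q) (hF'0 : ∀ q, 0 ≤ F' q)
    (hsmall : ∀ δ > 0, ∃ τ > 0, ∀ᵐ t ∂volume.restrict (Ioo 0 T), t < τ →
      |∫ x in G, F (t, x)| ≤ δ)
    (hsmall' : ∀ δ > 0, ∃ τ > 0, ∀ᵐ t ∂volume.restrict (Ioo 0 T), t < τ →
      |∫ x in G', F' (t, x)| ≤ δ)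
    (hmass : ∀ η : ℝ → ℝ, ContDiff ℝ ∞ η → HasCompactSupport η → tsupport η ⊆ Ioo 0 T →
      (∀ t, 0 ≤ η t) → 0 ≤ (∫ q in timeCyl T G, F q * deriv η q.1) +
        ∫ q in timeCyl T G', F' q * deriv η q.1) :
    (∀ᵐ q ∂volume.restrict (timeCyl T G), F q = 0) ∧
      ∀ᵐ q ∂volume.restrict (timeCyl T G'), F' q = 0 := by
  have : ProperSpace E := FiniteDimensional.proper ℝ E
  have : ProperSpace E' := FiniteDimensional.proper ℝ E'
  obtain ⟨ψ, hψ, hψc, hψT, hψ0, hψ1, hψl⟩ := exists_cutoff_seq (X := ℝ)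
    (isOpen_Ioo (a := 0) (b := T))
  have hψab : ∀ m t, |ψ m t| ≤ 1 := fun m t => by rw [abs_of_nonneg (hψ0 m t)]; exact hψ1 m t
  have key : ∀ m, (∫ q in timeCyl T G, ψ m q.1 * F q) = 0 ∧
      (∫ q in timeCyl T G', ψ m q.1 * F' q) = 0 := fun m => by
    obtain ⟨η, k, χ, M, h1, h2, h3, h4, h5, h6, h7, h8, h9, h10, h11⟩ :=
      exists_time_test_seq hT (hψ m) (hψc m) (hψT m) (hψ0 m)
    have L := tendsto_integral_time_test hG hF hsmall (hψ m).continuous (hψab m)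
      (η' := fun n => deriv (η n)) h5 h6 h7 h8 h9 h10 h11
    have L' := tendsto_integral_time_test hG' hF' hsmall' (hψ m).continuous (hψab m)
      (η' := fun n => deriv (η n)) h5 h6 h7 h8 h9 h10 h11
    -- In the limit the monotonicity of the mass says that minus the sum of two nonnegative
    -- integrals is nonnegative, so both vanish.
    have h12 := ge_of_tendsto' (L.add L') fun n => hmass (η n) (h1 n) (h2 n) (h3 n) (h4 n)
    have h13 : 0 ≤ ∫ q in timeCyl T G, ψ m q.1 * F q :=
      integral_nonneg fun q => mul_nonneg (hψ0 m _) (hF0 q)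
    have h14 : 0 ≤ ∫ q in timeCyl T G', ψ m q.1 * F' q :=
      integral_nonneg fun q => mul_nonneg (hψ0 m _) (hF'0 q)
    constructor <;> linarith
  constructor
  · have h1 : ∀ m, ∀ᵐ q ∂volume.restrict (timeCyl T G), ψ m q.1 * F q = 0 := fun m =>
      (integral_eq_zero_iff_of_nonneg (fun q => mul_nonneg (hψ0 m _) (hF0 q))
        (Integrable.bdd_mul (c := 1) hF ((hψ m).continuous.comp
          continuous_fst).aestronglyMeasurable (ae_of_all _ fun q => hψab m q.1))).1 (key m).1
    filter_upwards [ae_all_iff.2 h1, ae_restrict_mem (timeCyl_isOpen T hG).measurableSet]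
      with q hq hq'
    obtain ⟨m, hm⟩ := (hψl _ hq'.1).exists
    simpa [hm] using hq m
  · have h1 : ∀ m, ∀ᵐ q ∂volume.restrict (timeCyl T G'), ψ m q.1 * F' q = 0 := fun m =>
      (integral_eq_zero_iff_of_nonneg (fun q => mul_nonneg (hψ0 m _) (hF'0 q))
        (Integrable.bdd_mul (c := 1) hF' ((hψ m).continuous.comp
          continuous_fst).aestronglyMeasurable (ae_of_all _ fun q => hψab m q.1))).1 (key m).2
    filter_upwards [ae_all_iff.2 h1, ae_restrict_mem (timeCyl_isOpen T hG').measurableSet]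
      with q hq hq'
    obtain ⟨m, hm⟩ := (hψl _ hq'.1).exists
    simpa [hm] using hq m

end Uniqueness

/-! ### Growth and signs of the rates -/

section Rates

theorem SorptionRegular.continuous {r : ℝ → ℝ → ℝ} (h : SorptionRegular r) :
    Continuous fun x : ℝ × ℝ => r x.1 x.2 := h.1.continuous

/-- A bounded gradient gives linear growth, enough on a finite measure space. -/
theorem SorptionRegular.integrable {r : ℝ → ℝ → ℝ} (h : SorptionRegular r) {Y : Type*}
    [MeasurableSpace Y] {μ : Measure Y} [IsFiniteMeasure μ] {f g : Y → ℝ} (hf : Integrable f μ)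
    (hg : Integrable g μ) : Integrable (fun y => r (f y) (g y)) μ := by
  obtain ⟨C, hC⟩ := h.2.1
  have hC0 : 0 ≤ C := (norm_nonneg _).trans (hC 0)
  refine ((((hf.abs.add hg.abs).const_mul C).add (integrable_const |r 0 0|))).mono'
    (h.continuous.comp_aestronglyMeasurable (hf.1.prodMk hg.1)) (ae_of_all _ fun y => ?_)
  have h1 := Convex.norm_image_sub_le_of_norm_fderiv_le (𝕜 := ℝ)
    (f := fun x : ℝ × ℝ => r x.1 x.2) (C := C) (s := univ) (x := 0) (y := (f y, g y))
    (fun x _ => (h.1.differentiable (by simp)) x) (fun x _ => hC x) convex_univ (mem_univ _)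
    (mem_univ _)
  have h2 : ‖((f y, g y) : ℝ × ℝ)‖ ≤ |f y| + |g y| := by
    rw [Prod.norm_def]
    exact max_le (by simp) (by simp)
  simp only [sub_zero, Prod.fst_zero, Prod.snd_zero] at h1
  have h3 := h1.trans (mul_le_mul_of_nonneg_left h2 hC0)
  have h4 := norm_le_norm_add_norm_sub' (r (f y) (g y)) (r 0 0)
  simp only [Pi.add_apply]
  rw [Real.norm_eq_abs, Real.norm_eq_abs (r 0 0)] at h4
  rw [Real.norm_eq_abs]
  linarith

/-- The linear bounds concern nonnegative arguments only. Monotonicity reduces to a = 0, where the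
upper bound is zero. -/
theorem SorptionBounded.nonpos {r : ℝ → ℝ → ℝ} (h : SorptionBounded r) (hm : SorptionMonotone r)
    {a b : ℝ} (ha : a ≤ 0) (hb : 0 ≤ b) : r a b ≤ 0 := by
  obtain ⟨kad, kde, -, -, hk⟩ := h
  have h1 := (hk 0 b le_rfl hb).2
  rw [mul_zero] at h1
  exact (hm.1 b ha).trans h1

theorem SorptionBounded.nonneg {r : ℝ → ℝ → ℝ} (h : SorptionBounded r) (hm : SorptionMonotone r)
    {a b : ℝ} (ha : 0 ≤ a) (hb : b ≤ 0) : 0 ≤ r a b := by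
  obtain ⟨kad, kde, -, -, hk⟩ := h
  have h1 := (hk a 0 ha le_rfl).1
  rw [mul_zero] at h1
  exact h1.trans (hm.2 a hb)

/-- The positive part of y has i-th entry 0, which is where quasi-positivity applies. -/
theorem QuasiPositive.extendPos_nonneg {N : ℕ}
    {r : EuclideanSpace ℝ (Fin N) → EuclideanSpace ℝ (Fin N)} (h : QuasiPositive r)
    {y : Fin N → ℝ} {i : Fin N} (hi : y i ≤ 0) : 0 ≤ extendPos r y i :=
  h i _ (fun _ => le_max_left _ _) (max_eq_left hi)

end Rates

/-! ### Total mass of the negative parts of the two phases -/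

section Mass

variable {E E' : Type*} [NormedAddCommGroup E] [NormedSpace ℝ E] [FiniteDimensional ℝ E]
  [MeasureSpace E] [BorelSpace E] [(volume : Measure E).IsAddHaarMeasure]
  [NormedAddCommGroup E'] [NormedSpace ℝ E'] [FiniteDimensional ℝ E']
  [MeasureSpace E'] [BorelSpace E'] [(volume : Measure E').IsAddHaarMeasure]

/-- If the exchange rate `R` between two phases has the right sign, then the total mass of the
negative parts does not increase in time. -/
theorem integral_negPart_mul_deriv_nonneg {T : ℝ} {G : Set E} (hG : IsOpen G) {G' : Set E'}
    (hG' : IsOpen G') {c ct : ℝ × E → ℝ} {w wt a R : ℝ × E' → ℝ}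
    (hc : HasWeakDeriv T G (1, 0) c ct) (hci : IntegrableOn c (timeCyl T G))
    (hcti : IntegrableOn ct (timeCyl T G))
    (hw : HasWeakDeriv T G' (1, 0) w wt) (hwi : IntegrableOn w (timeCyl T G'))
    (hwti : IntegrableOn wt (timeCyl T G'))
    (ha : AEStronglyMeasurable a (volume.restrict (timeCyl T G')))
    (hR : IntegrableOn R (timeCyl T G'))
    (hsign : ∀ q, (a q < 0 → 0 ≤ w q → R q ≤ 0) ∧ (0 ≤ a q → w q < 0 → 0 ≤ R q))
    {η : ℝ → ℝ} (hη : ContDiff ℝ ∞ η) (hηc : HasCompactSupport η) (hηT : tsupport η ⊆ Ioo 0 T)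
    (hη0 : ∀ t, 0 ≤ η t)
    (hest : ∀ b b', IsNegStep b b' →
      (∫ q in timeCyl T G, η q.1 * (b (c q) * ct q)) ≤
        -∫ q in timeCyl T G', η q.1 * (b (a q) * R q))
    (hest' : ∀ b b', IsNegStep b b' →
      (∫ q in timeCyl T G', η q.1 * (b (w q) * wt q)) ≤
        ∫ q in timeCyl T G', η q.1 * (b (w q) * R q)) :
    0 ≤ (∫ q in timeCyl T G, max 0 (-c q) * deriv η q.1) +
      ∫ q in timeCyl T G', max 0 (-w q) * deriv η q.1 := by
  have : ProperSpace E := FiniteDimensional.proper ℝ E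
  have : ProperSpace E' := FiniteDimensional.proper ℝ E'
  obtain ⟨b, b', β, hb, hβ, hβ0, hbl, hβl⟩ := exists_negStep_seq
  obtain ⟨D, hD⟩ := hη.continuous.bounded_above_of_compact_support hηc
  have hη' : Continuous (deriv η) := hη.continuous_deriv (by simp)
  obtain ⟨D', hD'⟩ := hη'.bounded_above_of_compact_support hηc.deriv
  have L1 := tendsto_integral_primitive (μ := volume.restrict (timeCyl T G)) hβ hβ0
    (fun n => (hb n).abs_le) hβl hci (g := fun q => deriv η q.1)
    (hη'.comp continuous_fst).aestronglyMeasurable (fun q => hD' q.1)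
  have L2 := tendsto_integral_primitive (μ := volume.restrict (timeCyl T G')) hβ hβ0
    (fun n => (hb n).abs_le) hβl hwi (g := fun q => deriv η q.1)
    (hη'.comp continuous_fst).aestronglyMeasurable (fun q => hD' q.1)
  have hηR : Integrable (fun q => η q.1 * R q) (volume.restrict (timeCyl T G')) :=
    Integrable.bdd_mul (c := D) hR (hη.continuous.comp continuous_fst).aestronglyMeasurable
      (ae_of_all _ fun q => hD q.1)
  have L3 := tendsto_integral_comp_of_bounded (fun n => (hb n).continuous)
    (fun n => (hb n).abs_le) hbl ha hηR
  have L4 := tendsto_integral_comp_of_bounded (fun n => (hb n).continuous)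
    (fun n => (hb n).abs_le) hbl hwi.1 hηR
  have hmeas : ∀ {f : ℝ × E' → ℝ}, AEStronglyMeasurable f (volume.restrict (timeCyl T G')) →
      Integrable (fun q => (if f q < 0 then (-1 : ℝ) else 0) * (η q.1 * R q))
        (volume.restrict (timeCyl T G')) := fun {f} hf => by
    refine hηR.bdd_mul (c := 1) ?_ (ae_of_all _ fun q => by split_ifs <;> simp)
    have hm : Measurable fun s : ℝ => if s < 0 then (-1 : ℝ) else 0 :=
      Measurable.ite measurableSet_Iio measurable_const measurable_const
    exact (hm.comp_aemeasurable hf.aemeasurable).aestronglyMeasurable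
  have hlim : 0 ≤ (∫ q in timeCyl T G', (if a q < 0 then (-1 : ℝ) else 0) * (η q.1 * R q)) -
      ∫ q in timeCyl T G', (if w q < 0 then (-1 : ℝ) else 0) * (η q.1 * R q) := by
    rw [← integral_sub (hmeas ha) (hmeas hwi.1)]
    refine integral_nonneg fun q => ?_
    have h1 := hη0 q.1
    simp only [Pi.zero_apply]
    -- If a and w are both negative or both nonnegative, the contributions of the two phases cancel
    -- exactly. In the mixed cases only one of them is active and `hsign` gives the sign.
    rcases lt_or_ge (a q) 0 with ha | ha <;> rcases lt_or_ge (w q) 0 with hw | hw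
    · simp [ha, hw]
    · have := mul_nonpos_of_nonneg_of_nonpos h1 ((hsign q).1 ha hw)
      simpa [ha, not_lt.2 hw] using this
    · have := mul_nonneg h1 ((hsign q).2 ha hw)
      simpa [not_lt.2 ha, hw] using this
    · simp [not_lt.2 ha, not_lt.2 hw]
  refine hlim.trans (le_of_tendsto_of_tendsto' (L3.sub L4) (L1.add L2) fun n => ?_)
  have e1 := hc.time_chain_rule hG hci hcti (hβ n) (hβ0 n) (hb n).continuous (hb n).abs_le
    hη hηc hηT
  have e2 := hw.time_chain_rule hG' hwi hwti (hβ n) (hβ0 n) (hb n).continuous (hb n).abs_le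
    hη hηc hηT
  have e3 : ∀ f : ℝ × E' → ℝ, ∫ q in timeCyl T G', b n (f q) * (η q.1 * R q) =
      ∫ q in timeCyl T G', η q.1 * (b n (f q) * R q) := fun f => by
    congr 1; ext q; ring
  rw [e1, e2, e3, e3]
  linarith [hest _ _ (hb n), hest' _ _ (hb n)]

theorem HasWeakDeriv.mono {T : ℝ} {G G' : Set E} {v : ℝ × E} {f g : ℝ × E → ℝ}
    (h : HasWeakDeriv T G v f g) (hG : G' ⊆ G) : HasWeakDeriv T G' v f g :=
  have h' := h.weakDerivOn.mono (prod_mono_right hG : timeCyl T G' ⊆ timeCyl T G)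
  ⟨h'.locInt, h'.locInt_deriv, h'.byParts⟩

end Mass

/-! ### Null sets of the active surface in coordinates -/

namespace Pore

variable (P : Pore) {T : ℝ}

theorem injOn_lateral : InjOn P.lateral P.cell := by
  rintro ⟨s, z⟩ ⟨hs, -⟩ ⟨s', z'⟩ ⟨hs', -⟩ h
  simp only [lateral, Prod.mk.injEq] at h
  exact Prod.ext (P.injOn (Ioo_subset_Ico_self hs) (Ioo_subset_Ico_self hs') h.1) h.2

/-- Almost everywhere statements on `(0,T) × Σ` can be checked in the coordinates `(t, s, z)`. -/
theorem ae_timeProd_surfaceMeasure {p : ℝ × Space → Prop}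
    (h : ∀ᵐ q ∂volume.restrict (timeCyl T P.cell), p (q.1, P.lateral q.2)) :
    ∀ᵐ q ∂timeProd T P.surfaceMeasure, p q := by
  set j : ℝ × (ℝ × ℝ) → ℝ × Space := fun q => (q.1, P.lateral q.2) with hj
  have cj : Continuous j := continuous_fst.prodMk (P.continuous_lateral.comp continuous_snd)
  have hC : MeasurableSet (timeCyl T P.cell) := (timeCyl_isOpen T P.isOpen_cell).measurableSet
  -- The predicate need not be measurable. The exceptional set is enlarged to a measurable one, and
  -- the image of the good set is measurable because the chart is continuous and injective on the
  -- cell.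
  obtain ⟨Z, hZ, hZm, hZ0⟩ := exists_measurable_superset_of_null (ae_iff.1 h)
  have hS : MeasurableSet (j '' (timeCyl T P.cell \ Z)) := by
    refine (hC.diff hZm).image_of_continuousOn_injOn cj.continuousOn ?_
    rintro ⟨t, x⟩ ⟨hx, -⟩ ⟨t', x'⟩ ⟨hx', -⟩ h
    simp only [hj, Prod.mk.injEq] at h
    exact Prod.ext h.1 (P.injOn_lateral hx.2 hx'.2 h.2)
  have hmap : timeProd T P.surfaceMeasure = (volume.restrict (timeCyl T P.cell)).map j :=
    (map_timeCyl T P.cell P.continuous_lateral).symm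
  rw [hmap, ae_iff]
  refine measure_mono_null (t := (j '' (timeCyl T P.cell \ Z))ᶜ) ?_ ?_
  · rintro q hq ⟨q', hq', rfl⟩
    exact hq'.2 (hZ hq)
  · rw [Measure.map_apply cj.measurable hS.compl]
    refine measure_mono_null (t := (timeCyl T P.cell)ᶜ ∪ Z) (fun q hq => ?_)
      (measure_union_null ?_ hZ0)
    · by_contra hq'
      rw [mem_union, not_or, notMem_compl_iff] at hq'
      exact hq ⟨q, hq', rfl⟩
    · rw [Measure.restrict_apply hC.compl, compl_inter_self, measure_empty]

end Pore

end Catalysis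

end

theorem mainTheorem4 (P : Catalysis.Pore) {N : ℕ} (T p : ℝ) (hT : 0 < T) (hp : 1 < p)
    (d dS : Fin N → ℝ) (hd : ∀ i, 0 < d i) (hdS : ∀ i, 0 < dS i)
    (u : Fin 3 → ℝ × Catalysis.Space → ℝ)
    (hu : Catalysis.VelocityAssumption P T (ENNReal.ofReal p) u)
    (rs : Fin N → ℝ → ℝ → ℝ)
    (hrsF : ∀ i, Catalysis.SorptionRegular (rs i))
    (hrsM : ∀ i, Catalysis.SorptionMonotone (rs i))
    (hrsB : ∀ i, Catalysis.SorptionBounded (rs i))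
    (rc : EuclideanSpace ℝ (Fin N) → EuclideanSpace ℝ (Fin N))
    (hrcF : ContDiffOn ℝ 1 rc (Catalysis.orthant N))
    (hrcN : Catalysis.QuasiPositive rc)
    (hrcP : Catalysis.PolynomialGrowth p rc)
    (f g : Fin N → ℝ × Catalysis.Space → ℝ) (c₀ cS₀ : Fin N → Catalysis.Space → ℝ)
    (hf : ∀ i, MemLp (f i) (ENNReal.ofReal p)
      (volume.restrict (Catalysis.timeCyl T P.bulk)))
    (hf_nonneg : ∀ i, ∀ᵐ q ∂(volume.restrict (Catalysis.timeCyl T P.bulk)), 0 ≤ f i q)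
    (hg_nonpos : ∀ i, ∀ᵐ q ∂(volume.restrict (Catalysis.timeCyl T P.A)),
      g i (q.1, P.inlet q.2) ≤ 0)
    (hc₀ : ∀ i, ∀ᵐ x ∂(volume.restrict P.bulk), 0 ≤ c₀ i x)
    (hcS₀ : ∀ i, ∀ᵐ x ∂P.surfaceMeasure, 0 ≤ cS₀ i x)
    (c cS : Fin N → ℝ × Catalysis.Space → ℝ)
    (hsol : Catalysis.IsStrongSolution P T (ENNReal.ofReal p) d dS u rs rc f g c₀ cS₀ c cS) :
    ∀ i, (∀ᵐ q ∂(volume.restrict (Catalysis.timeCyl T P.bulk)), 0 ≤ c i q) ∧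
      ∀ᵐ q ∂(Catalysis.timeProd T P.surfaceMeasure), 0 ≤ cS i q := by
  intro i
  have hp1 : 1 ≤ ENNReal.ofReal p := by
    rw [← ENNReal.ofReal_one]; exact ENNReal.ofReal_le_ofReal hp.le
  have hfin := Catalysis.isFiniteMeasure_timeCyl T P.isBounded_bulk
  have hfin' := Catalysis.isFiniteMeasure_timeCyl T P.isBounded_cell
  obtain ⟨uB, DuB, huB, hsol⟩ := hsol
  obtain ⟨ct, Dc, D2c, cB, DcB, wt, Dw, D2w, wR, DwR, hjet, htr, hjetS, htrS, heq, heqS, hin,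
    hlat, hout, hrim, hini, hiniS⟩ := hsol i
  choose ut Du D2u hjetu using hu.regular
  obtain ⟨ν, Dν, hν, hνin, hνlat, hνout⟩ := hu.boundary
  -- The velocity is approximated twice, once for the trace carrying the sign conditions and once
  -- for the trace in the inflow condition, so that `inlet_unique` can identify the two.
  choose U hU using fun j => P.exists_bulkApprox hp1 (hjetu j) (hν j)
  choose U' hU' using fun j => P.exists_bulkApprox hp1 (hjetu j) (huB j)
  obtain ⟨V, hV⟩ := P.exists_bulkApprox hp1 hjet htr
  have hdiv := Catalysis.ae_sum_weakDeriv_eq_zero P.isOpen_bulk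
    (fun j => (hjetu j).weak_grad j) hu.div_free
  have hin' : ∀ᵐ q ∂volume.restrict (Catalysis.timeCyl T P.A),
      (∑ j, ν j (q.1, P.inlet q.2) * Catalysis.Pore.normalIn j) * cB (q.1, P.inlet q.2) ≤
        d i * ∑ j, Catalysis.Pore.normalIn j * DcB j (q.1, P.inlet q.2) := by
    filter_upwards [hin, hg_nonpos i, ae_all_iff.2 fun j => (hU j).inlet_unique (hU' j)]
      with q h1 h2 h3
    simp only [h3]
    linarith
  set w := P.pull (cS i) with hw
  set R : ℝ × (ℝ × ℝ) → ℝ := fun q => rs i (P.pull cB q) (w q) with hR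
  have hRi : Integrable R (volume.restrict (Catalysis.timeCyl T P.cell)) :=
    (hrsF i).integrable hV.bdry.lat.int (hjetS.memLp.integrable hp1)
  have hrim' : ∀ᵐ q ∂Catalysis.timeProd T P.rimMeasure, DwR 1 q = 0 := by
    filter_upwards [hrim] with q hq
    exact (mul_eq_zero.1 hq).resolve_left (neg_ne_zero.2 (hdS i).ne')
  have hci := hjet.memLp.integrable hp1
  have hwi := hjetS.memLp.integrable hp1
  have hpos : ∀ {Y : Type} [MeasurableSpace Y] {μ : Measure Y} {f : Y → ℝ}, Integrable f μ →
      Integrable (fun y => max 0 (-f y)) μ := fun hf => by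
    simpa [max_comm] using hf.neg.pos_part
  -- Applied to the negative parts of c in Ω and of cS on Σ. The sorption rate R is the exchange
  -- between the two phases, and its sign conditions come from the monotonicity and the linear
  -- bounds.
  have hzero := Catalysis.ae_eq_zero_of_mass_nonincreasing hT P.isOpen_bulk P.isOpen_cell
    (hpos hci) (hpos hwi) (fun q => le_max_left _ _) (fun q => le_max_left _ _)
    (fun δ hδ => hini.negPart_small P.isBounded_bulk hp1 hci (hc₀ i) hδ)
    (fun δ hδ => hiniS.negPart_small P.isBounded_cell hp1 hwi
      (ae_of_ae_map P.continuous_lateral.aemeasurable (hcS₀ i)) hδ)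
    fun η hη hηc hηT hη0 => by
      obtain ⟨D, hD⟩ := hη.continuous.bounded_above_of_compact_support hηc
      refine Catalysis.integral_negPart_mul_deriv_nonneg P.isOpen_bulk P.isOpen_cell
        hjet.weak_dt hci (hjet.memLp_dt.integrable hp1)
        (hjetS.weak_dt.mono P.cell_subset_strip) hwi (hjetS.memLp_dt.integrable hp1)
        (a := P.pull cB) hV.bdry.lat.int.1 hRi (fun q => ⟨fun h h' => ?_, fun h h' => ?_⟩)
        hη hηc hηT hη0 (fun b b' hb => ?_) (fun b b' hb => ?_)
      · exact (hrsB i).nonpos (hrsM i) h.le h'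
      · exact (hrsB i).nonneg (hrsM i) h h'.le
      · exact Catalysis.Pore.BulkApprox.integral_time_deriv_le hU hV hdiv hνin hνlat hνout (hd i)
          (hjet.memLp_dt.integrable hp1) ((hf i).integrable hp1) (hf_nonneg i) heq hin' hlat hout
          hb hη hη0 hD
      · exact Catalysis.Pore.surface_integral_time_deriv_le hp1 hjetS htrS
          (P.pull_add_shift (cS i)) hrim' (hdS i) hRi
          (fun q hq => hrcN.extendPos_nonneg (i := i) hq.le) heqS hb hη hηc hηT hη0
  refine ⟨?_, P.ae_timeProd_surfaceMeasure ?_⟩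
  · filter_upwards [hzero.1] with q hq
    linarith [le_max_right 0 (-c i q)]
  · filter_upwards [hzero.2] with q hq
    have := le_max_right 0 (-w q)
    change 0 ≤ w q
    linarith
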